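/- All graphs are finite, undirected, simple and connected. A split graph is a graph whose vertex set can be partitioned into a clique and an independent set. An LBFS ordering of $G$ is a vertex ordering $\sigma$ that can be produced by the following search: initially all labels are empty; in step $i = 1, \dots, |V(G)|$ one picks as $\sigma(i)$ an unnumbered vertex $x$ such that no unnumbered vertex $y$ satisfies $\mathrm{label}(x) \prec \mathrm{label}(y)$, and then adds $i$ to the labels of the unnumbered neighbors of $\sigma(i)$; here $A \prec B$ if and only if $A \subsetneq B$ or $\min(A \setminus B) > \min(B \setminus A)$. The partial search order problem of LBFS asks, given a graph $G$ and a (reflexive) partial order $\pi$ on $V(G)$, whether there is an LBFS ordering $\sigma$ of $G$ that extends $\pi$, i.e., such that $x$ precedes $y$ in $\sigma$ whenever $(x,y) \in \pi$ and $x \neq y$. Theorem. On split graphs the partial search order problem of LBFS can be solved in time $O(|V(G)| \cdot |\pi|)$, where $|\pi|$ is the number of pairs in $\pi$ (reflexive pairs included). That is, there are a program for a word RAM with words of $O(\log |V(G)|)$ bits and a constant $c$ such that for every connected split graph $G$ with vertex set $\{0, \dots, n-1\}$ and every partial order $\pi$ on $V(G)$, given as $n$, a list of the pairs of adjacent vertices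 and a list of the pairs of $\pi$ (each in arbitrary order), the program halts after at most $c \cdot |V(G)| \cdot |\pi|$ steps and correctly decides whether some LBFS ordering of $G$ extends $\pi$. -/

import Mathlib

namespace PSOP

/-! ### Split graphs and graph searches -/

/-- A split graph: the vertex set is partitioned into a clique `C` and an independent set `Cᶜ`. -/
def IsSplitGraph {V : Type*} (G : SimpleGraph V) : Prop :=
  ∃ C : Set V, G.IsClique C ∧ G.IsIndepSet Cᶜ

/-- The label of the vertex `w` in the generic label search at the moment when the positions
`0, …, i - 1` of the ordering `σ` have been filled and `w` is still unnumbered.  The search adds the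
(one-based) number `j + 1` of each visited vertex `σ j` to the labels of its unnumbered neighbors. -/
noncomputable def label {V : Type*} {n : ℕ} (G : SimpleGraph V) (σ : Fin n ≃ V) (i : Fin n) (w : V) :
    Finset ℕ :=
  open Classical in
  (Finset.univ.filter fun j : Fin n => j < i ∧ G.Adj (σ j) w).image fun j : Fin n => (j : ℕ) + 1

/-- `σ` can be produced by the label search with the strict label order `prec`: in every step `i`,
the chosen vertex `σ i` is eligible, that is, no vertex `y` which is unnumbered in step `i` has a
label that is larger with respect to `prec`. -/
def IsLabelSearchOrdering {V : Type*} {n : ℕ} (prec : Finset ℕ → Finset ℕ → Prop)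
    (G : SimpleGraph V) (σ : Fin n ≃ V) : Prop :=
  ∀ i : Fin n, ¬ ∃ y : V, i ≤ σ.symm y ∧ prec (label G σ i (σ i)) (label G σ i y)

/-- The label order of LBFS: `A ≺ B` iff `A ⊊ B` or `min (A \ B) > min (B \ A)`.
(`Finset.min` takes values in `WithTop ℕ` and the minimum of the empty set is `⊤`.) -/
def lbfsPrec (A B : Finset ℕ) : Prop :=
  A ⊂ B ∨ (B \ A).min < (A \ B).min

/-- `σ` is an LBFS ordering of `G`. -/
def IsLBFSOrdering {V : Type*} {n : ℕ} (G : SimpleGraph V) (σ : Fin n ≃ V) : Prop :=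
  IsLabelSearchOrdering lbfsPrec G σ

/-- The vertex ordering `σ` is a linear extension of the partial order `π`. -/
def Extends {V : Type*} {n : ℕ} (σ : Fin n ≃ V) (π : V → V → Prop) : Prop :=
  ∀ x y : V, π x y → x ≠ y → σ.symm x < σ.symm y

/-- The question of the partial search order problem of LBFS: is there an LBFS ordering of `G`
which extends `π`? -/
def LBFSExtendable {n : ℕ} (G : SimpleGraph (Fin n)) (π : Fin n → Fin n → Prop) : Prop :=
  ∃ σ : Fin n ≃ Fin n, IsLBFSOrdering G σ ∧ Extends σ π

/-- The number `|π|` of pairs in the relation `π` (reflexive pairs included). -/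
noncomputable def relSize {n : ℕ} (π : Fin n → Fin n → Prop) : ℕ :=
  {p : Fin n × Fin n | π p.1 p.2}.ncard

/-! ### A word RAM

Programs of a random access machine in structured form.  The machine has finitely many registers and
finitely many arrays that occur in its program, all holding natural numbers that fit into a machine
word.  `W` is the number of different words (a word of `w` bits gives `W = 2 ^ w`); a computation
that produces a number which does not fit gets stuck. -/

/-- Memory contents: `reg x` is the content of register `x`, and `arr a j` is the cell with index `j`
of array `a`. -/
structure Store where
  reg : ℕ → ℕ
  arr : ℕ → ℕ → ℕ

/-- Change one register. -/
def Store.setReg (s : Store) (x v : ℕ) : Store :=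
  { s with reg := Function.update s.reg x v }

/-- Change one array cell. -/
def Store.setArr (s : Store) (a j v : ℕ) : Store :=
  { s with arr := Function.update s.arr a (Function.update (s.arr a) j v) }

/-- Arithmetic expressions.  `get a e` reads the cell with index `e` of array `a`, and `sub` is
truncated subtraction. -/
inductive Expr where
  | lit (k : ℕ)
  | reg (x : ℕ)
  | get (a : ℕ) (e : Expr)
  | add (e f : Expr)
  | sub (e f : Expr)
  | mul (e f : Expr)

/-- Tests. -/
inductive Test where
  | eq (e f : Expr)
  | lt (e f : Expr)
  | not (b : Test)
  | and (b c : Test)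

/-- Programs. -/
inductive Cmd where
  | skip
  | assign (x : ℕ) (e : Expr)
  | store (a : ℕ) (i e : Expr)
  | seq (p q : Cmd)
  | ite (b : Test) (p q : Cmd)
  | while (b : Test) (p : Cmd)

/-- `v`, if it fits into a word. -/
def fits (W v : ℕ) : Option ℕ :=
  if v < W then some v else none

/-- The value of an expression; `none` if some intermediate result does not fit into a word. -/
def Expr.eval (W : ℕ) (s : Store) : Expr → Option ℕ
  | .lit k => fits W k
  | .reg x => fits W (s.reg x)
  | .get a e => (e.eval W s).bind fun j => fits W (s.arr a j)
  | .add e f => (e.eval W s).bind fun u => (f.eval W s).bind fun v => fits W (u + v)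
  | .sub e f => (e.eval W s).bind fun u => (f.eval W s).bind fun v => fits W (u - v)
  | .mul e f => (e.eval W s).bind fun u => (f.eval W s).bind fun v => fits W (u * v)

/-- The number of elementary steps for evaluating an expression: one per operation. -/
def Expr.cost : Expr → ℕ
  | .lit _ => 1
  | .reg _ => 1
  | .get _ e => e.cost + 1
  | .add e f => e.cost + f.cost + 1
  | .sub e f => e.cost + f.cost + 1
  | .mul e f => e.cost + f.cost + 1

/-- The value of a test. -/
def Test.eval (W : ℕ) (s : Store) : Test → Option Bool
  | .eq e f => (e.eval W s).bind fun u => (f.eval W s).bind fun v => some (decide (u = v))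
  | .lt e f => (e.eval W s).bind fun u => (f.eval W s).bind fun v => some (decide (u < v))
  | .not b => (b.eval W s).bind fun u => some (!u)
  | .and b c => (b.eval W s).bind fun u => (c.eval W s).bind fun v => some (u && v)

/-- The number of elementary steps for evaluating a test. -/
def Test.cost : Test → ℕ
  | .eq e f => e.cost + f.cost + 1
  | .lt e f => e.cost + f.cost + 1
  | .not b => b.cost + 1
  | .and b c => b.cost + c.cost + 1

/-- `Exec W p s t s'`: on a machine with `W` different words, the program `p` started with memory
contents `s` halts after exactly `t` elementary steps with memory contents `s'`. -/
inductive Exec (W : ℕ) : Cmd → Store → ℕ → Store → Prop where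
  | skip {s : Store} : Exec W .skip s 1 s
  | assign {x : ℕ} {e : Expr} {s : Store} {v : ℕ} (he : e.eval W s = some v) :
      Exec W (.assign x e) s (e.cost + 1) (s.setReg x v)
  | store {a : ℕ} {i e : Expr} {s : Store} {j v : ℕ} (hi : i.eval W s = some j)
      (he : e.eval W s = some v) :
      Exec W (.store a i e) s (i.cost + e.cost + 1) (s.setArr a j v)
  | seq {p q : Cmd} {s₁ s₂ s₃ : Store} {t₁ t₂ : ℕ} (hp : Exec W p s₁ t₁ s₂)
      (hq : Exec W q s₂ t₂ s₃) : Exec W (.seq p q) s₁ (t₁ + t₂) s₃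
  | ite_true {b : Test} {p q : Cmd} {s s' : Store} {t : ℕ} (hb : b.eval W s = some true)
      (hp : Exec W p s t s') : Exec W (.ite b p q) s (b.cost + 1 + t) s'
  | ite_false {b : Test} {p q : Cmd} {s s' : Store} {t : ℕ} (hb : b.eval W s = some false)
      (hq : Exec W q s t s') : Exec W (.ite b p q) s (b.cost + 1 + t) s'
  | while_true {b : Test} {p : Cmd} {s₁ s₂ s₃ : Store} {t₁ t₂ : ℕ} (hb : b.eval W s₁ = some true)
      (hp : Exec W p s₁ t₁ s₂) (hw : Exec W (.while b p) s₂ t₂ s₃) :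
      Exec W (.while b p) s₁ (b.cost + 1 + t₁ + t₂) s₃
  | while_false {b : Test} {p : Cmd} {s : Store} (hb : b.eval W s = some false) :
      Exec W (.while b p) s (b.cost + 1) s

/-- The machine is deterministic: running time and result are determined by the program and the
initial memory contents. -/
theorem Exec.deterministic {W : ℕ} {p : Cmd} {s s₁ s₂ : Store} {t₁ t₂ : ℕ}
    (h₁ : Exec W p s t₁ s₁) (h₂ : Exec W p s t₂ s₂) : t₁ = t₂ ∧ s₁ = s₂ := by
  induction h₁ generalizing t₂ s₂ with
  | skip => cases h₂; exact ⟨rfl, rfl⟩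
  | assign he => cases h₂ with | assign he' => simp_all
  | store hi he => cases h₂ with | store hi' he' => simp_all
  | seq _ _ ihp ihq =>
    cases h₂ with
    | seq hp' hq' =>
      obtain ⟨rfl, rfl⟩ := ihp hp'
      obtain ⟨rfl, rfl⟩ := ihq hq'
      exact ⟨rfl, rfl⟩
  | ite_true hb _ ih =>
    cases h₂ with
    | ite_true hb' hp' => obtain ⟨rfl, rfl⟩ := ih hp'; exact ⟨rfl, rfl⟩
    | ite_false hb' hp' => simp_all
  | ite_false hb _ ih =>
    cases h₂ with
    | ite_true hb' hp' => simp_all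
    | ite_false hb' hp' => obtain ⟨rfl, rfl⟩ := ih hp'; exact ⟨rfl, rfl⟩
  | while_true hb _ _ ihp ihw =>
    cases h₂ with
    | while_true hb' hp' hw' =>
      obtain ⟨rfl, rfl⟩ := ihp hp'
      obtain ⟨rfl, rfl⟩ := ihw hw'
      exact ⟨rfl, rfl⟩
    | while_false hb' => simp_all
  | while_false hb =>
    cases h₂ with
    | while_true hb' hp' hw' => simp_all
    | while_false hb' => exact ⟨rfl, rfl⟩

/-! ### Encoding of instances -/

/-- `l` lists the pairs of the relation `r`, each pair once, in an arbitrary order. -/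
def Lists {n : ℕ} (l : List (Fin n × Fin n)) (r : Fin n → Fin n → Prop) : Prop :=
  l.Nodup ∧ ∀ u v : Fin n, (u, v) ∈ l ↔ r u v

/-- The initial memory contents for a graph on `{0, …, n - 1}` with the list `arcs` of its ordered
pairs of adjacent vertices, and a relation with the list `pairs` of its pairs.  Registers `0, 1, 2`
hold `n` and the lengths of the two lists, arrays `0, 1` hold the first and second components of
`arcs`, arrays `2, 3` hold those of `pairs`, and all other cells are zero. -/
def inputStore {n : ℕ} (arcs pairs : List (Fin n × Fin n)) : Store where
  reg
    | 0 => n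
    | 1 => arcs.length
    | 2 => pairs.length
    | _ => 0
  arr
    | 0 => fun i => (arcs.map fun e => (e.1 : ℕ)).getD i 0
    | 1 => fun i => (arcs.map fun e => (e.2 : ℕ)).getD i 0
    | 2 => fun i => (pairs.map fun e => (e.1 : ℕ)).getD i 0
    | 3 => fun i => (pairs.map fun e => (e.2 : ℕ)).getD i 0
    | _ => fun _ => 0

end PSOP

namespace PSOP

/-! ### Total evaluation of expressions in bounded stores -/

/-! Fix a partition into a clique C and an independent set I. By the four-point condition
(`isLBFSOrdering_iff_fourPoint`), an LBFS ordering is rigid at the vertices of I that are visited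
before the end of the clique. The neighborhood of such an early vertex is an initial segment of the
clique order, contains every clique vertex visited before it, and is exhausted before the next
vertex of I (`adj_of_lt_early`, `lt_of_adj_of_lt`, `lt_of_adj_of_not_adj_of_early`). The relation π
shows which vertices must be early (`Forced.early`). All other vertices of I can wait until the
clique is finished and then follow in lexicographic order of their neighborhoods.

This leads to two sets of conditions on an enumeration τ of the clique. Those of `CliqueOrder` can
be enforced vertex by vertex: each forbids a choice until certain clique vertices, or sufficiently
many of them, have been placed. If a solution exists, then for any set of vertices placed so far the
first missing clique vertex of that solution is an allowed choice (`exists_available`), so a greedy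
enumeration never gets stuck, whatever it chose before. The conditions of `Insertable` say that the
forced vertices fit into the enumeration. They hold for every τ that makes the neighborhoods of
forced vertices initial segments, as soon as one solution exists (`insertable_of_fourPoint`), so
checking them for the one enumeration found is enough. Conversely, both sets of conditions give a
solution by sorting with `sortKey` (`fourPoint_sortKey`, `sortKey_lt_of_rel`).

For the running time, the partition is read off the degrees (`inClique_partition`). The greedy
enumeration keeps, for each vertex, a pointer to the first pair of π that still forbids its choice.
A pair that has ceased to forbid a vertex never forbids it again (`Blocks.mono`), so the pointers
make at most n · |π| moves in all. The remaining work is bounded by multiples of n², of the number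
of arcs and of n · |π|; reflexivity of π gives n ≤ |π|, so n · |π| dominates. -/

/-- The value of an expression when overflow is ignored. -/
def Expr.val (s : Store) : Expr → ℕ
  | .lit k => k
  | .reg x => s.reg x
  | .get a e => s.arr a (e.val s)
  | .add e f => e.val s + f.val s
  | .sub e f => e.val s - f.val s
  | .mul e f => e.val s * f.val s

/-- The truth value of a test when overflow is ignored. -/
def Test.Holds (s : Store) : Test → Prop
  | .eq e f => e.val s = f.val s
  | .lt e f => e.val s < f.val s
  | .not b => ¬ b.Holds s
  | .and b c => b.Holds s ∧ c.Holds s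

/-- An exponent `h` such that all intermediate values are below `B ^ h` in a store bounded by `B`. -/
def Expr.height : Expr → ℕ
  | .lit k => k + 1
  | .reg _ => 1
  | .get _ e => e.height
  | .add e f => max e.height f.height + 1
  | .sub e f => max e.height f.height
  | .mul e f => e.height + f.height

def Test.height : Test → ℕ
  | .eq e f => max e.height f.height
  | .lt e f => max e.height f.height
  | .not b => b.height
  | .and b c => max b.height c.height

/-- The arrays read by an expression. -/
def Expr.arrays : Expr → List ℕ
  | .lit _ => []
  | .reg _ => []
  | .get a e => a :: e.arrays
  | .add e f => e.arrays ++ f.arrays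
  | .sub e f => e.arrays ++ f.arrays
  | .mul e f => e.arrays ++ f.arrays

def Test.arrays : Test → List ℕ
  | .eq e f => e.arrays ++ f.arrays
  | .lt e f => e.arrays ++ f.arrays
  | .not b => b.arrays
  | .and b c => b.arrays ++ c.arrays

/-- All cells hold numbers below `B`. -/
structure Store.Bounded (B : ℕ) (s : Store) : Prop where
  reg : ∀ x, s.reg x < B
  arr : ∀ a j, s.arr a j < B

theorem Store.Bounded.setReg {B : ℕ} {s : Store} (h : s.Bounded B) {x v : ℕ} (hv : v < B) :
    (s.setReg x v).Bounded B := by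
  refine ⟨fun y => ?_, h.arr⟩
  by_cases hy : y = x
  · subst hy; simpa [Store.setReg] using hv
  · simpa [Store.setReg, hy] using h.reg y

theorem Store.Bounded.setArr {B : ℕ} {s : Store} (h : s.Bounded B) {a j v : ℕ} (hv : v < B) :
    (s.setArr a j v).Bounded B := by
  refine ⟨h.reg, fun b i => ?_⟩
  by_cases hb : b = a
  · subst hb
    by_cases hi : i = j
    · subst hi; simpa [Store.setArr] using hv
    · simpa [Store.setArr, hi] using h.arr b i
  · simpa [Store.setArr, hb] using h.arr b i

theorem Expr.height_pos (e : Expr) : 1 ≤ e.height := by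
  induction e <;> simp only [Expr.height] <;> omega

theorem Expr.val_lt {B : ℕ} (hB : 2 ≤ B) {s : Store} (hs : s.Bounded B) (e : Expr) :
    e.val s < B ^ e.height := by
  induction e with
  | lit k =>
    exact lt_of_lt_of_le (Nat.lt_two_pow_self.trans (Nat.pow_lt_pow_right (by norm_num)
      (Nat.lt_succ_self k))) (Nat.pow_le_pow_left hB _)
  | reg x => simpa [Expr.val, Expr.height] using hs.reg x
  | get a e _ =>
    exact lt_of_lt_of_le (hs.arr _ _) (Nat.le_self_pow (by have := (Expr.get a e).height_pos; omega) _)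
  | add e f ihe ihf =>
    have h1 : B ^ e.height ≤ B ^ max e.height f.height :=
      Nat.pow_le_pow_right (by omega) (le_max_left _ _)
    have h2 : B ^ f.height ≤ B ^ max e.height f.height :=
      Nat.pow_le_pow_right (by omega) (le_max_right _ _)
    have h3 : B ^ (max e.height f.height) * 2 ≤ B ^ (max e.height f.height + 1) := by
      rw [pow_succ]; exact Nat.mul_le_mul_left _ hB
    simp only [Expr.val, Expr.height]; omega
  | sub e f ihe ihf =>
    have h1 : B ^ e.height ≤ B ^ max e.height f.height :=
      Nat.pow_le_pow_right (by omega) (le_max_left _ _)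
    simp only [Expr.val, Expr.height]; omega
  | mul e f ihe ihf =>
    simp only [Expr.val, Expr.height, pow_add]
    exact Nat.mul_lt_mul'' ihe ihf

theorem fits_of_lt {W v : ℕ} (h : v < W) : fits W v = some v := if_pos h

/-- No intermediate result overflows: each subexpression stays below `B` to its own height, which
does not exceed the height of the whole. From here on, overflow matters only for values written to
memory, which must stay below `B`. -/
theorem Expr.eval_eq {B W : ℕ} (hB : 2 ≤ B) {s : Store} (hs : s.Bounded B) (e : Expr)
    (hW : B ^ e.height ≤ W) : e.eval W s = some (e.val s) := by
  have hlt := lt_of_lt_of_le (e.val_lt hB hs) hW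
  induction e with
  | lit k => exact fits_of_lt hlt
  | reg x => exact fits_of_lt hlt
  | get a e ih =>
    rw [Expr.eval, ih hW (lt_of_lt_of_le (e.val_lt hB hs) hW)]
    exact fits_of_lt hlt
  | add e f ihe ihf =>
    have h1 : B ^ e.height ≤ W := le_trans (Nat.pow_le_pow_right (by omega)
      (by simp only [Expr.height]; omega)) hW
    have h2 : B ^ f.height ≤ W := le_trans (Nat.pow_le_pow_right (by omega)
      (by simp only [Expr.height]; omega)) hW
    rw [Expr.eval, ihe h1 (lt_of_lt_of_le (e.val_lt hB hs) h1),
      ihf h2 (lt_of_lt_of_le (f.val_lt hB hs) h2)]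
    exact fits_of_lt hlt
  | sub e f ihe ihf =>
    have h1 : B ^ e.height ≤ W := le_trans (Nat.pow_le_pow_right (by omega)
      (by simp only [Expr.height]; omega)) hW
    have h2 : B ^ f.height ≤ W := le_trans (Nat.pow_le_pow_right (by omega)
      (by simp only [Expr.height]; omega)) hW
    rw [Expr.eval, ihe h1 (lt_of_lt_of_le (e.val_lt hB hs) h1),
      ihf h2 (lt_of_lt_of_le (f.val_lt hB hs) h2)]
    exact fits_of_lt hlt
  | mul e f ihe ihf =>
    have h1 : B ^ e.height ≤ W := le_trans (Nat.pow_le_pow_right (by omega)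
      (by simp only [Expr.height]; omega)) hW
    have h2 : B ^ f.height ≤ W := le_trans (Nat.pow_le_pow_right (by omega)
      (by simp only [Expr.height]; omega)) hW
    rw [Expr.eval, ihe h1 (lt_of_lt_of_le (e.val_lt hB hs) h1),
      ihf h2 (lt_of_lt_of_le (f.val_lt hB hs) h2)]
    exact fits_of_lt hlt

open Classical in
theorem Test.eval_eq {B W : ℕ} (hB : 2 ≤ B) {s : Store} (hs : s.Bounded B) (b : Test)
    (hW : B ^ b.height ≤ W) : b.eval W s = some (decide (b.Holds s)) := by
  have hpow : ∀ {i j : ℕ}, i ≤ j → B ^ j ≤ W → B ^ i ≤ W := fun h h' =>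
    le_trans (Nat.pow_le_pow_right (by omega) h) h'
  induction b with
  | eq e f =>
    rw [Test.eval, Expr.eval_eq hB hs e (hpow (le_max_left _ _) hW),
      Expr.eval_eq hB hs f (hpow (le_max_right _ _) hW)]
    by_cases h : e.val s = f.val s <;> simp [Test.Holds, h]
  | lt e f =>
    rw [Test.eval, Expr.eval_eq hB hs e (hpow (le_max_left _ _) hW),
      Expr.eval_eq hB hs f (hpow (le_max_right _ _) hW)]
    by_cases h : e.val s < f.val s <;> simp [Test.Holds, h]
  | not b ih =>
    rw [Test.eval, ih hW]
    by_cases h : b.Holds s <;> simp [Test.Holds, h]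
  | and b c ihb ihc =>
    rw [Test.eval, ihb (hpow (le_max_left _ _) hW), ihc (hpow (le_max_right _ _) hW)]
    by_cases h : b.Holds s <;> by_cases h' : c.Holds s <;> simp [Test.Holds, h, h']

/-! ### Running programs -/

/-- The word size `W` and the bound `B` for the contents of the memory are far enough apart for the
evaluation of small expressions. -/
structure WordBound (B W : ℕ) : Prop where
  two_le : 2 ≤ B
  pow_le : B ^ 6 ≤ W

/-- The program `p` halts when it is started in the store `s`, and its running time and its final
store satisfy `Q`; the final store is bounded by `B`. -/
def Runs (B W : ℕ) (p : Cmd) (s : Store) (Q : ℕ → Store → Prop) : Prop :=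
  ∃ t s', Exec W p s t s' ∧ s'.Bounded B ∧ Q t s'

/-! ### Proof rules for total correctness with exact step counts. -/

section Rules

variable {B W : ℕ} {s : Store} {Q : ℕ → Store → Prop}

theorem WordBound.expr (hW : WordBound B W) (hs : s.Bounded B) {e : Expr} (he : e.height ≤ 6) :
    e.eval W s = some (e.val s) :=
  e.eval_eq hW.two_le hs (le_trans (Nat.pow_le_pow_right (by have := hW.two_le; omega) he) hW.pow_le)

open Classical in
theorem WordBound.test (hW : WordBound B W) (hs : s.Bounded B) {b : Test} (hb : b.height ≤ 6) :
    b.eval W s = some (decide (b.Holds s)) :=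
  b.eval_eq hW.two_le hs (le_trans (Nat.pow_le_pow_right (by have := hW.two_le; omega) hb) hW.pow_le)

theorem Runs.mono {p : Cmd} {Q' : ℕ → Store → Prop} (h : Runs B W p s Q)
    (hQ : ∀ t s', s'.Bounded B → Q t s' → Q' t s') : Runs B W p s Q' := by
  obtain ⟨t, s', he, hb, hq⟩ := h
  exact ⟨t, s', he, hb, hQ t s' hb hq⟩

theorem Runs.skip (hs : s.Bounded B) (h : Q 1 s) : Runs B W .skip s Q :=
  ⟨1, s, .skip, hs, h⟩

theorem Runs.assign (hW : WordBound B W) (hs : s.Bounded B) {x : ℕ} {e : Expr} (he : e.height ≤ 6)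
    (hv : e.val s < B) (h : Q (e.cost + 1) (s.setReg x (e.val s))) :
    Runs B W (.assign x e) s Q :=
  ⟨_, _, .assign (hW.expr hs he), hs.setReg hv, h⟩

theorem Runs.store (hW : WordBound B W) (hs : s.Bounded B) {a : ℕ} {i e : Expr}
    (hi : i.height ≤ 6) (he : e.height ≤ 6) (hv : e.val s < B)
    (h : Q (i.cost + e.cost + 1) (s.setArr a (i.val s) (e.val s))) :
    Runs B W (.store a i e) s Q :=
  ⟨_, _, .store (hW.expr hs hi) (hW.expr hs he), hs.setArr hv, h⟩

theorem Runs.seq {p q : Cmd}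
    (h : Runs B W p s fun t s' => Runs B W q s' fun t' s'' => Q (t + t') s'') :
    Runs B W (.seq p q) s Q := by
  obtain ⟨t, s', he, _, t', s'', he', hb', hq⟩ := h
  exact ⟨_, _, .seq he he', hb', hq⟩

theorem Runs.ite (hW : WordBound B W) (hs : s.Bounded B) {b : Test} {p q : Cmd}
    (hb : b.height ≤ 6)
    (hp : b.Holds s → Runs B W p s fun t s' => Q (b.cost + 1 + t) s')
    (hq : ¬ b.Holds s → Runs B W q s fun t s' => Q (b.cost + 1 + t) s') :
    Runs B W (.ite b p q) s Q := by
  classical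
  by_cases h : b.Holds s
  · obtain ⟨t, s', he, hb', hQ⟩ := hp h
    exact ⟨_, _, .ite_true (by rw [hW.test hs hb]; simp [h]) he, hb', hQ⟩
  · obtain ⟨t, s', he, hb', hQ⟩ := hq h
    exact ⟨_, _, .ite_false (by rw [hW.test hs hb]; simp [h]) he, hb', hQ⟩

/-- A loop whose number of iterations is bounded in advance by a measure of the store; the invariant
also speaks about the time that has been spent. -/
theorem Runs.while (hW : WordBound B W) {b : Test} {p : Cmd} (hb : b.height ≤ 6)
    (I : ℕ → Store → Prop) (μ : Store → ℕ) (hs : s.Bounded B) (h0 : I 0 s)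
    (hstep : ∀ t s', s'.Bounded B → I t s' → b.Holds s' →
      Runs B W p s' fun t' s'' => I (t + (b.cost + 1) + t') s'' ∧ μ s'' < μ s')
    (hQ : ∀ t s', s'.Bounded B → I t s' → ¬ b.Holds s' → Q (t + (b.cost + 1)) s') :
    Runs B W (.while b p) s Q := by
  classical
  suffices H : ∀ m t s', μ s' = m → s'.Bounded B → I t s' →
      Runs B W (.while b p) s' fun t' s'' => Q (t + t') s'' by
    simpa using H _ 0 s rfl hs h0
  intro m
  induction m using Nat.strong_induction_on with
  | _ m ih =>
    intro t s' hm hs' hI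
    by_cases h : b.Holds s'
    · obtain ⟨t₁, s₁, he₁, hb₁, hI₁, hμ⟩ := hstep t s' hs' hI h
      obtain ⟨t₂, s₂, he₂, hb₂, hQ₂⟩ := ih _ (hm ▸ hμ) _ s₁ rfl hb₁ hI₁
      refine ⟨_, _, .while_true (by rw [hW.test hs' hb]; simp [h]) he₁ he₂, hb₂, ?_⟩
      convert hQ₂ using 1; ring
    · exact ⟨_, _, .while_false (by rw [hW.test hs' hb]; simp [h]), hs', hQ t s' hs' hI h⟩

/-- `for x := 0 to (content of N) - 1 do p` -/
def forLoop (x N : ℕ) (p : Cmd) : Cmd :=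
  .seq (.assign x (.lit 0))
    (.while (.lt (.reg x) (.reg N)) (.seq p (.assign x (.add (.reg x) (.lit 1)))))

/-- The time in the invariant counts the loop bodies only. The overhead is 4 steps for the test and
4 for the increment in each iteration, plus 6 for the initialization and the last test. -/
theorem Runs.forLoop (hW : WordBound B W) (hs : s.Bounded B) {x N : ℕ} {p : Cmd} (m : ℕ)
    (I : ℕ → ℕ → Store → Prop) (hm : m < B)
    (hI : ∀ i t s', I i t s' → s'.reg x = i ∧ s'.reg N = m)
    (h0 : I 0 0 (s.setReg x 0))
    (hstep : ∀ i t s', i < m → s'.Bounded B → I i t s' →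
      Runs B W p s' fun t' s'' => s''.reg x = i ∧ I (i + 1) (t + t') (s''.setReg x (i + 1)))
    (hQ : ∀ t s', s'.Bounded B → I m t s' → Q (t + (8 * m + 6)) s') :
    Runs B W (forLoop x N p) s Q := by
  have hB := hW.two_le
  apply Runs.seq
  apply Runs.assign hW hs (by simp [Expr.height]) (by simp only [Expr.val]; omega)
  apply Runs.while hW (by simp [Test.height, Expr.height])
    (fun t s' => ∃ i t', i ≤ m ∧ t = t' + 8 * i ∧ I i t' s') (fun s' => m - s'.reg x)
    (hs.setReg (by simp only [Expr.val]; omega))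
  · exact ⟨0, 0, Nat.zero_le _, rfl, h0⟩
  · rintro t s' hs' ⟨i, t', hi, rfl, hIi⟩ hlt
    obtain ⟨h1, h2⟩ := hI _ _ _ hIi
    have hlt' : i < m := by simpa [Test.Holds, Expr.val, h1, h2] using hlt
    apply Runs.seq
    apply (hstep i t' s' hlt' hs' hIi).mono
    rintro t'' s'' hs'' ⟨hx, hI'⟩
    apply Runs.assign hW hs'' (by simp [Expr.height]) (by simp only [Expr.val]; omega)
    simp only [Expr.val, hx, h1]
    refine ⟨⟨i + 1, t' + t'', hlt', ?_, hI'⟩, ?_⟩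
    · simp only [Test.cost, Expr.cost]; ring
    · simp [Store.setReg]; omega
  · rintro t s' hs' ⟨i, t', hi, rfl, hIi⟩ hlt
    obtain ⟨h1, h2⟩ := hI _ _ _ hIi
    have hlt' : ¬ i < m := by simpa [Test.Holds, Expr.val, h1, h2] using hlt
    obtain rfl : i = m := by omega
    have := hQ t' s' hs' hIi
    convert this using 1
    simp only [Test.cost, Expr.cost]; ring

end Rules

/-! ### Expressions depend only on the arrays that they read -/

theorem Expr.val_congr {s s' : Store} (hr : s.reg = s'.reg) (e : Expr)
    (ha : ∀ a ∈ e.arrays, s.arr a = s'.arr a) : e.val s = e.val s' := by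
  induction e with
  | lit k => rfl
  | reg x => simp [Expr.val, hr]
  | get a e ih =>
    simp only [Expr.arrays, List.mem_cons] at ha
    simp only [Expr.val]
    rw [ih fun b hb => ha b (Or.inr hb), ha a (Or.inl rfl)]
  | add e f ihe ihf | sub e f ihe ihf | mul e f ihe ihf =>
    simp only [Expr.arrays, List.mem_append] at ha
    simp only [Expr.val]
    rw [ihe fun b hb => ha b (Or.inl hb), ihf fun b hb => ha b (Or.inr hb)]

theorem Test.holds_congr {s s' : Store} (hr : s.reg = s'.reg) (b : Test)
    (ha : ∀ a ∈ b.arrays, s.arr a = s'.arr a) : b.Holds s ↔ b.Holds s' := by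
  induction b with
  | eq e f | lt e f =>
    simp only [Test.arrays, List.mem_append] at ha
    simp only [Test.Holds]
    rw [e.val_congr hr fun b hb => ha b (Or.inl hb), f.val_congr hr fun b hb => ha b (Or.inr hb)]
  | not b ih => exact not_congr (ih ha)
  | and b c ihb ihc =>
    simp only [Test.arrays, List.mem_append] at ha
    exact and_congr (ihb fun b hb => ha b (Or.inl hb)) (ihc fun b hb => ha b (Or.inr hb))

/-! ### Loops that set flags and loops that count -/

section Loops

variable {B W : ℕ} {s : Store} {Q : ℕ → Store → Prop}

/-- Set the flag with index `i` in array `a` if the test holds. -/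
def setFlag (a : ℕ) (b : Test) (i : Expr) : Cmd :=
  .ite b (.store a i (.lit 1)) .skip

/-- Set the flags of all indices that `x < N` yields. -/
def flagLoop (x N a : ℕ) (b : Test) (i : Expr) : Cmd :=
  forLoop x N (setFlag a b i)

/-- Set the flags of all indices that the pairs of `x < N` and `y < K` yield. -/
def flagLoop₂ (x N y K a : ℕ) (b : Test) (i : Expr) : Cmd :=
  forLoop x N (flagLoop y K a b i)

theorem Runs.setFlag (hW : WordBound B W) (hs : s.Bounded B) {a : ℕ} {b : Test} {i : Expr}
    (hb : b.height ≤ 6) (hi : i.height ≤ 6)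
    (hQ : ∀ t g, t ≤ b.cost + i.cost + 3 →
      (∀ j, 0 < g j ↔ 0 < s.arr a j ∨ (b.Holds s ∧ i.val s = j)) →
      Q t ⟨s.reg, Function.update s.arr a g⟩) :
    Runs B W (setFlag a b i) s Q := by
  have hB := hW.two_le
  apply Runs.ite hW hs hb
  · intro h
    apply Runs.store hW hs hi (by simp [Expr.height]) (by simp only [Expr.val]; omega)
    apply hQ
    · simp only [Expr.cost]; omega
    · intro j
      by_cases hj : j = i.val s
      · subst hj; simp [Expr.val, h]
      · simp [hj, Ne.symm hj]
  · intro h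
    apply Runs.skip hs
    have := hQ (b.cost + 1 + 1) (s.arr a) (by omega) (by simp [h])
    simpa using this

/-- Since the test and the index do not read the array being written, earlier iterations cannot
influence later ones. The result can therefore be described by evaluating both in the initial store.
-/
theorem Runs.flagLoop (hW : WordBound B W) (hs : s.Bounded B) {x N a : ℕ} {b : Test} {i : Expr}
    (m : ℕ) (hm : s.reg N = m) (hxN : N ≠ x) (hb : b.height ≤ 6) (hi : i.height ≤ 6)
    (hab : a ∉ b.arrays) (hai : a ∉ i.arrays)
    (hQ : ∀ t g, t ≤ m * (b.cost + i.cost + 11) + 6 →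
      (∀ j, 0 < g j ↔ 0 < s.arr a j ∨
        ∃ k < m, b.Holds (s.setReg x k) ∧ i.val (s.setReg x k) = j) →
      Q t ⟨Function.update s.reg x m, Function.update s.arr a g⟩) :
    Runs B W (flagLoop x N a b i) s Q := by
  apply Runs.forLoop hW hs m (fun k t s' => t ≤ k * (b.cost + i.cost + 3) ∧ ∃ g,
    s' = ⟨Function.update s.reg x k, Function.update s.arr a g⟩ ∧
    ∀ j, 0 < g j ↔ 0 < s.arr a j ∨
        ∃ l < k, b.Holds (s.setReg x l) ∧ i.val (s.setReg x l) = j) (hm ▸ hs.reg N)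
  · rintro k t s' ⟨_, g, rfl, _⟩
    simp [hxN, hm]
  · exact ⟨by simp, s.arr a, by simp [Store.setReg], by simp⟩
  · rintro k t s' hk hs' ⟨ht, g, rfl, hg⟩
    have e1 : b.Holds ⟨Function.update s.reg x k, Function.update s.arr a g⟩ ↔
        b.Holds (s.setReg x k) := by
      refine b.holds_congr (by simp [Store.setReg]) fun c hc => ?_
      have : c ≠ a := fun h => hab (h ▸ hc)
      simp [this, Store.setReg]
    have e2 : i.val ⟨Function.update s.reg x k, Function.update s.arr a g⟩ =
        i.val (s.setReg x k) := by
      refine i.val_congr (by simp [Store.setReg]) fun c hc => ?_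
      have : c ≠ a := fun h => hai (h ▸ hc)
      simp [this, Store.setReg]
    apply Runs.setFlag hW hs' hb hi
    rintro t' g' ht' hg'
    refine ⟨by simp, by rw [Nat.succ_mul]; omega, g', by simp [Store.setReg], fun j => ?_⟩
    rw [hg']
    simp only [Function.update_self, hg, e1, e2, or_assoc, Nat.lt_succ_iff_lt_or_eq]
    apply or_congr Iff.rfl
    constructor
    · rintro (⟨l, hl, h⟩ | h)
      · exact ⟨l, Or.inl hl, h⟩
      · exact ⟨k, Or.inr rfl, h⟩
    · rintro ⟨l, hl | rfl, h⟩
      · exact Or.inl ⟨l, hl, h⟩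
      · exact Or.inr h
  · rintro t s' hs' ⟨ht, g, rfl, hg⟩
    refine hQ _ _ ?_ hg
    have : m * (b.cost + i.cost + 11) = m * (b.cost + i.cost + 3) + 8 * m := by ring
    omega

/-- The final content `v` of the inner counter is left open because the inner loop is never entered
when `m = 0`. -/
theorem Runs.flagLoop₂ (hW : WordBound B W) (hs : s.Bounded B) {x N y K a : ℕ} {b : Test}
    {i : Expr} (m n : ℕ) (hm : s.reg N = m) (hn : s.reg K = n) (hxN : N ≠ x) (hyN : N ≠ y)
    (hxK : K ≠ x) (hyK : K ≠ y) (hxy : x ≠ y) (hb : b.height ≤ 6) (hi : i.height ≤ 6)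
    (hab : a ∉ b.arrays) (hai : a ∉ i.arrays)
    (hQ : ∀ t g v, t ≤ m * (n * (b.cost + i.cost + 11) + 14) + 6 →
      (∀ j, 0 < g j ↔ 0 < s.arr a j ∨ ∃ k < m, ∃ l < n,
        b.Holds ((s.setReg x k).setReg y l) ∧ i.val ((s.setReg x k).setReg y l) = j) →
      Q t ⟨Function.update (Function.update s.reg y v) x m, Function.update s.arr a g⟩) :
    Runs B W (flagLoop₂ x N y K a b i) s Q := by
  apply Runs.forLoop hW hs m (fun k t s' => t ≤ k * (n * (b.cost + i.cost + 11) + 6) ∧ ∃ g v,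
    s' = ⟨Function.update (Function.update s.reg y v) x k, Function.update s.arr a g⟩ ∧
    ∀ j, 0 < g j ↔ 0 < s.arr a j ∨ ∃ l < k, ∃ l' < n,
      b.Holds ((s.setReg x l).setReg y l') ∧ i.val ((s.setReg x l).setReg y l') = j)
    (hm ▸ hs.reg N)
  · rintro k t s' ⟨_, g, v, rfl, _⟩
    simp [hxN, hm, hyN]
  · exact ⟨by simp, s.arr a, s.reg y, by simp [Store.setReg], by simp⟩
  · rintro k t s' hk hs' ⟨ht, g, v, rfl, hg⟩
    apply Runs.flagLoop hW hs' n (by simp [hxK, hyK, hn]) hyK hb hi hab hai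
    rintro t' g' ht' hg'
    refine ⟨by simp [hxy], by rw [Nat.succ_mul]; omega, g', n, ?_, fun j => ?_⟩
    · simp [Store.setReg, Function.update_comm hxy]
    · have er : ∀ l, (Store.setReg ⟨Function.update (Function.update s.reg y v) x k,
          Function.update s.arr a g⟩ y l).reg = ((s.setReg x k).setReg y l).reg := fun l => by
        simp [Store.setReg, Function.update_comm hxy]
      have e1 : ∀ l, b.Holds (Store.setReg ⟨Function.update (Function.update s.reg y v) x k,
          Function.update s.arr a g⟩ y l) ↔ b.Holds ((s.setReg x k).setReg y l) := fun l => by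
        refine b.holds_congr (er l) fun c hc => ?_
        have : c ≠ a := fun h => hab (h ▸ hc)
        simp [this, Store.setReg]
      have e2 : ∀ l, i.val (Store.setReg ⟨Function.update (Function.update s.reg y v) x k,
          Function.update s.arr a g⟩ y l) = i.val ((s.setReg x k).setReg y l) := fun l => by
        refine i.val_congr (er l) fun c hc => ?_
        have : c ≠ a := fun h => hai (h ▸ hc)
        simp [this, Store.setReg]
      rw [hg']
      simp only [e1, e2, Function.update_self, hg, or_assoc, Nat.lt_succ_iff_lt_or_eq]
      apply or_congr Iff.rfl
      constructor
      · rintro (⟨l, hl, h⟩ | h)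
        · exact ⟨l, Or.inl hl, h⟩
        · exact ⟨k, Or.inr rfl, h⟩
      · rintro ⟨l, hl | rfl, h⟩
        · exact Or.inl ⟨l, hl, h⟩
        · exact Or.inr h
  · rintro t s' hs' ⟨ht, g, v, rfl, hg⟩
    refine hQ _ _ _ ?_ hg
    have : m * (n * (b.cost + i.cost + 11) + 14) =
      m * (n * (b.cost + i.cost + 11) + 6) + 8 * m := by ring
    omega

/-- Count in cell `x` of array `a`, for all `x < N`, the numbers `y < K` that pass the test. -/
def countLoop (x N y K a : ℕ) (b : Test) : Cmd :=
  forLoop x N (forLoop y K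
    (.ite b (.store a (.reg x) (.add (.get a (.reg x)) (.lit 1))) .skip))

open Classical in
theorem Runs.countLoop (hW : WordBound B W) (hs : s.Bounded B) {x N y K a : ℕ} {b : Test}
    (m n : ℕ) (hm : s.reg N = m) (hn : s.reg K = n) (hxN : N ≠ x) (hyN : N ≠ y)
    (hxK : K ≠ x) (hyK : K ≠ y) (hxy : x ≠ y) (hb : b.height ≤ 6) (hab : a ∉ b.arrays)
    (ha : ∀ j, s.arr a j = 0)
    (hQ : ∀ t g v, t ≤ m * (n * (b.cost + 15) + 14) + 6 →
      (∀ k < m, g k =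
        ((Finset.range n).filter fun l => b.Holds ((s.setReg x k).setReg y l)).card) →
      Q t ⟨Function.update (Function.update s.reg y v) x m, Function.update s.arr a g⟩) :
    Runs B W (countLoop x N y K a b) s Q := by
  set cnt : ℕ → ℕ → ℕ := fun k l =>
    ((Finset.range l).filter fun l => b.Holds ((s.setReg x k).setReg y l)).card with hcnt
  apply Runs.forLoop hW hs m (fun k t s' => t ≤ k * (n * (b.cost + 15) + 6) ∧ ∃ g v,
    s' = ⟨Function.update (Function.update s.reg y v) x k, Function.update s.arr a g⟩ ∧
    ∀ j, g j = if j < k then cnt j n else 0) (hm ▸ hs.reg N)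
  · rintro k t s' ⟨_, g, v, rfl, _⟩
    simp [hxN, hm, hyN]
  · exact ⟨by simp, s.arr a, s.reg y, by simp [Store.setReg], by simp [ha]⟩
  · rintro k t s' hk hs' ⟨ht, g, v, rfl, hg⟩
    apply Runs.forLoop hW hs' n (fun l t' s' => t' ≤ l * (b.cost + 7) ∧
      l ≤ n ∧ s' = ⟨Function.update (Function.update s.reg x k) y l,
        Function.update s.arr a (Function.update g k (cnt k l))⟩) (hn ▸ hs.reg K)
    · rintro l t' s' ⟨_, _, rfl⟩
      simp [hxK, hyK, hn]
    · refine ⟨by simp, Nat.zero_le _, ?_⟩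
      have : Function.update g k 0 = g := by
        rw [Function.update_eq_self_iff]; simp [hg]
      simp [Store.setReg, Function.update_comm hxy, hcnt, this]
    · rintro l t' s' hl hs'' ⟨ht', _, rfl⟩
      have e1 : b.Holds ⟨Function.update (Function.update s.reg x k) y l,
          Function.update s.arr a (Function.update g k (cnt k l))⟩ ↔
          b.Holds ((s.setReg x k).setReg y l) := by
        refine b.holds_congr (by simp [Store.setReg]) fun c hc => ?_
        have : c ≠ a := fun h => hab (h ▸ hc)
        simp [this, Store.setReg]
      apply Runs.ite hW hs'' hb
      · intro h
        rw [e1] at h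
        have hc : cnt k (l + 1) = cnt k l + 1 := by
          simp only [hcnt, Finset.range_add_one, Finset.filter_insert, h, if_true]
          rw [Finset.card_insert_of_notMem (by simp)]
        have hle : cnt k l ≤ l := (Finset.card_filter_le _ _).trans (by simp)
        have hnB : n < B := hn ▸ hs.reg K
        apply Runs.store hW hs'' (by simp [Expr.height]) (by simp [Expr.height])
        · simp [Expr.val, hxy]; omega
        · refine ⟨by simp [Store.setArr], ?_, hl, ?_⟩
          · simp only [Expr.cost]; rw [Nat.succ_mul]; omega
          · simp [Expr.val, Store.setArr, Store.setReg, hxy, hc]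
      · intro h
        rw [e1] at h
        have hc : cnt k (l + 1) = cnt k l := by
          simp only [hcnt, Finset.range_add_one, Finset.filter_insert, h, if_false]
        apply Runs.skip hs''
        refine ⟨by simp, ?_, hl, ?_⟩
        · rw [Nat.succ_mul]; omega
        · simp [Store.setReg, hc]
    · rintro t' s' hs'' ⟨ht', _, rfl⟩
      refine ⟨by simp [hxy], ?_, Function.update g k (cnt k n), n, ?_, fun j => ?_⟩
      · have : n * (b.cost + 15) = n * (b.cost + 7) + 8 * n := by ring
        have := add_one_mul k (n * (b.cost + 15) + 6)
        omega
      · simp [Store.setReg, Function.update_comm hxy]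
      · by_cases hj : j = k
        · subst hj; simp
        · simp only [Function.update_of_ne hj, hg]
          have : j < k + 1 ↔ j < k := by omega
          simp [this]
  · rintro t s' hs' ⟨ht, g, v, rfl, hg⟩
    refine hQ _ _ _ ?_ fun k hk => by rw [hg, if_pos hk]
    have : m * (n * (b.cost + 15) + 14) = m * (n * (b.cost + 15) + 6) + 8 * m := by ring
    omega

end Loops

/-! ### The four-point description of LBFS orderings -/

section FourPoint

variable {V : Type*} {n : ℕ} {G : SimpleGraph V}

theorem mem_label {σ : Fin n ≃ V} {i : Fin n} {w : V} {k : ℕ} :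
    k ∈ label G σ i w ↔ ∃ j : Fin n, j < i ∧ G.Adj (σ j) w ∧ (j : ℕ) + 1 = k := by
  simp [label, and_assoc]

/-- Both clauses of the label order say that the smallest number in which the labels differ belongs
to `B`. This form avoids minima of possibly empty sets. -/
theorem lbfsPrec_iff {A B : Finset ℕ} :
    lbfsPrec A B ↔ ∃ m ∈ B, m ∉ A ∧ ∀ m' ∈ A, m' ∉ B → m < m' := by
  constructor
  · rintro (h | h)
    · obtain ⟨hs, m, hm, hm'⟩ := Finset.ssubset_iff_exists_cons_subset.1 h |>.elim
        fun a ha => ha.elim fun h1 h2 => (⟨fun x hx => h2 (by simp [hx]), a, h2 (by simp), h1⟩ :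
          A ⊆ B ∧ ∃ m, m ∈ B ∧ m ∉ A)
      exact ⟨m, hm, hm', fun x hx hx' => absurd (hs hx) hx'⟩
    · have hne : (B \ A).min ≠ ⊤ := fun h' => by simp [h'] at h
      have hne' : (B \ A).Nonempty := by
        rw [Finset.nonempty_iff_ne_empty]; rintro h'; simp [h'] at hne
      obtain ⟨m, hm⟩ := Finset.min_of_nonempty hne'
      have hmem := Finset.mem_of_min hm
      rw [Finset.mem_sdiff] at hmem
      refine ⟨m, hmem.1, hmem.2, fun m' h1 h2 => ?_⟩
      have := Finset.min_le (Finset.mem_sdiff.2 ⟨h1, h2⟩)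
      rw [hm] at h
      exact WithTop.coe_lt_coe.1 (lt_of_lt_of_le h this)
  · rintro ⟨m, hm, hmA, h⟩
    right
    refine lt_of_le_of_lt (Finset.min_le (Finset.mem_sdiff.2 ⟨hm, hmA⟩)) ?_
    -- An empty difference has minimum `⊤`, so proper inclusion is already covered by the second
    -- clause.
    rcases Finset.eq_empty_or_nonempty (A \ B) with h' | h'
    · simp [h']
    · obtain ⟨a, ha⟩ := Finset.min_of_nonempty h'
      have hmem := Finset.mem_of_min ha
      rw [Finset.mem_sdiff] at hmem
      rw [ha]
      exact WithTop.coe_lt_coe.2 (h a hmem.1 hmem.2)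

/-- The four-point condition that characterizes LBFS orderings, for vertices ordered by `p`. -/
def FourPoint {P : Type*} [LT P] (G : SimpleGraph V) (p : V → P) : Prop :=
  ∀ z x y : V, p z < p x → p x < p y → G.Adj z y → ¬ G.Adj z x →
    ∃ z', p z' < p z ∧ G.Adj z' x ∧ ¬ G.Adj z' y

/-- A four-point violation makes the label of `y` beat that of `x` when `x` is chosen: `z` is the
first vertex at which their labels differ in favor of `y`, and nothing earlier favors `x`.
Conversely, if some label beats that of the chosen vertex, apply the condition to the first
difference; it yields a still earlier one in the other direction. -/
theorem isLBFSOrdering_iff_fourPoint {σ : Fin n ≃ V} :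
    IsLBFSOrdering G σ ↔ FourPoint G σ.symm := by
  constructor
  · intro h z x y hzx hxy hzy hnzx
    by_contra! hcon
    apply h (σ.symm x)
    refine ⟨y, hxy.le, lbfsPrec_iff.2 ⟨σ.symm z + 1, mem_label.2 ⟨_, hzx, by simpa, rfl⟩, ?_, ?_⟩⟩
    · rw [mem_label]
      rintro ⟨j, _, hj, hjz⟩
      obtain rfl : j = σ.symm z := Fin.ext (by omega)
      simp [hnzx] at hj
    · intro m' hm' hm''
      rw [mem_label] at hm' hm''
      obtain ⟨j, hj, hjx, rfl⟩ := hm'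
      have hjy : ¬ G.Adj (σ j) y := fun h' => hm'' ⟨j, hj, h', rfl⟩
      simp only [Equiv.apply_symm_apply] at hjx
      have h1 : ¬ j < σ.symm z := fun h' => hjy (hcon (σ j) (by simpa) hjx)
      have h2 : j ≠ σ.symm z := by rintro rfl; simp [hzy] at hjy
      have : (σ.symm z : ℕ) < j := lt_of_le_of_ne (not_lt.1 h1) (fun h => h2 (Fin.ext h.symm))
      omega
  · rintro h i ⟨y, hiy, hprec⟩
    obtain ⟨m, hm, hm', hmin⟩ := lbfsPrec_iff.1 hprec
    obtain ⟨j, hj, hjy, rfl⟩ := mem_label.1 hm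
    have hji : ¬ G.Adj (σ j) (σ i) := fun h' => hm' (mem_label.2 ⟨j, hj, h', rfl⟩)
    have hne : i ≠ σ.symm y := by rintro rfl; simp [hjy] at hji
    obtain ⟨z', hz', h1, h2⟩ := h (σ j) (σ i) y (by simpa) (by simpa using lt_of_le_of_ne hiy hne)
      hjy hji
    simp only [Equiv.symm_apply_apply] at hz'
    have := hmin (σ.symm z' + 1) (mem_label.2 ⟨_, hz'.trans hj, by simpa, rfl⟩) (by
      rw [mem_label]
      rintro ⟨j', _, hj', hjz⟩
      obtain rfl : j' = σ.symm z' := Fin.ext (by omega)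
      simp [h2] at hj')
    have : (σ.symm z' : ℕ) < j := hz'
    omega

/-- A four-point ordering by an injective key yields an extension of `π` that is an LBFS ordering. -/
theorem exists_ordering_of_key [Fintype V] (hn : Fintype.card V = n) {K : Type*} [LinearOrder K]
    (key : V → K) (hkey : Function.Injective key) (h : FourPoint G key) {π : V → V → Prop}
    (hπ : ∀ x y, π x y → x ≠ y → key x < key y) :
    ∃ σ : Fin n ≃ V, IsLBFSOrdering G σ ∧ Extends σ π := by
  let : LinearOrder V := LinearOrder.lift' key hkey
  have hlt : ∀ x y : V, x < y ↔ key x < key y := fun x y => Iff.rfl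
  let e : Fin n ≃o V := monoEquivOfFin V hn
  have he : ∀ x y, e.toEquiv.symm x < e.toEquiv.symm y ↔ key x < key y := fun x y => by
    rw [← hlt]; exact e.symm.lt_iff_lt
  refine ⟨e.toEquiv, isLBFSOrdering_iff_fourPoint.2 ?_, fun x y h1 h2 => (he _ _).2 (hπ x y h1 h2)⟩
  intro z x y
  simp only [he]
  exact h z x y

end FourPoint

/-! ### Forced vertices of the independent set -/

section Split

variable {V : Type*} (G : SimpleGraph V) (π : V → V → Prop) (C : V → Prop)

/-- The vertices of the independent set which have to precede some vertex `w` that either belongs to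
the clique or has a larger neighborhood. -/
def Forced₀ (v : V) : Prop :=
  ¬ C v ∧ ∃ w, π v w ∧
    (C w ∨ ((∀ c, G.Adj v c → G.Adj w c) ∧ ∃ c, G.Adj w c ∧ ¬ G.Adj v c))

/-- The vertices of the independent set which have to be visited before the end of the clique. -/
def Forced (u : V) : Prop :=
  ¬ C u ∧ ∃ v, π u v ∧ Forced₀ G π C v

open Classical in
/-- The number of neighbors. -/
noncomputable def nbrCount [Fintype V] (v : V) : ℕ :=
  (Finset.univ.filter fun c => G.Adj v c).card

open Classical in
/-- The size of the clique. -/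
noncomputable def cliqueCount [Fintype V] : ℕ :=
  (Finset.univ.filter fun c => C c).card

/-- The forced vertex `v` may be visited before the forced vertex `v'` if the clique is ordered by
`τ`. -/
def MayPrecede [Fintype V] (τ : V → ℕ) (v v' : V) : Prop :=
  nbrCount G v ≤ nbrCount G v' ∧ ∀ c, C c → π v' c → nbrCount G v ≤ τ c

/-- The conditions on an enumeration `τ` of the clique that are used in its construction. -/
structure CliqueOrder [Fintype V] (τ : V → ℕ) : Prop where
  inj : ∀ c d, C c → C d → τ c = τ d → c = d
  bound : ∀ c, C c → τ c < cliqueCount C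
  order : ∀ c d, C c → C d → π c d → c ≠ d → τ c < τ d
  initial : ∀ v d, Forced G π C v → C d → ¬ G.Adj v d → nbrCount G v ≤ τ d
  before : ∀ v w b, π v w → ¬ C v → ¬ C w → ¬ Forced G π C v → G.Adj w b → ¬ G.Adj v b →
    ∃ a, G.Adj v a ∧ ¬ G.Adj w a ∧ τ a < τ b

/-- The conditions on an enumeration `τ` of the clique which say that the forced vertices can be
inserted. -/
structure Insertable [Fintype V] (τ : V → ℕ) : Prop where
  total : ∀ v v', Forced G π C v → Forced G π C v' → v ≠ v' →
    MayPrecede G π C τ v v' ∨ MayPrecede G π C τ v' v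
  clique : ∀ c v, C c → Forced G π C v → π c v → G.Adj v c
  forced : ∀ v v', Forced G π C v → Forced G π C v' → v ≠ v' → π v v' → MayPrecede G π C τ v v'

variable {G π C}

/-! ### What an LBFS ordering that extends π forces. -/

section Necessity

variable {P : Type*} [LinearOrder P] {p : V → P} (hp : Function.Injective p)
  (hC : ∀ c d, C c → C d → c ≠ d → G.Adj c d) (hI : ∀ u v, ¬ C u → ¬ C v → ¬ G.Adj u v)
  (h4 : FourPoint G p) (hπ : ∀ x y, π x y → x ≠ y → p x < p y)

include hC hI h4

/-- Otherwise the four-point condition for `d`, `v`, `c` asks for a neighbor of `v` that is not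
adjacent to `c`. But the neighbors of `v` lie in the clique, as does `c`. -/
theorem adj_of_lt_early {v c d : V} (hv : ¬ C v) (hc : C c) (hvc : p v < p c) (hd : C d)
    (hdv : p d < p v) : G.Adj v d := by
  by_contra hcon
  have hcd : d ≠ c := by rintro rfl; exact lt_asymm hvc hdv
  obtain ⟨z, hz, h1, h2⟩ := h4 d v c hdv hvc (hC d c hd hc hcd) fun h => hcon h.symm
  have hzC : C z := by by_contra h; exact hI z v h hv h1
  refine h2 (hC z c hzC hc ?_)
  rintro rfl
  exact lt_asymm (hz.trans hdv) hvc

include hp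

/-- If `x` came after `v'`, the four-point condition for `v`, `v'`, `x` would again ask for a clique
vertex that is not adjacent to the clique vertex `x`. -/
theorem lt_of_adj_of_lt {v v' x : V} (hv : ¬ C v) (hv' : ¬ C v') (hvv : p v < p v')
    (hx : G.Adj v x) : p x < p v' := by
  have hxC : C x := by by_contra h; exact hI v x hv h hx
  by_contra hcon
  have hne : p v' ≠ p x := fun h => hv' (hp h ▸ hxC)
  obtain ⟨z, hz, h1, h2⟩ := h4 v v' x hvv (lt_of_le_of_ne (not_lt.1 hcon) hne) hx (hI v v' hv hv')
  have hzC : C z := by by_contra h; exact hI z v' h hv' h1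
  refine h2 (hC z x hzC hxC ?_)
  rintro rfl
  exact hcon (hz.trans hvv)

/-- The neighborhood of an early vertex is an initial segment of the clique order. A non-neighbor
`d` must follow `v`; if it preceded the neighbor `c`, there would be a vertex of the independent set
before `v` that is adjacent to `d`, and its neighbors must precede `v`. -/
theorem lt_of_adj_of_not_adj_of_early {v c d e : V} (hv : ¬ C v) (he : C e) (hve : p v < p e)
    (hc : G.Adj v c) (hd : C d) (hvd : ¬ G.Adj v d) : p c < p d := by
  have hcC : C c := by by_contra h; exact hI v c hv h hc
  have hvd' : p v < p d := by
    rcases lt_trichotomy (p v) (p d) with h | h | h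
    · exact h
    · exact absurd (hp h ▸ hd) hv
    · exact absurd (adj_of_lt_early hC hI h4 hv he hve hd h) hvd
  by_contra hcon
  have hdc : p d < p c := lt_of_le_of_ne (not_lt.1 hcon) fun h => hvd (hp h ▸ hc)
  obtain ⟨z, hz, h1, h2⟩ := h4 v d c hvd' hdc hc hvd
  have hzC : ¬ C z := fun h => h2 (hC z c h hcC (by rintro rfl; exact lt_asymm hz (hvd'.trans hdc)))
  exact lt_asymm (lt_of_adj_of_lt hp hC hI h4 hzC hv hz h1) hvd'

omit hC in
include hπ in
-- The only case with content is a strictly larger neighborhood of `w`. If some `c` adjacent to `w`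
-- but not to `u` preceded `u`, the four-point condition for `c`, `u`, `w` would give a neighbor of
-- `u` that `w` lacks.
theorem Forced.early {v : V} (hv : Forced G π C v) : ∃ c, C c ∧ p v < p c := by
  obtain ⟨hvC, u, hvu, huC, w, huw, hw⟩ := hv
  have hu : ∃ c, C c ∧ p u < p c := by
    have huw' : u ≠ w → p u < p w := hπ u w huw
    rcases hw with hw | ⟨hsub, c, hwc, huc⟩
    · exact ⟨w, hw, huw' (by rintro rfl; exact huC hw)⟩
    · have hne : u ≠ w := by rintro rfl; exact huc hwc
      by_cases hwC : C w
      · exact ⟨w, hwC, huw' hne⟩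
      have hcC : C c := by by_contra h; exact hI w c hwC h hwc
      refine ⟨c, hcC, ?_⟩
      by_contra hcon
      have hcu : p c < p u := lt_of_le_of_ne (not_lt.1 hcon) fun h => huC (hp h ▸ hcC)
      obtain ⟨z, _, h1, h2⟩ := h4 c u w hcu (huw' hne) hwc.symm fun h => huc h.symm
      exact h2 (hsub z h1.symm).symm
  obtain ⟨c, hc, huc⟩ := hu
  refine ⟨c, hc, ?_⟩
  by_cases h : v = u
  · rwa [h]
  · exact (hπ v u hvu h).trans huc

include hπ in
/-- If an LBFS ordering extends `π`, then the clique can be enumerated greedily. -/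
theorem exists_available [Finite V] (hrefl : ∀ x, π x x) (S : V → Prop) (hS : ∃ d, C d ∧ ¬ S d) :
    ∃ d, C d ∧ ¬ S d ∧ (∀ c, C c → π c d → c ≠ d → S c) ∧
      (∀ v, Forced G π C v → ¬ G.Adj v d → ∀ c, G.Adj v c → S c) ∧
      (∀ v w, π v w → ¬ C v → ¬ C w → ¬ Forced G π C v → G.Adj w d → ¬ G.Adj v d →
        ∃ a, G.Adj v a ∧ ¬ G.Adj w a ∧ S a) := by
  -- `S` need not be an initial part of the given ordering. The first clique vertex outside `S`
  -- works because all clique vertices before it belong to `S`.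
  obtain ⟨d, ⟨hd, hdS⟩, hmin⟩ := Set.exists_min_image {d | C d ∧ ¬ S d} p (Set.toFinite _) hS
  have hlt : ∀ c, C c → p c < p d → S c := fun c hc h => by
    by_contra hcon
    exact absurd (hmin c ⟨hc, hcon⟩) (not_le.2 h)
  refine ⟨d, hd, hdS, fun c hc h hne => hlt c hc (hπ c d h hne), ?_, ?_⟩
  · intro v hv hvd c hvc
    obtain ⟨e, he, hve⟩ := Forced.early hp hI h4 hπ hv
    exact hlt c (by by_contra h; exact hI v c hv.1 h hvc)
      (lt_of_adj_of_not_adj_of_early hp hC hI h4 hv.1 he hve hvc hd hvd)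
  · intro v w hvw hv hw hvF hwd hvd
    have hne : v ≠ w := by rintro rfl; exact hvd hwd
    have hlt' := hπ v w hvw hne
    rcases lt_or_ge (p v) (p d) with h | h
    · have hnsub : ¬ ∀ a, G.Adj v a → G.Adj w a := by
        exact fun hsub => hvF ⟨hv, v, hrefl v, hv, w, hvw, Or.inr ⟨hsub, d, hwd, hvd⟩⟩
      push Not at hnsub
      obtain ⟨a, hva, hwa⟩ := hnsub
      exact ⟨a, hva, hwa, hlt a (by by_contra h; exact hI v a hv h hva)
        (lt_of_adj_of_not_adj_of_early hp hC hI h4 hv hd h hva hd hvd)⟩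
    · have hdv : p d < p v := lt_of_le_of_ne h fun h => hv (hp h ▸ hd)
      obtain ⟨z, hz, h1, h2⟩ := h4 d v w hdv hlt' hwd.symm fun h => hvd h.symm
      exact ⟨z, h1.symm, fun h => h2 h.symm, hlt z (by by_contra h; exact hI z v h hv h1) hz⟩

include hπ in
-- Here `τ` is not assumed to agree with the given ordering. Only the sizes of the neighborhoods
-- matter, and `hτ` turns every clique vertex outside such a neighborhood into a bound on its
-- position in `τ`.
theorem insertable_of_fourPoint [Fintype V] {τ : V → ℕ}
    (hτ : ∀ v d, Forced G π C v → C d → ¬ G.Adj v d → nbrCount G v ≤ τ d) :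
    Insertable G π C τ := by
  have key : ∀ v v', Forced G π C v → Forced G π C v' → p v < p v' →
      MayPrecede G π C τ v v' := by
    intro v v' hv hv' hlt
    obtain ⟨e, he, hve⟩ := Forced.early hp hI h4 hπ hv'
    have hb : ∀ x, G.Adj v x → p x < p v' := fun x hx =>
      lt_of_adj_of_lt hp hC hI h4 hv.1 hv'.1 hlt hx
    constructor
    -- Neighbors of `v` precede `v'`, and all clique vertices before the early vertex `v'` are its
    -- neighbors.
    · refine Finset.card_le_card fun x hx => ?_
      simp only [Finset.mem_filter, Finset.mem_univ, true_and] at hx ⊢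
      exact adj_of_lt_early hC hI h4 hv'.1 he hve (by by_contra h; exact hI v x hv.1 h hx) (hb x hx)
    · intro c hc hπc
      -- A clique vertex that has to follow `v'` cannot be a neighbor of `v`.
      refine hτ v c hv hc fun h => ?_
      exact lt_asymm (hb c h) (hπ v' c hπc (by rintro rfl; exact hv'.1 hc))
  refine ⟨fun v v' hv hv' hne => ?_, fun c v hc hv h => ?_, fun v v' hv hv' hne h => ?_⟩
  · rcases lt_or_gt_of_ne (fun h => hne (hp h)) with h | h
    · exact Or.inl (key v v' hv hv' h)
    · exact Or.inr (key v' v hv' hv h)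
  · obtain ⟨e, he, hve⟩ := Forced.early hp hI h4 hπ hv
    exact adj_of_lt_early hC hI h4 hv.1 he hve hc (hπ c v h (by rintro rfl; exact hv.1 hc))
  · exact key v v' hv hv' (hπ v v' h hne)

end Necessity

end Split

/-! ### Building an LBFS ordering from a suitable enumeration of the clique. -/

section Sufficiency

variable {V : Type*} [Fintype V] {G : SimpleGraph V} {π : V → V → Prop} {C : V → Prop} {τ : V → ℕ}

/-- The number of clique vertices after which the vertex `v` is inserted. -/
noncomputable def slot (G : SimpleGraph V) (π : V → V → Prop) (C : V → Prop) (τ : V → ℕ) (v : V) :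
    ℕ :=
  sInf {t | t = nbrCount G v ∨ ∃ c, C c ∧ π v c ∧ τ c = t}

theorem slot_le_nbrCount (v : V) : slot G π C τ v ≤ nbrCount G v :=
  Nat.sInf_le (Or.inl rfl)

theorem slot_le {v c : V} (hc : C c) (h : π v c) : slot G π C τ v ≤ τ c :=
  Nat.sInf_le (Or.inr ⟨c, hc, h, rfl⟩)

theorem slot_eq (v : V) :
    slot G π C τ v = nbrCount G v ∨ ∃ c, C c ∧ π v c ∧ τ c = slot G π C τ v :=
  Nat.sInf_mem (s := {t | t = nbrCount G v ∨ ∃ c, C c ∧ π v c ∧ τ c = t}) ⟨_, Or.inl rfl⟩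

theorem MayPrecede.le_slot {v v' : V} (h : MayPrecede G π C τ v v') :
    nbrCount G v ≤ slot G π C τ v' := by
  rcases slot_eq (G := G) (π := π) (C := C) (τ := τ) v' with h' | ⟨c, hc, hπ, hτ⟩
  · exact h' ▸ h.1
  · exact hτ ▸ h.2 c hc hπ

theorem nbrCount_le_cliqueCount (hI : ∀ u v, ¬ C u → ¬ C v → ¬ G.Adj u v) {v : V} (hv : ¬ C v) :
    nbrCount G v ≤ cliqueCount C := by
  refine Finset.card_le_card fun c hc => ?_
  simp only [Finset.mem_filter, Finset.mem_univ, true_and] at hc ⊢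
  by_contra h
  exact hI v c hv h hc

/-- The neighborhood of a forced vertex is an initial segment of the clique order. -/
theorem CliqueOrder.lt_nbrCount (hτ : CliqueOrder G π C τ)
    (hI : ∀ u v, ¬ C u → ¬ C v → ¬ G.Adj u v) {v c : V} (hv : Forced G π C v) (hc : G.Adj v c) :
    τ c < nbrCount G v := by
  classical
  set A := Finset.univ.filter fun c => G.Adj v c with hA
  set K := Finset.univ.filter fun c => C c with hK
  set L := K.filter fun c => τ c < nbrCount G v with hL
  -- `τ` is a bijection onto the positions below the clique size, so exactly `nbrCount G v` clique
  -- vertices have positions below that number. All of them are neighbors of `v`, and by counting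
  -- there are no other neighbors.
  have hLA : L ⊆ A := by
    intro x hx
    simp only [hL, hK, hA, Finset.mem_filter, Finset.mem_univ, true_and] at hx ⊢
    by_contra h
    exact absurd (hτ.initial v x hv hx.1 h) (not_le.2 hx.2)
  have hinj : Set.InjOn τ K := fun x hx y hy h => by
    simp only [hK, Finset.coe_filter, Finset.mem_univ, true_and, Set.mem_ofPred_eq] at hx hy
    exact hτ.inj x y hx hy h
  have himg : K.image τ = Finset.range (cliqueCount C) := by
    apply Finset.eq_of_subset_of_card_le
    · intro t ht
      obtain ⟨x, hx, rfl⟩ := Finset.mem_image.1 ht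
      simp only [hK, Finset.mem_filter, Finset.mem_univ, true_and] at hx
      exact Finset.mem_range.2 (hτ.bound x hx)
    · rw [Finset.card_image_of_injOn hinj, Finset.card_range]
      simp [cliqueCount, hK]
  have hLimg : Finset.range (nbrCount G v) ⊆ L.image τ := by
    intro t ht
    rw [Finset.mem_range] at ht
    have : t ∈ K.image τ := by
      rw [himg, Finset.mem_range]
      exact lt_of_lt_of_le ht (nbrCount_le_cliqueCount hI hv.1)
    obtain ⟨x, hx, rfl⟩ := Finset.mem_image.1 this
    exact Finset.mem_image_of_mem _ (Finset.mem_filter.2 ⟨hx, ht⟩)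
  have hcard : A.card ≤ L.card := by
    have := Finset.card_le_card hLimg
    rw [Finset.card_range] at this
    calc A.card = nbrCount G v := by simp [nbrCount, hA]
      _ ≤ _ := this
      _ ≤ _ := Finset.card_image_le
  have := Finset.eq_of_subset_of_card_le hLA hcard
  have hcL : c ∈ L := by rw [this]; simpa [hA] using hc
  exact (Finset.mem_filter.1 hcL).2

open Classical in
/-- The main key of the ordering. -/
noncomputable def mainKey (G : SimpleGraph V) (π : V → V → Prop) (C : V → Prop) (τ : V → ℕ)
    (v : V) : ℕ :=
  -- Odd keys belong to the clique, so a forced vertex with slot `t` goes just before the clique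
  -- vertex at position `t`. The last value exceeds every other main key when `τ` takes values below
  -- the size of the clique.
  if C v then 2 * τ v + 1 else if Forced G π C v then 2 * slot G π C τ v else 2 * cliqueCount C + 2

open Classical in
/-- Forced vertices with the same main key are visited by increasing number of neighbors. -/
noncomputable def forcedKey (G : SimpleGraph V) (π : V → V → Prop) (C : V → Prop) (v : V) : ℕ :=
  if Forced G π C v then nbrCount G v else 0

open Classical in
/-- The remaining vertices of the independent set are visited in the lexicographic order of their
neighborhoods. -/
noncomputable def lexKey (G : SimpleGraph V) (π : V → V → Prop) (C : V → Prop) (τ : V → ℕ)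
    (v : V) : Fin (cliqueCount C) → ℕ := fun i =>
  if C v ∨ Forced G π C v ∨ ∃ c, C c ∧ τ c = i ∧ G.Adj v c then 0 else 1

open Classical in
/-- The number of predecessors. -/
noncomputable def predCount (π : V → V → Prop) (v : V) : ℕ :=
  (Finset.univ.filter fun u => π u v).card

/-- The sorting key of an LBFS ordering that extends `π`. -/
noncomputable def sortKey (G : SimpleGraph V) (π : V → V → Prop) (C : V → Prop) (τ : V → ℕ)
    (v : V) : ℕ ×ₗ ℕ ×ₗ Lex (Fin (cliqueCount C) → ℕ) ×ₗ ℕ ×ₗ Fin (Fintype.card V) :=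
  toLex (mainKey G π C τ v, toLex (forcedKey G π C v, toLex (toLex (lexKey G π C τ v),
    toLex (predCount π v, Fintype.equivFin V v))))

theorem sortKey_injective : Function.Injective (sortKey G π C τ) := by
  intro x y h
  simpa [sortKey] using congrArg (fun k => (ofLex (ofLex (ofLex (ofLex k).2).2).2).2) h

theorem sortKey_lt_iff {x y : V} : sortKey G π C τ x < sortKey G π C τ y ↔
    mainKey G π C τ x < mainKey G π C τ y ∨ mainKey G π C τ x = mainKey G π C τ y ∧
      (forcedKey G π C x < forcedKey G π C y ∨ forcedKey G π C x = forcedKey G π C y ∧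
        (toLex (lexKey G π C τ x) < toLex (lexKey G π C τ y) ∨ lexKey G π C τ x = lexKey G π C τ y ∧
          (predCount π x < predCount π y ∨ predCount π x = predCount π y ∧
            Fintype.equivFin V x < Fintype.equivFin V y))) := by
  simp [sortKey, Prod.Lex.toLex_lt_toLex]

theorem mainKey_of_clique {v : V} (h : C v) : mainKey G π C τ v = 2 * τ v + 1 := if_pos h

theorem mainKey_of_forced {v : V} (h : Forced G π C v) :
    mainKey G π C τ v = 2 * slot G π C τ v := by
  rw [mainKey, if_neg h.1, if_pos h]

theorem mainKey_of_not_forced {v : V} (h : ¬ C v) (h' : ¬ Forced G π C v) :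
    mainKey G π C τ v = 2 * cliqueCount C + 2 := by
  rw [mainKey, if_neg h, if_neg h']

theorem mainKey_le_of_lt {x y : V} (h : sortKey G π C τ x < sortKey G π C τ y) :
    mainKey G π C τ x ≤ mainKey G π C τ y := by
  rw [sortKey_lt_iff] at h; omega

theorem forcedKey_le_of_lt {x y : V} (h : sortKey G π C τ x < sortKey G π C τ y)
    (h' : mainKey G π C τ x = mainKey G π C τ y) : forcedKey G π C x ≤ forcedKey G π C y := by
  rw [sortKey_lt_iff] at h; omega

/-- Sorting by slot and then by neighborhood size respects comparability. If only `y` may precede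
`x`, then the neighborhood size of `y` is at most the slot of `x`, hence at most that of `y`, which
never exceeds the former. So the slots agree, and the second key decides. -/
theorem nbrCount_le_slot_of_lt (hins : Insertable G π C τ) {x y : V} (hx : Forced G π C x)
    (hy : Forced G π C y) (h : sortKey G π C τ x < sortKey G π C τ y) :
    nbrCount G x ≤ slot G π C τ y := by
  have hne : x ≠ y := by rintro rfl; exact lt_irrefl _ h
  rcases hins.total x y hx hy hne with h' | h'
  · exact h'.le_slot
  · have h1 := h'.le_slot
    have h2 := mainKey_le_of_lt h
    rw [mainKey_of_forced hx, mainKey_of_forced hy] at h2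
    have h3 := slot_le_nbrCount (G := G) (π := π) (C := C) (τ := τ) y
    have h4 := forcedKey_le_of_lt h (by rw [mainKey_of_forced hx, mainKey_of_forced hy]; omega)
    rw [forcedKey, forcedKey, if_pos hx, if_pos hy] at h4
    omega

theorem predCount_lt (hπ : IsPartialOrder V π) {x y : V} (h : π x y) (hne : x ≠ y) :
    predCount π x < predCount π y := by
  refine Finset.card_lt_card (Finset.ssubset_iff_of_subset ?_ |>.2 ⟨y, ?_, ?_⟩)
  · intro z hz
    simp only [Finset.mem_filter, Finset.mem_univ, true_and] at hz ⊢
    exact hπ.trans _ _ _ hz h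
  · simpa using hπ.refl y
  · simp only [Finset.mem_filter, Finset.mem_univ, true_and]
    exact fun h' => hne (hπ.antisymm _ _ h h')

/-- The premises can only occur when `z` is in the clique and `x`, `y` are unforced vertices of the
independent set; there lexicographic order supplies the earlier witness. Every other position
contradicts the initial segments of the forced vertices, the bound on their slots, or the placement
of unforced vertices after the clique. -/
theorem fourPoint_sortKey (hI : ∀ u v, ¬ C u → ¬ C v → ¬ G.Adj u v)
    (hC : ∀ c d, C c → C d → c ≠ d → G.Adj c d)
    (hτ : CliqueOrder G π C τ) (hins : Insertable G π C τ) : FourPoint G (sortKey G π C τ) := by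
  intro z x y hzx hxy hzy hnzx
  have hzx' := mainKey_le_of_lt hzx
  have hxy' := mainKey_le_of_lt hxy
  have hne : z ≠ x := by rintro rfl; exact lt_irrefl _ hzx
  by_cases hx : C x
  · exfalso
    have hz : ¬ C z := fun hz => hnzx (hC z x hz hx hne)
    have hy : C y := by by_contra h; exact hI z y hz h hzy
    rw [mainKey_of_clique hx] at hzx' hxy'
    rw [mainKey_of_clique hy] at hxy'
    by_cases hzF : Forced G π C z
    · have h1 := hτ.initial z x hzF hx hnzx
      have h2 := hτ.lt_nbrCount hI hzF hzy
      omega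
    · rw [mainKey_of_not_forced hz hzF] at hzx'
      have := hτ.bound x hx
      omega
  have hyF : C y → Forced G π C x := by
    intro hy
    by_contra hxF
    rw [mainKey_of_not_forced hx hxF, mainKey_of_clique hy] at hxy'
    have := hτ.bound y hy
    omega
  by_cases hz : C z
  · by_cases hxF : Forced G π C x
    · exfalso
      rw [mainKey_of_clique hz, mainKey_of_forced hxF] at hzx'
      have h1 := hτ.initial x z hxF hz fun h => hnzx h.symm
      have h2 := slot_le_nbrCount (G := G) (π := π) (C := C) (τ := τ) x
      omega
    · have hy : ¬ C y := fun h => hxF (hyF h)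
      have hyF : ¬ Forced G π C y := by
        intro h
        rw [mainKey_of_not_forced hx hxF, mainKey_of_forced h] at hxy'
        have h1 := slot_le_nbrCount (G := G) (π := π) (C := C) (τ := τ) y
        have h2 := nbrCount_le_cliqueCount (G := G) hI hy
        omega
      have hzb := hτ.bound z hz
      have hbit : ∀ {v : V}, ¬ C v → ¬ Forced G π C v → ∀ {c : V} (hc : C c),
          (lexKey G π C τ v ⟨τ c, hτ.bound c hc⟩ = 0 ↔ G.Adj v c) := by
        intro v hv hvF c hc
        simp only [lexKey, hv, hvF, false_or, ite_eq_left_iff, one_ne_zero, imp_false, not_not]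
        constructor
        · rintro ⟨c', hc', h, h'⟩
          rwa [← hτ.inj c' c hc' hc h]
        · exact fun h => ⟨c, hc, rfl, h⟩
      have hbit' : ∀ {v : V}, ¬ C v → ¬ Forced G π C v → ∀ i, lexKey G π C τ v i = 0 →
          ∃ c, C c ∧ τ c = i ∧ G.Adj v c := by
        intro v hv hvF i h
        simpa [lexKey, hv, hvF] using h
      have hle : toLex (lexKey G π C τ x) < toLex (lexKey G π C τ y) := by
        have hne' : lexKey G π C τ x ≠ lexKey G π C τ y := by
          intro h
          have h1 := (hbit hy hyF hz).2 hzy.symm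
          rw [← h] at h1
          exact hnzx ((hbit hx hxF hz).1 h1).symm
        rw [sortKey_lt_iff, mainKey_of_not_forced hx hxF, mainKey_of_not_forced hy hyF] at hxy
        simpa [forcedKey, hxF, hyF, hne'] using hxy
      -- Coordinate `0` means adjacency, so the first difference is a clique vertex adjacent to `x`
      -- but not to `y`. It lies before `z`, whose coordinate shows a difference in favor of `y`.
      obtain ⟨i, hi, hlt⟩ := hle
      simp only [Pi.toLex_apply] at hi hlt
      have hxi : lexKey G π C τ x i = 0 := by
        have : lexKey G π C τ y i ≤ 1 := by unfold lexKey; split_ifs <;> simp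
        omega
      obtain ⟨c, hc, hci, hxc⟩ := hbit' hx hxF i hxi
      obtain rfl : i = ⟨τ c, hτ.bound c hc⟩ := Fin.ext hci.symm
      have hyc : ¬ G.Adj y c := fun h => by rw [(hbit hy hyF hc).2 h] at hlt; omega
      refine ⟨c, ?_, hxc.symm, fun h => hyc h.symm⟩
      rw [sortKey_lt_iff, mainKey_of_clique hc, mainKey_of_clique hz]
      left
      by_contra hcon
      rcases Nat.lt_or_ge (τ z) (τ c) with h | h
      · have := hi ⟨τ z, hzb⟩ h
        rw [(hbit hy hyF hz).2 hzy.symm] at this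
        exact hnzx ((hbit hx hxF hz).1 this).symm
      · have : z = c := hτ.inj z c hz hc (by omega)
        subst this
        exact hnzx hxc.symm
  · exfalso
    have hy : C y := by by_contra h; exact hI z y hz h hzy
    have hxF := hyF hy
    have hzF : Forced G π C z := by
      by_contra h
      rw [mainKey_of_not_forced hz h, mainKey_of_forced hxF] at hzx'
      have h1 := slot_le_nbrCount (G := G) (π := π) (C := C) (τ := τ) x
      have h2 := nbrCount_le_cliqueCount (G := G) hI hx
      omega
    have h1 := nbrCount_le_slot_of_lt hins hzF hxF hzx
    have h2 := hτ.lt_nbrCount hI hzF hzy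
    rw [mainKey_of_forced hxF, mainKey_of_clique hy] at hxy'
    omega

/-- Each condition on `τ` serves one kind of pair: `order` pairs inside the clique, `clique` and
`forced` pairs that end in a forced vertex, `before` pairs of unforced vertices. The definition of
the slot handles pairs from a forced vertex to the clique, and predecessor counts break the
remaining ties. -/
theorem sortKey_lt_of_rel (hπ : IsPartialOrder V π) (hI : ∀ u v, ¬ C u → ¬ C v → ¬ G.Adj u v)
    (hτ : CliqueOrder G π C τ) (hins : Insertable G π C τ) {x y : V} (h : π x y) (hne : x ≠ y) :
    sortKey G π C τ x < sortKey G π C τ y := by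
  rw [sortKey_lt_iff]
  have hpred := predCount_lt hπ h hne
  by_cases hx : C x
  · left
    rw [mainKey_of_clique hx]
    by_cases hy : C y
    · rw [mainKey_of_clique hy]
      have := hτ.order x y hx hy h hne
      omega
    by_cases hyF : Forced G π C y
    · rw [mainKey_of_forced hyF]
      suffices τ x < slot G π C τ y by omega
      rcases slot_eq (G := G) (π := π) (C := C) (τ := τ) y with h' | ⟨c, hc, hyc, h'⟩
      · rw [h']
        exact hτ.lt_nbrCount hI hyF (hins.clique x y hx hyF h)
      · rw [← h']
        refine hτ.order x c hx hc (hπ.trans _ _ _ h hyc) ?_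
        rintro rfl
        exact hne (hπ.antisymm _ _ h hyc)
    · rw [mainKey_of_not_forced hy hyF]
      have := hτ.bound x hx
      omega
  by_cases hxF : Forced G π C x
  · have h1 := slot_le_nbrCount (G := G) (π := π) (C := C) (τ := τ) x
    have h2 := nbrCount_le_cliqueCount (G := G) hI hx
    rw [mainKey_of_forced hxF]
    by_cases hy : C y
    · left
      rw [mainKey_of_clique hy]
      have := slot_le (G := G) (π := π) (C := C) (τ := τ) hy h
      omega
    by_cases hyF : Forced G π C y
    · rw [mainKey_of_forced hyF]
      -- Now slot of `x` ≤ degree of `x` ≤ slot of `y` ≤ degree of `y`, so equality of the first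
      -- keys is the worst case.
      have h3 := (hins.forced x y hxF hyF hne h).le_slot
      have h4 := slot_le_nbrCount (G := G) (π := π) (C := C) (τ := τ) y
      have e : lexKey G π C τ x = lexKey G π C τ y := by
        funext i; simp [lexKey, hxF, hyF]
      simp only [forcedKey, if_pos hxF, if_pos hyF, e, hpred, true_or, or_true, and_true]
      omega
    · left
      rw [mainKey_of_not_forced hy hyF]
      omega
  -- The set of forced vertices is closed downwards inside the independent set, so nothing above the
  -- unforced `x` is forced or in the clique.
  · have hy : ¬ C y := fun hy =>
      hxF ⟨hx, x, hπ.refl x, hx, y, h, Or.inl hy⟩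
    have hyF : ¬ Forced G π C y := by
      rintro ⟨_, w, hyw, hw⟩
      exact hxF ⟨hx, w, hπ.trans _ _ _ h hyw, hw⟩
    rw [mainKey_of_not_forced hx hxF, mainKey_of_not_forced hy hyF]
    simp only [forcedKey, if_neg hxF, if_neg hyF, lt_irrefl, true_and, false_or]
    rcases lt_trichotomy (toLex (lexKey G π C τ x)) (toLex (lexKey G π C τ y)) with hl | hl | hl
    · exact Or.inl hl
    · exact Or.inr ⟨toLex_inj.1 hl, Or.inl hpred⟩
    · exfalso
      obtain ⟨i, hi, hlt⟩ := hl
      simp only [Pi.toLex_apply] at hi hlt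
      have hyi : lexKey G π C τ y i = 0 := by
        have : lexKey G π C τ x i ≤ 1 := by unfold lexKey; split_ifs <;> simp
        omega
      have hxi : lexKey G π C τ x i ≠ 0 := by omega
      obtain ⟨b, hb, hbi, hyb⟩ : ∃ c, C c ∧ τ c = i ∧ G.Adj y c := by
        simpa [lexKey, hy, hyF] using hyi
      have hxb : ¬ G.Adj x b := by
        intro h'
        exact hxi (by simp only [lexKey]; rw [if_pos (Or.inr (Or.inr ⟨b, hb, hbi, h'⟩))])
      -- If `y` came lexicographically first, with first difference `b`, this earlier difference `a`
      -- would be a contradiction.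
      obtain ⟨a, hxa, hya, hab⟩ := hτ.before x y b h hx hy hxF hyb hxb
      have ha : C a := by by_contra h'; exact hI x a hx h' hxa
      have hj := hi ⟨τ a, hτ.bound a ha⟩ (by simpa [Fin.lt_def, ← hbi] using hab)
      have hxa' : lexKey G π C τ x ⟨τ a, hτ.bound a ha⟩ = 0 := by
        simp only [lexKey]; rw [if_pos (Or.inr (Or.inr ⟨a, ha, rfl, hxa⟩))]
      rw [hxa'] at hj
      obtain ⟨a', ha', haa, hya'⟩ : ∃ c, C c ∧ τ c = τ a ∧ G.Adj y c := by
        simpa [lexKey, hy, hyF] using hj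
      rw [hτ.inj a' a ha' ha haa] at hya'
      exact hya hya'

/-- If the clique has an enumeration into which the forced vertices can be inserted, then some LBFS
ordering extends `π`. -/
theorem exists_ordering_of_cliqueOrder {n : ℕ} (hn : Fintype.card V = n) (hπ : IsPartialOrder V π)
    (hC : ∀ c d, C c → C d → c ≠ d → G.Adj c d) (hI : ∀ u v, ¬ C u → ¬ C v → ¬ G.Adj u v)
    (hτ : CliqueOrder G π C τ) (hins : Insertable G π C τ) :
    ∃ σ : Fin n ≃ V, IsLBFSOrdering G σ ∧ Extends σ π :=
  exists_ordering_of_key hn (sortKey G π C τ) sortKey_injective (fourPoint_sortKey hI hC hτ hins)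
    fun _ _ h hne => sortKey_lt_of_rel hπ hI hτ hins h hne

end Sufficiency

/-! ### The split partition by degrees -/

section Partition

variable {V : Type*} [Fintype V] [LinearOrder V] (G : SimpleGraph V)

/-- The order by decreasing degree. -/
def DegreeBefore (u v : V) : Prop :=
  nbrCount G v < nbrCount G u ∨ nbrCount G u = nbrCount G v ∧ u < v

open Classical in
/-- The number of vertices before `v` in the order by decreasing degree. -/
noncomputable def degreeRank (v : V) : ℕ :=
  (Finset.univ.filter fun u => DegreeBefore G u v).card

/-- The vertices whose rank does not exceed their degree. -/
def InClique (v : V) : Prop := degreeRank G v ≤ nbrCount G v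

variable {G}

theorem DegreeBefore.total {u v : V} (h : u ≠ v) : DegreeBefore G u v ∨ DegreeBefore G v u := by
  unfold DegreeBefore
  rcases lt_or_gt_of_ne h with h | h <;> simp only [h, and_true] <;> omega

theorem le_degreeRank {v : V} {S : Finset V} (h : ∀ u ∈ S, DegreeBefore G u v) :
    S.card ≤ degreeRank G v :=
  Finset.card_le_card fun u hu => by simpa using h u hu

theorem degreeRank_le {v : V} {S : Finset V} (h : ∀ u, DegreeBefore G u v → u ∈ S) :
    degreeRank G v ≤ S.card :=
  Finset.card_le_card fun u hu => h u (by simpa using hu)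

/-- Take a partition with a largest clique side. An outside vertex adjacent to all of it could be
moved into it. -/
theorem exists_maximal_split (h : IsSplitGraph G) : ∃ K : Finset V,
    (∀ c ∈ K, ∀ d ∈ K, c ≠ d → G.Adj c d) ∧ (∀ u ∉ K, ∀ v ∉ K, ¬ G.Adj u v) ∧
    ∀ v ∉ K, ∃ c ∈ K, ¬ G.Adj v c := by
  classical
  obtain ⟨C, hC, hI⟩ := h
  let good : Finset V → Prop := fun K =>
    (∀ c ∈ K, ∀ d ∈ K, c ≠ d → G.Adj c d) ∧ (∀ u ∉ K, ∀ v ∉ K, ¬ G.Adj u v)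
  have h0 : good (Finset.univ.filter (· ∈ C)) := by
    constructor
    · intro c hc d hd hne
      exact hC (by simpa using hc) (by simpa using hd) hne
    · intro u hu v hv
      by_cases huv : u = v
      · subst huv; exact G.loopless.irrefl u
      · exact hI (by simpa using hu) (by simpa using hv) huv
  obtain ⟨K, hK, hmax⟩ := Set.exists_max_image {K | good K} Finset.card (Set.toFinite _) ⟨_, h0⟩
  refine ⟨K, hK.1, hK.2, fun v hv => ?_⟩
  by_contra! hcon
  have : good (insert v K) := by
    constructor
    · intro c hc d hd hne
      rw [Finset.mem_insert] at hc hd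
      rcases hc with rfl | hc <;> rcases hd with rfl | hd
      · exact absurd rfl hne
      · exact hcon d hd
      · exact (hcon c hc).symm
      · exact hK.1 c hc d hd hne
    · intro u hu w hw
      simp only [Finset.mem_insert, not_or] at hu hw
      exact hK.2 u hu.2 w hw.2
  have := hmax _ this
  rw [Finset.card_insert_of_notMem hv] at this
  omega

/-- In a split graph, the vertices whose rank does not exceed their degree form a clique and the
other vertices form an independent set. -/
theorem inClique_partition (h : IsSplitGraph G) :
    (∀ c d, InClique G c → InClique G d → c ≠ d → G.Adj c d) ∧
    ∀ u v, ¬ InClique G u → ¬ InClique G v → ¬ G.Adj u v := by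
  classical
  obtain ⟨K, hK, hI, hfull⟩ := exists_maximal_split h
  set N : V → Finset V := fun v => Finset.univ.filter fun c => G.Adj v c with hN
  have hmem : ∀ {v c}, c ∈ N v ↔ G.Adj v c := by simp [hN]
  have hcard : ∀ v, (N v).card = nbrCount G v := fun v => by simp [hN, nbrCount]
  have hsubI : ∀ {v c}, v ∉ K → ¬ G.Adj v c → N v ⊆ K.erase c := by
    intro v c hv hc x hx
    rw [hmem] at hx
    refine Finset.mem_erase.2 ⟨by rintro rfl; exact hc hx, ?_⟩
    by_contra hxK
    exact hI v hv x hxK hx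
  -- Degrees are at most |K| - 1 outside `K` and at least |K| - 1 inside, so the rank test can
  -- deviate from `K` only at vertices of degree exactly |K| - 1.
  have hdI : ∀ v ∉ K, nbrCount G v + 1 ≤ K.card := by
    intro v hv
    obtain ⟨c, hc, hvc⟩ := hfull v hv
    have := Finset.card_le_card (hsubI hv hvc)
    have := Finset.card_erase_add_one hc
    rw [hcard] at *
    omega
  have hsubC : ∀ {c}, c ∈ K → K.erase c ⊆ N c := by
    intro c hc x hx
    rw [Finset.mem_erase] at hx
    exact hmem.2 (hK c hc x hx.2 (Ne.symm hx.1))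
  have hdC : ∀ c ∈ K, K.card ≤ nbrCount G c + 1 := by
    intro c hc
    have := Finset.card_le_card (hsubC hc)
    have := Finset.card_erase_add_one hc
    rw [hcard] at *
    omega
  have hNC : ∀ c ∈ K, nbrCount G c + 1 = K.card → K.erase c = N c := by
    intro c hc h
    have := Finset.card_erase_add_one hc
    exact Finset.eq_of_subset_of_card_le (hsubC hc) (by rw [hcard]; omega)
  have hNI : ∀ v ∉ K, ∀ c ∈ K, nbrCount G v + 1 = K.card → ¬ G.Adj v c → N v = K.erase c := by
    intro v hv c hc h hvc
    have := Finset.card_erase_add_one hc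
    exact Finset.eq_of_subset_of_card_le (hsubI hv hvc) (by rw [hcard]; omega)
  have hIn : ∀ v ∉ K, InClique G v → nbrCount G v + 1 = K.card := by
    intro v hv hin
    by_contra hne
    have := hdI v hv
    have hle : K.card ≤ degreeRank G v := le_degreeRank fun u hu => by
      have := hdC u hu
      left; omega
    unfold InClique at hin
    omega
  have hOut : ∀ v ∈ K, ¬ InClique G v → nbrCount G v + 1 = K.card := by
    intro v hv hin
    by_contra hne
    have := hdC v hv
    have hle : degreeRank G v ≤ (K.erase v).card := degreeRank_le fun u hu => by
      refine Finset.mem_erase.2 ⟨?_, ?_⟩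
      · rintro rfl; rcases hu with hu | hu <;> simp at hu
      · by_contra huK
        have := hdI u huK
        unfold DegreeBefore at hu
        omega
    have := Finset.card_erase_add_one hv
    unfold InClique at hin
    omega
  have hlarge : ∀ v ∉ K, ∀ c ∈ K, G.Adj v c → K.card ≤ nbrCount G c := by
    intro v hv c hc hvc
    by_contra hlt
    have := hNC c hc (by have := hdC c hc; omega)
    have hvN : v ∈ N c := hmem.2 hvc.symm
    rw [← this] at hvN
    exact hv (Finset.mem_of_mem_erase hvN)
  -- The |K| - 1 neighbors of `v` all have degree at least |K| and precede it. One further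
  -- predecessor would push its rank above its degree |K| - 1. So an outside vertex can only enter
  -- in exchange for the one clique vertex that it misses.
  have hbefore : ∀ v ∉ K, InClique G v → ∀ c ∈ K, ¬ G.Adj v c → ∀ w, DegreeBefore G w v →
      w ∉ K.erase c → False := by
    intro v hv hin c hc hvc w hw hwK
    have hd := hIn v hv hin
    have hle : (insert w (K.erase c)).card ≤ degreeRank G v := le_degreeRank fun u hu => by
      rcases Finset.mem_insert.1 hu with rfl | hu
      · exact hw
      · have := hlarge v hv u (Finset.mem_of_mem_erase hu)
          (hmem.1 (hNI v hv c hc hd hvc ▸ hu))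
        left; omega
    rw [Finset.card_insert_of_notMem hwK, Finset.card_erase_add_one hc] at hle
    unfold InClique at hin
    omega
  have hclique : ∀ c ∈ K, ∀ v ∉ K, InClique G c → InClique G v → G.Adj c v := by
    intro x hx y hy hinx hiny
    by_contra hcon
    have hyx : ¬ G.Adj y x := fun h => hcon h.symm
    have hd := hIn y hy hiny
    rcases DegreeBefore.total (G := G) (u := x) (v := y) (by rintro rfl; exact hy hx) with h | h
    · exact hbefore y hy hiny x hx hyx x h (by simp)
    · have hle : (insert y (K.erase x)).card ≤ degreeRank G x := le_degreeRank fun u hu => by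
        rcases Finset.mem_insert.1 hu with rfl | hu
        · exact h
        · have := hlarge y hy u (Finset.mem_of_mem_erase hu) (hmem.1 (hNI y hy x hx hd hyx ▸ hu))
          unfold DegreeBefore at *
          left; omega
      rw [Finset.card_insert_of_notMem (by simp [hy]), Finset.card_erase_add_one hx] at hle
      unfold InClique DegreeBefore at *
      omega
  have hIclique : ∀ x ∉ K, ∀ y ∉ K, InClique G y → ¬ DegreeBefore G x y := by
    intro x hx y hy hin hxy
    obtain ⟨c, hc, hyc⟩ := hfull y hy
    exact hbefore y hy hin c hc hyc x hxy fun h => hx (Finset.mem_of_mem_erase h)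
  -- An adjacent rejected pair would lie in `K`, both without neighbors outside `K`. The rank of `x`
  -- yields a vertex `v` outside `K` whose neighborhood is `K` without `x`, hence contains `y`.
  have hindep : ∀ x ∈ K, ∀ y, ¬ InClique G x → ¬ InClique G y → ¬ G.Adj x y := by
    intro x hx y hinx hiny hxy
    have hdx := hOut x hx hinx
    have hNx := hNC x hx hdx
    have hyN : y ∈ N x := hmem.2 hxy
    rw [← hNx, Finset.mem_erase] at hyN
    have hNy := hNC y hyN.2 (hOut y hyN.2 hiny)
    have : ∃ v, DegreeBefore G v x ∧ v ∉ K.erase x := by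
      by_contra! hcon
      have hle := degreeRank_le hcon
      have := Finset.card_erase_add_one hx
      unfold InClique at hinx
      omega
    obtain ⟨v, hv, hvK⟩ := this
    have hvx : v ≠ x := by rintro rfl; rcases hv with hv | hv <;> simp at hv
    have hvK : v ∉ K := fun h => hvK (Finset.mem_erase.2 ⟨hvx, h⟩)
    have hdv : nbrCount G v + 1 = K.card := by
      have := hdI v hvK
      unfold DegreeBefore at hv
      omega
    have hnot : ∀ z ∈ K, K.erase z = N z → ¬ G.Adj v z := by
      intro z _ hNz h
      have : v ∈ N z := hmem.2 h.symm
      rw [← hNz] at this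
      exact hvK (Finset.mem_of_mem_erase this)
    have h1 := hNI v hvK x hx hdv (hnot x hx hNx)
    have h2 : y ∈ N v := by rw [h1]; exact Finset.mem_erase.2 hyN
    exact hnot y hyN.2 hNy (hmem.1 h2)
  constructor
  · intro x y hinx hiny hne
    by_cases hx : x ∈ K <;> by_cases hy : y ∈ K
    · exact hK x hx y hy hne
    · exact hclique x hx y hy hinx hiny
    · exact (hclique y hy x hx hiny hinx).symm
    · rcases DegreeBefore.total (G := G) hne with h | h
      · exact absurd h (hIclique x hx y hy hiny)
      · exact absurd h (hIclique y hy x hx hinx)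
  · intro x y hinx hiny hxy
    by_cases hx : x ∈ K
    · exact hindep x hx y hinx hiny hxy
    · by_cases hy : y ∈ K
      · exact hindep y hy x hiny hinx hxy.symm
      · exact hI x hx y hy hxy

end Partition

/-! ### The greedy enumeration of the clique -/

/-- Disjunction of tests. -/
def Test.or (b c : Test) : Test := .not (.and (.not b) (.not c))

/-- The test whether the flag with index `e` in array `a` is set. -/
def flag (a : ℕ) (e : Expr) : Test := .lt (.lit 0) (.get a e)

/-- The index of the matrix entry in row `e` and column `f`. -/
def entry (e f : Expr) : Expr := .add (.mul e (.reg 0)) f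

theorem Test.holds_or {s : Store} {b c : Test} : (b.or c).Holds s ↔ b.Holds s ∨ c.Holds s := by
  simp only [Test.or, Test.Holds]; tauto

theorem flag_holds {s : Store} {a : ℕ} {e : Expr} : (flag a e).Holds s ↔ 0 < s.arr a (e.val s) :=
  Iff.rfl

theorem entry_val {s : Store} {e f : Expr} :
    (entry e f).val s = e.val s * s.reg 0 + f.val s := rfl

/-- The test whether the pair with the index `e` prevents the choice of the vertex `f`. -/
def blockTest (e f : Expr) : Test :=
  Test.or
    (.and (.not (flag 13 e))
      (.and (flag 8 (entry (.get 3 e) f)) (.not (flag 8 (entry (.get 2 e) f)))))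
    (.and (flag 12 (.get 2 e))
      (.and (.not (flag 8 (entry (.get 2 e) f))) (.lt (.reg 6) (.get 5 (.get 2 e)))))

/-- The test whether the pointer of the vertex in register `8` can be advanced. -/
def advanceTest : Test :=
  .and (.lt (.get 14 (.reg 8)) (.reg 2)) (.not (blockTest (.get 14 (.reg 8)) (.reg 8)))

/-- Advance the pointer of the vertex in register `8` to the first pair which prevents its choice. -/
def advance : Cmd :=
  .while advanceTest (.store 14 (.reg 8) (.add (.get 14 (.reg 8)) (.lit 1)))

/-- Examine the vertex in register `8`. -/
def examine : Cmd :=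
  .ite (.and (flag 7 (.reg 8)) (.not (flag 16 (.reg 8))))
    (.seq advance
      (.ite (.lt (.get 14 (.reg 8)) (.reg 2)) .skip (.assign 7 (.add (.reg 8) (.lit 1)))))
    .skip

/-- Put the vertex found before at the next position. -/
def place : Cmd :=
  .seq (.assign 10 (.sub (.reg 7) (.lit 1)))
    (.seq (.store 15 (.reg 10) (.reg 6))
      (.seq (.store 16 (.reg 10) (.lit 1))
        (.seq (.assign 6 (.add (.reg 6) (.lit 1)))
          (flagLoop 9 2 13
            (.and (flag 8 (entry (.get 2 (.reg 9)) (.reg 10)))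
              (.not (flag 8 (entry (.get 3 (.reg 9)) (.reg 10)))))
            (.reg 9)))))

/-- Look for a vertex that can be chosen, and place it. -/
def round : Cmd :=
  .seq (.assign 7 (.lit 0))
    (.seq (forLoop 8 0 examine) (.ite (.lt (.lit 0) (.reg 7)) place .skip))

/-- Enumerate the clique. -/
def greedy : Cmd := forLoop 5 0 round

/-- The pair with index `p` prevents the choice of `d`. -/
def Blocks (s : Store) (d p : ℕ) : Prop :=
  (¬ 0 < s.arr 13 p ∧ 0 < s.arr 8 (s.arr 3 p * s.reg 0 + d) ∧
    ¬ 0 < s.arr 8 (s.arr 2 p * s.reg 0 + d)) ∨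
  (0 < s.arr 12 (s.arr 2 p) ∧ ¬ 0 < s.arr 8 (s.arr 2 p * s.reg 0 + d) ∧
    s.reg 6 < s.arr 5 (s.arr 2 p))

theorem blockTest_holds {s : Store} {e f : Expr} :
    (blockTest e f).Holds s ↔ Blocks s (f.val s) (e.val s) := by
  simp only [blockTest, Test.holds_or, Test.Holds, flag_holds, entry_val, Blocks, Expr.val]

theorem Blocks.congr {s s' : Store} (h0 : s.reg 0 = s'.reg 0) (h6 : s.reg 6 = s'.reg 6)
    (ha : ∀ a ∈ [2, 3, 5, 8, 12, 13], s.arr a = s'.arr a) (d p : ℕ) :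
    Blocks s d p ↔ Blocks s' d p := by
  simp only [List.mem_cons, List.not_mem_nil, or_false, forall_eq_or_imp, forall_eq] at ha
  obtain ⟨h2, h3, h5, h8, h12, h13⟩ := ha
  simp only [Blocks, *]

open Classical in
/-- What holds before each round of the enumeration that was started in the store `s₀`. -/
structure GreedyInv (s₀ s : Store) : Prop where
  reg_zero : s.reg 0 = s₀.reg 0
  reg_two : s.reg 2 = s₀.reg 2
  arr : ∀ a, a ∉ [13, 14, 15, 16] → s.arr a = s₀.arr a
  pointer_le : ∀ d, s.arr 14 d ≤ s₀.reg 2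
  pointer : ∀ d, ∀ p < s.arr 14 d, ¬ Blocks s d p
  satisfied : ∀ p < s₀.reg 2, 0 < s.arr 13 p ↔ 0 < s₀.arr 13 p ∨ ∃ c, 0 < s.arr 16 c ∧
    0 < s₀.arr 8 (s₀.arr 2 p * s₀.reg 0 + c) ∧ ¬ 0 < s₀.arr 8 (s₀.arr 3 p * s₀.reg 0 + c)
  placed : ∀ d, 0 < s.arr 16 d → d < s₀.reg 0 ∧ 0 < s₀.arr 7 d ∧ s.arr 15 d < s.reg 6
  inj : ∀ d d', 0 < s.arr 16 d → 0 < s.arr 16 d' → s.arr 15 d = s.arr 15 d' → d = d'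
  card : s.reg 6 = ((Finset.range (s₀.reg 0)).filter fun d => 0 < s.arr 16 d).card
  item : ∀ d p, 0 < s.arr 16 d → p < s₀.reg 2 → 0 < s₀.arr 13 p ∨
    ¬ 0 < s₀.arr 8 (s₀.arr 3 p * s₀.reg 0 + d) ∨ 0 < s₀.arr 8 (s₀.arr 2 p * s₀.reg 0 + d) ∨
    ∃ c, 0 < s.arr 16 c ∧ s.arr 15 c < s.arr 15 d ∧ 0 < s₀.arr 8 (s₀.arr 2 p * s₀.reg 0 + c) ∧
      ¬ 0 < s₀.arr 8 (s₀.arr 3 p * s₀.reg 0 + c)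
  initial : ∀ d p, 0 < s.arr 16 d → p < s₀.reg 2 → 0 < s₀.arr 12 (s₀.arr 2 p) →
    ¬ 0 < s₀.arr 8 (s₀.arr 2 p * s₀.reg 0 + d) → s₀.arr 5 (s₀.arr 2 p) ≤ s.arr 15 d

/-! ### Amortized running time and correctness of the greedy enumeration. -/

section Greedy

variable {B W : ℕ} {s₀ s : Store} {Q : ℕ → Store → Prop}

/-- The sum of the pointers. -/
def pointerSum (n : ℕ) (g : ℕ → ℕ) : ℕ := ∑ d ∈ Finset.range n, g d

theorem pointerSum_update {n : ℕ} {g : ℕ → ℕ} {d q : ℕ} (hd : d < n) (h : g d ≤ q) :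
    pointerSum n (Function.update g d q) = pointerSum n g + (q - g d) := by
  have h1 : d ∈ Finset.range n := Finset.mem_range.2 hd
  unfold pointerSum
  rw [Finset.sum_update_of_mem h1, Finset.sum_eq_add_sum_sdiff_singleton_of_mem h1 g]
  omega

/-- Apart from a constant, the time is charged to the distance moved by the pointer; over all rounds
these distances telescope. -/
theorem runs_advance (hW : WordBound B W) (hs : s.Bounded B) {d : ℕ} (hd : s.reg 8 = d)
    (hle : s.arr 14 d ≤ s.reg 2) (hp : ∀ p < s.arr 14 d, ¬ Blocks s d p)
    (hQ : ∀ t q, s.arr 14 d ≤ q → q ≤ s.reg 2 → t ≤ 90 * (q - s.arr 14 d) + 90 →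
      (∀ p < q, ¬ Blocks s d p) → (q < s.reg 2 → Blocks s d q) →
      Q t ⟨s.reg, Function.update s.arr 14 (Function.update (s.arr 14) d q)⟩) :
    Runs B W advance s Q := by
  have hcost : advanceTest.cost ≤ 80 := by decide
  have hblk : ∀ g p, Blocks ⟨s.reg, Function.update s.arr 14 g⟩ d p ↔ Blocks s d p := fun g p =>
    Blocks.congr rfl rfl (by simp) d p
  apply Runs.while hW (by decide)
    (fun t s' => ∃ q, s.arr 14 d ≤ q ∧ q ≤ s.reg 2 ∧ t ≤ 90 * (q - s.arr 14 d) ∧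
      (∀ p < q, ¬ Blocks s d p) ∧
      s' = ⟨s.reg, Function.update s.arr 14 (Function.update (s.arr 14) d q)⟩)
    (fun s' => s.reg 2 - s'.arr 14 d) hs
  · exact ⟨s.arr 14 d, le_rfl, hle, by simp, hp, by simp⟩
  · rintro t s' hs' ⟨q, h1, h2, ht, hq, rfl⟩ hb
    simp only [advanceTest, Test.Holds, blockTest_holds, Expr.val, hd, Function.update_self, hblk]
      at hb
    have hB := hs.reg 2
    apply Runs.store hW hs' (by decide) (by decide)
    · simp only [Expr.val, hd, Function.update_self]; omega
    · refine ⟨⟨q + 1, by omega, hb.1, ?_, ?_, ?_⟩, ?_⟩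
      · simp only [Expr.cost]; omega
      · intro p hp'
        rcases Nat.lt_succ_iff_lt_or_eq.1 hp' with h | rfl
        · exact hq p h
        · exact hb.2
      · simp [Store.setArr, Expr.val, hd]
      · simp [Store.setArr, Expr.val, hd]; omega
  · rintro t s' hs' ⟨q, h1, h2, ht, hq, rfl⟩ hb
    simp only [advanceTest, Test.Holds, blockTest_holds, Expr.val, hd, Function.update_self, hblk,
      not_and, not_not] at hb
    exact hQ _ q h1 h2 (by omega) hq hb

/-- Examining all vertices advances all pointers as far as possible and finds an available vertex, if
there is one. -/
theorem runs_examineAll (hW : WordBound B W) (hs : s.Bounded B) {n : ℕ} (hn : s.reg 0 = n)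
    (h7 : s.reg 7 = 0) (hle : ∀ d, s.arr 14 d ≤ s.reg 2)
    (hp : ∀ d, ∀ p < s.arr 14 d, ¬ Blocks s d p)
    (hQ : ∀ t g f, t + 90 * pointerSum n (s.arr 14) ≤ 148 * n + 6 + 90 * pointerSum n g →
      (∀ d, g d ≤ s.reg 2) → (∀ d, ∀ p < g d, ¬ Blocks s d p) →
      (∀ d, f = d + 1 → d < n ∧ 0 < s.arr 7 d ∧ ¬ 0 < s.arr 16 d ∧
        ∀ p < s.reg 2, ¬ Blocks s d p) →
      (f = 0 → ∀ d < n, 0 < s.arr 7 d → ¬ 0 < s.arr 16 d → ∃ p < s.reg 2, Blocks s d p) →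
      Q t ⟨Function.update (Function.update s.reg 7 f) 8 n, Function.update s.arr 14 g⟩) :
    Runs B W (forLoop 8 0 examine) s Q := by
  have hnB := hs.reg 0
  apply Runs.forLoop hW hs n (fun i t s' => ∃ g f,
      s' = ⟨Function.update (Function.update s.reg 7 f) 8 i, Function.update s.arr 14 g⟩ ∧
      t + 90 * pointerSum n (s.arr 14) ≤ 140 * i + 90 * pointerSum n g ∧
      (∀ d, g d ≤ s.reg 2) ∧ (∀ d, ∀ p < g d, ¬ Blocks s d p) ∧
      (∀ d, f = d + 1 → d < n ∧ 0 < s.arr 7 d ∧ ¬ 0 < s.arr 16 d ∧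
        ∀ p < s.reg 2, ¬ Blocks s d p) ∧
      (f = 0 → ∀ d < i, 0 < s.arr 7 d → ¬ 0 < s.arr 16 d → ∃ p < s.reg 2, Blocks s d p))
    (hn ▸ hnB)
  · rintro i t s' ⟨g, f, rfl, _⟩
    simp [hn]
  · refine ⟨s.arr 14, 0, ?_, by simp, hle, hp, by simp, by simp⟩
    have : Function.update s.reg 7 0 = s.reg := by rw [Function.update_eq_self_iff]; exact h7.symm
    simp [Store.setReg, this]
  · rintro i t s' hi hs' ⟨g, f, rfl, ht, hg, hgp, hf, hf0⟩
    have hblk : ∀ p, Blocks ⟨Function.update (Function.update s.reg 7 f) 8 i,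
        Function.update s.arr 14 g⟩ i p ↔ Blocks s i p := fun p =>
      Blocks.congr (by simp) (by simp) (by simp) i p
    apply Runs.ite hW hs' (by decide)
    · intro hb
      simp only [Test.Holds, flag_holds, Expr.val] at hb
      norm_num at hb
      apply Runs.seq
      apply runs_advance hW hs' (d := i) (by simp) (by simpa using hg i)
        (by simpa [hblk] using hgp i)
      intro t' q hq1 hq2 ht' hqp hqb
      simp only [Function.update_self] at hq1 ht'
      simp only [hblk] at hqp hqb
      norm_num at hq2 hqb
      have hs'' : (Store.mk (Function.update (Function.update s.reg 7 f) 8 i)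
          (Function.update s.arr 14 (Function.update g i q))).Bounded B := by
        refine ⟨hs'.reg, fun a j => ?_⟩
        by_cases ha : a = 14
        · subst ha
          by_cases hj : j = i
          · subst hj; simpa using lt_of_le_of_lt hq2 (hs.reg 2)
          · simpa [hj] using lt_of_le_of_lt (hg j) (hs.reg 2)
        · simpa [ha] using hs.arr a j
      have hsum := pointerSum_update (n := n) hi hq1
      have hgle : ∀ d, Function.update g i q d ≤ s.reg 2 := fun d => by
        by_cases h : d = i
        · subst h; simpa using hq2
        · simpa [h] using hg d
      have hgp' : ∀ d, ∀ p < Function.update g i q d, ¬ Blocks s d p := fun d => by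
        by_cases h : d = i
        · subst h; simpa using hqp
        · simpa [h] using hgp d
      simp only [Function.update_idem, Function.update_self]
      apply Runs.ite hW hs'' (by decide)
      · intro hlt
        simp [Test.Holds, Expr.val] at hlt
        apply Runs.skip hs''
        refine ⟨by simp, Function.update g i q, f, by simp [Store.setReg], ?_, hgle, hgp', hf, ?_⟩
        · simp only [Test.cost, Expr.cost, flag] at *; omega
        · intro h d hd h1 h2
          rcases Nat.lt_succ_iff_lt_or_eq.1 hd with h' | rfl
          · exact hf0 h d h' h1 h2
          · exact ⟨q, hlt, hqb hlt⟩
      · intro hlt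
        simp [Test.Holds, Expr.val] at hlt
        -- The vertex is stored with offset one, so that `0` in register `7` means that no available
        -- vertex was found. A later available vertex may overwrite an earlier one, which does no
        -- harm.
        apply Runs.assign hW hs'' (by decide)
        · simp [Expr.val]; omega
        · refine ⟨by simp [Store.setReg], Function.update g i q, i + 1, ?_, ?_, hgle, hgp', ?_,
            by simp⟩
          · simp [Store.setReg, Expr.val, Function.update_comm (show (7 : ℕ) ≠ 8 by decide)]
          · simp only [Test.cost, Expr.cost, flag] at *; omega
          · intro d hd
            obtain rfl : i = d := by omega
            exact ⟨hi, hb.1, by simp [hb.2], fun p hp' => hqp p (lt_of_lt_of_le hp' hlt)⟩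
    · intro hb
      simp only [Test.Holds, flag_holds, Expr.val] at hb
      norm_num at hb
      apply Runs.skip hs'
      refine ⟨by simp, g, f, by simp [Store.setReg], ?_, hg, hgp, hf, ?_⟩
      · simp only [Test.cost, Expr.cost, flag] at *; omega
      · intro h d hd h1 h2
        rcases Nat.lt_succ_iff_lt_or_eq.1 hd with h' | rfl
        · exact hf0 h d h' h1 h2
        · exact absurd (hb h1) (by simpa using h2)
  · rintro t s' hs' ⟨g, f, rfl, ht, hg, hgp, hf, hf0⟩
    exact hQ _ g f (by omega) hg hgp hf hf0

theorem runs_place (hW : WordBound B W) (hs : s.Bounded B) {d : ℕ} (hd : s.reg 7 = d + 1)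
    (h6 : s.reg 6 + 1 < B)
    (hQ : ∀ t s', t ≤ 46 * s.reg 2 + 40 → s'.reg 0 = s.reg 0 → s'.reg 2 = s.reg 2 →
      s'.reg 5 = s.reg 5 → s'.reg 6 = s.reg 6 + 1 →
      (∀ a, a ∉ [13, 15, 16] → s'.arr a = s.arr a) →
      s'.arr 15 = Function.update (s.arr 15) d (s.reg 6) →
      s'.arr 16 = Function.update (s.arr 16) d 1 →
      (∀ p, 0 < s'.arr 13 p ↔ 0 < s.arr 13 p ∨ (p < s.reg 2 ∧
        0 < s.arr 8 (s.arr 2 p * s.reg 0 + d) ∧ ¬ 0 < s.arr 8 (s.arr 3 p * s.reg 0 + d))) →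
      Q t s') :
    Runs B W place s Q := by
  have hB := hW.two_le
  have hdB : d < B := by have := hs.reg 7; omega
  have h6B : s.reg 6 < B := hs.reg 6
  apply Runs.seq
  apply Runs.assign hW hs (by decide) (by simp [Expr.val, hd]; omega)
  have hs1 := hs.setReg (x := 10) hdB
  simp only [Expr.val, hd, Nat.add_sub_cancel]
  apply Runs.seq
  apply Runs.store hW hs1 (by decide) (by decide) (by simpa [Expr.val, Store.setReg] using h6B)
  have hs2 := hs1.setArr (a := 15) (j := d) h6B
  simp only [Expr.val, show (s.setReg 10 d).reg 10 = d by simp [Store.setReg],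
    show (s.setReg 10 d).reg 6 = s.reg 6 by simp [Store.setReg]]
  apply Runs.seq
  apply Runs.store hW hs2 (by decide) (by decide) (by simp only [Expr.val]; omega)
  have hs3 := hs2.setArr (a := 16) (j := d) (v := 1) (by omega)
  simp only [Expr.val,
    show ((s.setReg 10 d).setArr 15 d (s.reg 6)).reg 10 = d by simp [Store.setReg, Store.setArr]]
  apply Runs.seq
  apply Runs.assign hW hs3 (by decide) (by simpa [Expr.val, Store.setReg, Store.setArr] using h6)
  have hs4 := hs3.setReg (x := 6) h6
  simp only [Expr.val, show (((s.setReg 10 d).setArr 15 d (s.reg 6)).setArr 16 d 1).reg 6 = s.reg 6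
    by simp [Store.setReg, Store.setArr]]
  apply Runs.flagLoop hW hs4 (s.reg 2) (by simp [Store.setReg, Store.setArr]) (by decide)
    (by decide) (by decide) (by decide) (by decide)
  intro t g ht hg
  apply hQ
  · simp only [Test.cost, Expr.cost, flag, entry] at *; omega
  · simp [Store.setReg, Store.setArr]
  · simp [Store.setReg, Store.setArr]
  · simp [Store.setReg, Store.setArr]
  · simp [Store.setReg, Store.setArr]
  · intro a ha
    simp only [List.mem_cons, List.not_mem_nil, or_false, not_or] at ha
    simp [Store.setReg, Store.setArr, ha]
  · simp [Store.setReg, Store.setArr]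
  · simp [Store.setReg, Store.setArr]
  · intro p
    simp only [Function.update_self]
    rw [hg]
    simp only [Test.Holds, flag_holds, entry_val, Expr.val, Store.setReg, Store.setArr]
    norm_num

theorem GreedyInv.congr {s s' : Store} (h : GreedyInv s₀ s)
    (hr : ∀ x ∈ [0, 2, 6], s'.reg x = s.reg x) (ha : s'.arr = s.arr) : GreedyInv s₀ s' := by
  simp only [List.mem_cons, List.not_mem_nil, or_false, forall_eq_or_imp, forall_eq] at hr
  obtain ⟨h0, h2, h6⟩ := hr
  have hblk : ∀ d p, Blocks s' d p ↔ Blocks s d p :=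
    Blocks.congr h0 h6 fun a _ => by rw [ha]
  constructor
  · rw [h0, h.reg_zero]
  · rw [h2, h.reg_two]
  · rw [ha]; exact h.arr
  · rw [ha]; exact h.pointer_le
  · simp only [ha, hblk]; exact h.pointer
  · rw [ha]; exact h.satisfied
  · rw [ha, h6]; exact h.placed
  · rw [ha]; exact h.inj
  · rw [ha, h6]; exact h.card
  · rw [ha]; exact h.item
  · rw [ha]; exact h.initial

/-- The number of placed vertices and the satisfied pairs only grow, and both occur in the blocking
condition with negative sign. This is why the pointers never have to go back. -/
theorem Blocks.mono {s s' : Store} (h0 : s'.reg 0 = s.reg 0) (h6 : s.reg 6 ≤ s'.reg 6)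
    (ha : ∀ a ∈ [2, 3, 5, 8, 12], s'.arr a = s.arr a) {d p : ℕ}
    (h13 : 0 < s.arr 13 p → 0 < s'.arr 13 p) (h : Blocks s' d p) : Blocks s d p := by
  simp only [List.mem_cons, List.not_mem_nil, or_false, forall_eq_or_imp, forall_eq] at ha
  obtain ⟨h2, h3, h5, h8, h12⟩ := ha
  unfold Blocks at h ⊢
  rw [h0, h2, h3, h5, h8, h12] at h
  rcases h with ⟨h, h'⟩ | ⟨h, h', h''⟩
  · exact Or.inl ⟨fun hc => h (h13 hc), h'⟩
  · exact Or.inr ⟨h, h', by omega⟩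

theorem GreedyInv.reg_six_lt (h : GreedyInv s₀ s) {d : ℕ} (hd : d < s₀.reg 0)
    (hd' : ¬ 0 < s.arr 16 d) : s.reg 6 < s₀.reg 0 := by
  classical
  rw [h.card]
  conv_rhs => rw [← Finset.card_range (s₀.reg 0)]
  refine Finset.card_lt_card (Finset.ssubset_iff_of_subset (Finset.filter_subset _ _) |>.2
    ⟨d, Finset.mem_range.2 hd, ?_⟩)
  simp only [Finset.mem_filter, not_and]
  exact fun _ => hd'

/-- The effect of placing an available vertex. -/
theorem GreedyInv.place {s' : Store} (h : GreedyInv s₀ s) {d : ℕ} (hd : d < s₀.reg 0)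
    (hdC : 0 < s₀.arr 7 d) (hd' : ¬ 0 < s.arr 16 d) (hav : ∀ p < s₀.reg 2, ¬ Blocks s d p)
    (h0 : s'.reg 0 = s.reg 0) (h2 : s'.reg 2 = s.reg 2) (h6 : s'.reg 6 = s.reg 6 + 1)
    (ha : ∀ a, a ∉ [13, 14, 15, 16] → s'.arr a = s.arr a)
    (hptr : ∀ d, s'.arr 14 d ≤ s₀.reg 2) (hptr' : ∀ d, ∀ p < s'.arr 14 d, ¬ Blocks s d p)
    (h15 : s'.arr 15 = Function.update (s.arr 15) d (s.reg 6))
    (h16 : s'.arr 16 = Function.update (s.arr 16) d 1)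
    (h13 : ∀ p, 0 < s'.arr 13 p ↔ 0 < s.arr 13 p ∨ (p < s₀.reg 2 ∧
      0 < s₀.arr 8 (s₀.arr 2 p * s₀.reg 0 + d) ∧ ¬ 0 < s₀.arr 8 (s₀.arr 3 p * s₀.reg 0 + d))) :
    GreedyInv s₀ s' := by
  classical
  have hplaced : ∀ c, 0 < s'.arr 16 c ↔ 0 < s.arr 16 c ∨ c = d := fun c => by
    rw [h16]
    by_cases hc : c = d
    · subst hc; simp
    · simp [hc]
  have hpos : ∀ c, 0 < s.arr 16 c → s'.arr 15 c = s.arr 15 c := fun c hc => by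
    rw [h15, Function.update_of_ne]; rintro rfl; exact hd' hc
  have hposd : s'.arr 15 d = s.reg 6 := by rw [h15, Function.update_self]
  constructor
  · rw [h0, h.reg_zero]
  · rw [h2, h.reg_two]
  · intro a ha'
    rw [ha a ha', h.arr a ha']
  · exact hptr
  · intro c p hp hb
    refine hptr' c p hp (hb.mono h0 (by omega) (fun a ha' => ha a ?_) fun h => (h13 p).2 (Or.inl h))
    simp only [List.mem_cons, List.not_mem_nil, or_false] at ha' ⊢
    omega
  · intro p hp
    rw [h13, h.satisfied p hp]
    simp only [hplaced]
    constructor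
    · rintro ((h | ⟨c, hc, h⟩) | ⟨_, h⟩)
      · exact Or.inl h
      · exact Or.inr ⟨c, Or.inl hc, h⟩
      · exact Or.inr ⟨d, Or.inr rfl, h⟩
    · rintro (h | ⟨c, hc | rfl, h⟩)
      · exact Or.inl (Or.inl h)
      · exact Or.inl (Or.inr ⟨c, hc, h⟩)
      · exact Or.inr ⟨hp, h⟩
  · intro c hc
    rw [hplaced] at hc
    rcases hc with hc | rfl
    · obtain ⟨h1, h2, h3⟩ := h.placed c hc
      rw [hpos c hc]
      exact ⟨h1, h2, by omega⟩
    · exact ⟨hd, hdC, by omega⟩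
  · intro c c' hc hc' hcc
    rw [hplaced] at hc hc'
    rcases hc with hc | rfl <;> rcases hc' with hc' | rfl
    · rw [hpos c hc, hpos c' hc'] at hcc
      exact h.inj c c' hc hc' hcc
    · rw [hpos c hc, hposd] at hcc
      have := (h.placed c hc).2.2
      omega
    · rw [hpos c' hc', hposd] at hcc
      have := (h.placed c' hc').2.2
      omega
    · rfl
  · rw [h6, h.card]
    have : ((Finset.range (s₀.reg 0)).filter fun c => 0 < s'.arr 16 c) =
        insert d ((Finset.range (s₀.reg 0)).filter fun c => 0 < s.arr 16 c) := by
      ext c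
      simp only [Finset.mem_filter, Finset.mem_insert, hplaced, Finset.mem_range]
      constructor
      · rintro ⟨h1, h2 | h2⟩
        · exact Or.inr ⟨h1, h2⟩
        · exact Or.inl h2
      · rintro (rfl | ⟨h1, h2⟩)
        · exact ⟨hd, Or.inr rfl⟩
        · exact ⟨h1, Or.inl h2⟩
    convert (Finset.card_insert_of_notMem (s := (Finset.range (s₀.reg 0)).filter
      fun c => 0 < s.arr 16 c) (a := d) (by simpa using fun _ => by omega)).symm using 1
    convert congrArg Finset.card this
  · intro c p hc hp
    rw [hplaced] at hc
    rcases hc with hc | rfl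
    · rcases h.item c p hc hp with h1 | h1 | h1 | ⟨x, hx, hxc, h1⟩
      · exact Or.inl h1
      · exact Or.inr (Or.inl h1)
      · exact Or.inr (Or.inr (Or.inl h1))
      · refine Or.inr (Or.inr (Or.inr ⟨x, (hplaced x).2 (Or.inl hx), ?_, h1⟩))
        rwa [hpos x hx, hpos c hc]
    -- For the vertex just placed, the absence of blocking pairs supplies the condition; a witness
    -- placed in an earlier round has a smaller position.
    · have := hav p hp
      unfold Blocks at this
      rw [h.arr 8 (by simp), h.arr 3 (by simp), h.arr 2 (by simp), h.reg_zero,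
        h.satisfied p hp] at this
      by_cases h1 : 0 < s₀.arr 13 p
      · exact Or.inl h1
      by_cases h2 : 0 < s₀.arr 8 (s₀.arr 3 p * s₀.reg 0 + c)
      · by_cases h3 : 0 < s₀.arr 8 (s₀.arr 2 p * s₀.reg 0 + c)
        · exact Or.inr (Or.inr (Or.inl h3))
        · by_cases h4 : ∃ c, 0 < s.arr 16 c ∧ 0 < s₀.arr 8 (s₀.arr 2 p * s₀.reg 0 + c) ∧
              ¬ 0 < s₀.arr 8 (s₀.arr 3 p * s₀.reg 0 + c)
          · obtain ⟨x, hx, h4⟩ := h4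
            refine Or.inr (Or.inr (Or.inr ⟨x, (hplaced x).2 (Or.inl hx), ?_, h4⟩))
            rw [hpos x hx, hposd]
            exact (h.placed x hx).2.2
          · exact absurd (Or.inl ⟨fun hc => hc.elim h1 h4, h2, h3⟩) this
      · exact Or.inr (Or.inl h2)
  · intro c p hc hp h1 h2
    rw [hplaced] at hc
    rcases hc with hc | rfl
    · rw [hpos c hc]
      exact h.initial c p hc hp h1 h2
    · have := hav p hp
      unfold Blocks at this
      rw [h.arr 8 (by simp), h.arr 12 (by simp), h.arr 2 (by simp), h.arr 5 (by simp),
        h.reg_zero] at this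
      rw [hposd]
      by_contra hcon
      exact this (Or.inr ⟨h1, h2, by omega⟩)

/-- The sum of the pointers acts as a potential: a round costs O(n + |π|) plus a constant times the
growth of this sum. -/
theorem runs_round (hW : WordBound B W) (hs : s.Bounded B) (h : GreedyInv s₀ s)
    (hQ : ∀ t s', GreedyInv s₀ s' → s'.reg 5 = s.reg 5 →
      t + 90 * pointerSum (s₀.reg 0) (s.arr 14) ≤
        148 * s₀.reg 0 + 46 * s₀.reg 2 + 60 + 90 * pointerSum (s₀.reg 0) (s'.arr 14) →
      (∀ d, 0 < s.arr 16 d → 0 < s'.arr 16 d) →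
      ((∃ d < s₀.reg 0, 0 < s₀.arr 7 d ∧ ¬ 0 < s.arr 16 d ∧ ∀ p < s₀.reg 2, ¬ Blocks s d p) →
        s'.reg 6 = s.reg 6 + 1) → Q t s') :
    Runs B W round s Q := by
  have hB := hW.two_le
  apply Runs.seq
  apply Runs.assign hW hs (by decide) (by simp only [Expr.val]; omega)
  simp only [Expr.val]
  have hs1 := hs.setReg (x := 7) (v := 0) (by omega)
  have hblk : ∀ d p, Blocks (s.setReg 7 0) d p ↔ Blocks s d p :=
    Blocks.congr (by simp [Store.setReg]) (by simp [Store.setReg]) fun _ _ => rfl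
  apply Runs.seq
  apply runs_examineAll hW hs1 (n := s₀.reg 0)
    (by simpa [Store.setReg] using h.reg_zero) (by simp [Store.setReg])
    (by simpa [Store.setReg, h.reg_two] using h.pointer_le)
    (by simp only [hblk]; simpa [Store.setReg] using h.pointer)
  intro t g f ht hg hgp hf hf0
  have er2 : (s.setReg 7 0).reg 2 = s₀.reg 2 := by simpa [Store.setReg] using h.reg_two
  have ea : (s.setReg 7 0).arr = s.arr := rfl
  rw [er2] at hg
  simp only [er2, hblk, ea] at hf hf0 hgp ht
  have e7 : Function.update (Function.update (s.setReg 7 0).reg 7 f) 8 (s₀.reg 0) =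
      Function.update (Function.update s.reg 7 f) 8 (s₀.reg 0) := by
    simp [Store.setReg]
  rw [e7, ea]
  have hfB : f < B := by
    rcases Nat.eq_zero_or_pos f with h0 | h0
    · omega
    · have := (hf (f - 1) (by omega)).1
      have := h.reg_zero ▸ hs.reg 0
      omega
  have hs2 : (Store.mk (Function.update (Function.update s.reg 7 f) 8 (s₀.reg 0))
      (Function.update s.arr 14 g)).Bounded B := by
    refine ⟨fun x => ?_, fun a j => ?_⟩
    · by_cases h8 : x = 8
      · subst h8; simpa [h.reg_zero] using h.reg_zero ▸ hs.reg 0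
      · by_cases h7 : x = 7
        · subst h7; simpa using hfB
        · simpa [h7, h8] using hs.reg x
    · by_cases ha : a = 14
      · subst ha; simpa using lt_of_le_of_lt (hg j) (h.reg_two ▸ hs.reg 2)
      · simpa [ha] using hs.arr a j
  apply Runs.ite hW hs2 (by decide)
  · intro hpos
    simp [Test.Holds, Expr.val] at hpos
    obtain ⟨d, rfl⟩ : ∃ d, f = d + 1 := ⟨f - 1, by omega⟩
    obtain ⟨hd, hdC, hd', hav⟩ := hf d rfl
    have h6lt := h.reg_six_lt hd hd'
    have hnB : s₀.reg 0 < B := h.reg_zero ▸ hs.reg 0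
    apply runs_place hW hs2 (d := d) (by simp) (by simp; omega)
    intro t' s' ht' h0 h2 h5 h6 ha h15 h16 h13
    simp only [Function.update_apply, Nat.reduceEqDiff, OfNat.zero_ne_ofNat, if_false, h.reg_two, h.reg_zero, h.arr 8 (by decide),
      h.arr 2 (by decide), h.arr 3 (by decide)] at ht' h0 h2 h5 h6 h15 h16 h13
    have h14 : s'.arr 14 = g := by rw [ha 14 (by decide)]; simp
    apply hQ
    · refine h.place hd (h.arr 7 (by decide) ▸ hdC) hd' hav (h0.trans h.reg_zero.symm)
        (h2.trans h.reg_two.symm) h6 ?_ (by rwa [h14]) (by rwa [h14]) h15 h16 h13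
      intro a ha'
      simp only [List.mem_cons, List.not_mem_nil, or_false, not_or] at ha'
      rw [ha a (by simp [ha'])]
      simp [ha']
    · rw [h5]
    · rw [h14]; simp only [Test.cost, Expr.cost]; omega
    · intro c hc
      rw [h16]
      by_cases hcd : c = d
      · subst hcd; simp
      · simpa [hcd] using hc
    · exact fun _ => h6
  · intro hpos
    simp [Test.Holds, Expr.val] at hpos
    subst hpos
    apply Runs.skip hs2
    have hblk' : ∀ d p, Blocks ⟨Function.update (Function.update s.reg 7 0) 8 (s₀.reg 0),
        Function.update s.arr 14 g⟩ d p ↔ Blocks s d p :=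
      Blocks.congr (by simp) (by simp) (by simp)
    apply hQ
    · constructor
      · simpa using h.reg_zero
      · simpa using h.reg_two
      · intro a ha
        have : a ≠ 14 := by rintro rfl; simp at ha
        simpa [this] using h.arr a ha
      · simpa using hg
      · simp only [hblk']; simpa using hgp
      · simpa using h.satisfied
      · simpa using h.placed
      · simpa using h.inj
      · simpa using h.card
      · simpa using h.item
      · simpa using h.initial
    · simp
    · simp only [Test.cost, Expr.cost, Function.update_self]; omega
    · simp
    · rintro ⟨d, hd, hdC, hd', hav⟩
      obtain ⟨p, hp, hb⟩ := hf0 rfl d hd (h.arr 7 (by decide) ▸ hdC) hd'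
      exact absurd hb (hav p hp)

theorem pointerSum_le {n m : ℕ} {g : ℕ → ℕ} (h : ∀ d, g d ≤ m) : pointerSum n g ≤ n * m := by
  simpa [pointerSum] using Finset.sum_le_card_nsmul (Finset.range n) g m fun d _ => h d

/-- The enumeration is correct, and it is complete if there is an available vertex in each round. -/
theorem runs_greedy (hW : WordBound B W) (hs : s.Bounded B) (h6 : s.reg 6 = 0)
    (h14 : ∀ d, s.arr 14 d = 0) (h16 : ∀ d, s.arr 16 d = 0) :
    Runs B W greedy s fun t s' => GreedyInv s s' ∧
      t ≤ s.reg 0 * (148 * s.reg 0 + 136 * s.reg 2 + 68) + 6 ∧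
      ((∀ s', GreedyInv s s' → (∃ d < s.reg 0, 0 < s.arr 7 d ∧ ¬ 0 < s'.arr 16 d) →
        ∃ d < s.reg 0, 0 < s.arr 7 d ∧ ¬ 0 < s'.arr 16 d ∧ ∀ p < s.reg 2, ¬ Blocks s' d p) →
        ∀ d < s.reg 0, 0 < s.arr 7 d → 0 < s'.arr 16 d) := by
  classical
  set prog : Prop := ∀ s', GreedyInv s s' → (∃ d < s.reg 0, 0 < s.arr 7 d ∧ ¬ 0 < s'.arr 16 d) →
    ∃ d < s.reg 0, 0 < s.arr 7 d ∧ ¬ 0 < s'.arr 16 d ∧ ∀ p < s.reg 2, ¬ Blocks s' d p with hprog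
  -- Under `prog`, after `i` rounds either `i` vertices have been placed or the clique is exhausted.
  -- With as many rounds as vertices, the first alternative also leaves nothing out.
  apply Runs.forLoop hW hs (s.reg 0) (fun i t s' => s'.reg 5 = i ∧ GreedyInv s s' ∧
    t ≤ i * (148 * s.reg 0 + 46 * s.reg 2 + 60) + 90 * pointerSum (s.reg 0) (s'.arr 14) ∧
    (prog → s'.reg 6 = i ∨ ∀ d < s.reg 0, 0 < s.arr 7 d → 0 < s'.arr 16 d)) (hs.reg 0)
  · rintro i t s' ⟨h5, hI, _⟩
    exact ⟨h5, hI.reg_zero⟩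
  · refine ⟨by simp [Store.setReg], ?_, by simp, fun _ => Or.inl (by simpa [Store.setReg] using h6)⟩
    refine GreedyInv.congr (s := s) ?_ (by simp [Store.setReg]) rfl
    constructor <;> simp [h14, h16, h6]
  · rintro i t s' hi hs' ⟨h5, hI, ht, hp⟩
    apply runs_round hW hs' hI
    intro t' s'' hI' h5' ht' hmono hstep
    refine ⟨h5'.trans h5, by simp [Store.setReg], hI'.congr (by simp [Store.setReg]) rfl, ?_, ?_⟩
    · simp only [Store.setReg]
      rw [add_one_mul]; omega
    · intro hpr
      rcases hp hpr with h | h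
      · by_cases hall : ∀ d < s.reg 0, 0 < s.arr 7 d → 0 < s'.arr 16 d
        · exact Or.inr fun d hd hdC => hmono d (hall d hd hdC)
        · push Not at hall
          left
          have := hstep (hpr s' hI (by
            obtain ⟨d, h1, h2, h3⟩ := hall
            exact ⟨d, h1, h2, by omega⟩))
          simp [Store.setReg, this, h]
      · exact Or.inr fun d hd hdC => hmono d (h d hd hdC)
  · rintro t s' hs' ⟨h5, hI, ht, hp⟩
    refine ⟨hI, ?_, ?_⟩
    · have := pointerSum_le (n := s.reg 0) hI.pointer_le
      have e : s.reg 0 * (148 * s.reg 0 + 136 * s.reg 2 + 68) =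
        s.reg 0 * (148 * s.reg 0 + 46 * s.reg 2 + 60) + 90 * (s.reg 0 * s.reg 2) + 8 * s.reg 0 := by
        ring
      omega
    · intro hpr
      rcases hp hpr with h | h
      · intro d hd _
        by_contra hcon
        have := hI.reg_six_lt hd hcon
        omega
      · exact h

end Greedy

/-! ### The tables computed before the enumeration -/

@[simp] theorem Store.setReg_arr (s : Store) (x v : ℕ) : (s.setReg x v).arr = s.arr := rfl

@[simp] theorem Store.setReg_reg_self (s : Store) (x v : ℕ) : (s.setReg x v).reg x = v := by
  simp [Store.setReg]

@[simp] theorem Store.setReg_reg_of_ne (s : Store) {x y : ℕ} (v : ℕ) (h : y ≠ x) :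
    (s.setReg x v).reg y = s.reg y := by
  simp [Store.setReg, h]

theorem entry_inj {n x c x' c' : ℕ} (hc : c < n) (hc' : c' < n) :
    x * n + c = x' * n + c' ↔ x = x' ∧ c = c' := by
  constructor
  · intro h
    have h1 : x = x' := by
      have e1 := Nat.add_mul_div_right c x (Nat.zero_lt_of_lt hc)
      have e2 := Nat.add_mul_div_right c' x' (Nat.zero_lt_of_lt hc)
      rw [Nat.div_eq_of_lt hc] at e1
      rw [Nat.div_eq_of_lt hc'] at e2
      rw [add_comm, h, add_comm] at e1
      omega
    subst h1
    exact ⟨rfl, by omega⟩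
  · rintro ⟨rfl, rfl⟩; rfl

theorem card_range_filter {n : ℕ} {P : ℕ → Prop} {R : Fin n → Prop} {_ : DecidablePred P}
    {_ : DecidablePred R} (h : ∀ l : Fin n, P l ↔ R l) :
    ((Finset.range n).filter P).card = (Finset.univ.filter R).card := by
  rw [← Finset.card_map Fin.valEmbedding]
  congr 1
  ext l
  simp only [Finset.mem_filter, Finset.mem_range, Finset.mem_map, Finset.mem_univ, true_and,
    Fin.valEmbedding_apply]
  constructor
  · rintro ⟨hl, hP⟩
    exact ⟨⟨l, hl⟩, (h ⟨l, hl⟩).1 hP, rfl⟩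
  · rintro ⟨i, hi, rfl⟩
    exact ⟨i.2, (h i).2 hi⟩

/-- The array `4`: the adjacency matrix. -/
def adjTable : Cmd :=
  flagLoop 3 1 4 (.eq (.lit 0) (.lit 0)) (entry (.get 0 (.reg 3)) (.get 1 (.reg 3)))

/-- The array `5`: the degrees. -/
def degreeTable : Cmd := countLoop 3 0 4 0 5 (flag 4 (entry (.reg 3) (.reg 4)))

/-- The array `6`: the ranks of the vertices in the order by decreasing degree. -/
def rankTable : Cmd :=
  countLoop 3 0 4 0 6 (Test.or (.lt (.get 5 (.reg 3)) (.get 5 (.reg 4)))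
    (.and (.eq (.get 5 (.reg 4)) (.get 5 (.reg 3))) (.lt (.reg 4) (.reg 3))))

/-- The array `7`: the vertices of the clique. -/
def cliqueTable : Cmd :=
  flagLoop 3 0 7 (.not (.lt (.get 5 (.reg 3)) (.get 6 (.reg 3)))) (.reg 3)

/-- The array `8`: the matrix of the graph between the independent set and the clique, and of the
identity on the clique. -/
def itemTable : Cmd :=
  flagLoop₂ 3 0 4 0 8 (.and (flag 7 (.reg 4))
    (Test.or (.and (flag 7 (.reg 3)) (.eq (.reg 3) (.reg 4)))
      (.and (.not (flag 7 (.reg 3))) (flag 4 (entry (.reg 3) (.reg 4))))))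
    (entry (.reg 3) (.reg 4))

/-- The arrays `9` and `10`: the pairs of vertices such that not every neighbor of one of them is a
neighbor of the other one. -/
def differenceTable (a i j : ℕ) : Cmd :=
  flagLoop₂ 3 2 4 0 a (.and (flag 4 (entry (.get i (.reg 3)) (.reg 4)))
    (.not (flag 4 (entry (.get j (.reg 3)) (.reg 4))))) (.reg 3)

/-- The array `11`: the vertices described by `Forced₀`. -/
def forcedTable₀ : Cmd :=
  flagLoop 3 2 11 (.and (.not (flag 7 (.get 2 (.reg 3))))
    (Test.or (flag 7 (.get 3 (.reg 3))) (.and (.not (flag 10 (.reg 3))) (flag 9 (.reg 3)))))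
    (.get 2 (.reg 3))

/-- The array `12`: the forced vertices. -/
def forcedTable : Cmd :=
  flagLoop 3 2 12 (.and (.not (flag 7 (.get 2 (.reg 3)))) (flag 11 (.get 3 (.reg 3))))
    (.get 2 (.reg 3))

/-- The array `13`: the pairs which impose no condition on the lexicographic order. -/
def satisfiedTable : Cmd :=
  flagLoop 3 2 13 (Test.or (flag 12 (.get 2 (.reg 3)))
    (Test.or (.and (flag 7 (.get 2 (.reg 3))) (.not (flag 7 (.get 3 (.reg 3)))))
      (.and (.not (flag 7 (.get 2 (.reg 3)))) (flag 7 (.get 3 (.reg 3))))))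
    (.reg 3)

/-- The computation of the tables. -/
def tables : Cmd :=
  .seq adjTable (.seq degreeTable (.seq rankTable (.seq cliqueTable (.seq itemTable
    (.seq (differenceTable 9 3 2) (.seq (differenceTable 10 2 3) (.seq forcedTable₀
      (.seq forcedTable satisfiedTable))))))))

section Tables

variable {n : ℕ} (G : SimpleGraph (Fin n)) (π : Fin n → Fin n → Prop) (L M : ℕ)

/-- The content of the array `k` and, for `k = 0` and `k = 2`, the meaning of the input. -/
def Fact (arr : ℕ → ℕ → ℕ) : ℕ → Prop
  | 0 => (∀ e < L, arr 0 e < n ∧ arr 1 e < n) ∧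
      ∀ u v : Fin n, G.Adj u v ↔ ∃ e < L, arr 0 e = u ∧ arr 1 e = v
  | 2 => (∀ p < M, arr 2 p < n ∧ arr 3 p < n) ∧
      ∀ u v : Fin n, π u v ↔ ∃ p < M, arr 2 p = u ∧ arr 3 p = v
  | 4 => ∀ u v : Fin n, 0 < arr 4 (u * n + v) ↔ G.Adj u v
  | 5 => ∀ u : Fin n, arr 5 u = nbrCount G u
  | 6 => ∀ u : Fin n, arr 6 u = degreeRank G u
  | 7 => ∀ u : Fin n, 0 < arr 7 u ↔ InClique G u
  | 8 => ∀ x c : Fin n, 0 < arr 8 (x * n + c) ↔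
      InClique G c ∧ ((InClique G x ∧ x = c) ∨ (¬ InClique G x ∧ G.Adj x c))
  | 9 => ∀ p < M, ∀ v w : Fin n, arr 2 p = v → arr 3 p = w →
      (0 < arr 9 p ↔ ∃ c, G.Adj w c ∧ ¬ G.Adj v c)
  | 10 => ∀ p < M, ∀ v w : Fin n, arr 2 p = v → arr 3 p = w →
      (0 < arr 10 p ↔ ∃ c, G.Adj v c ∧ ¬ G.Adj w c)
  | 11 => ∀ v : Fin n, 0 < arr 11 v ↔ Forced₀ G π (InClique G) v
  | 12 => ∀ v : Fin n, 0 < arr 12 v ↔ Forced G π (InClique G) v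
  | 13 => ∀ p < M, ∀ v w : Fin n, arr 2 p = v → arr 3 p = w →
      (0 < arr 13 p ↔ Forced G π (InClique G) v ∨ ¬ (InClique G v ↔ InClique G w))
  | _ => True

/-- The arrays below `k` have been computed, the other ones are empty. -/
structure Upto (k : ℕ) (s : Store) : Prop where
  reg_zero : s.reg 0 = n
  reg_one : s.reg 1 = L
  reg_two : s.reg 2 = M
  reg_six : s.reg 6 = 0
  fact : ∀ j < k, Fact G π L M s.arr j
  empty : ∀ j, k ≤ j → ∀ i, s.arr j i = 0

/-- The relations between the sizes of the parts of the input; `K` is a bound for all of them. -/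
structure Sizes (n L M K : ℕ) : Prop where
  one_le : 1 ≤ K
  n_le : n ≤ K
  nn_le : n * n ≤ K
  L_le : L ≤ K
  M_le : M ≤ K
  nM_le : n * M ≤ K

variable {G π L M}

theorem Fact.congr {arr arr' : ℕ → ℕ → ℕ} {j : ℕ} (h1 : arr' 1 = arr 1)
    (h2 : arr' 2 = arr 2) (h3 : arr' 3 = arr 3) (hj : arr' j = arr j) (h : Fact G π L M arr j) :
    Fact G π L M arr' j := by
  unfold Fact at h ⊢
  split <;> simp_all <;> exact h

/-- A table is written into one fresh array, while the meaning of an earlier array refers only to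
itself and to the input arrays. -/
theorem Upto.step {k : ℕ} {s s' : Store} (h : Upto G π L M k s) (hk : 4 ≤ k) {g : ℕ → ℕ}
    (hr : ∀ x ∈ [0, 1, 2, 6], s'.reg x = s.reg x) (ha : s'.arr = Function.update s.arr k g)
    (hf : Fact G π L M (Function.update s.arr k g) k) : Upto G π L M (k + 1) s' := by
  simp only [List.mem_cons, List.not_mem_nil, or_false, forall_eq_or_imp, forall_eq] at hr
  obtain ⟨r0, r1, r2, r6⟩ := hr
  constructor
  · rw [r0, h.reg_zero]
  · rw [r1, h.reg_one]
  · rw [r2, h.reg_two]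
  · rw [r6, h.reg_six]
  · intro j hj
    rw [ha]
    rcases Nat.lt_succ_iff_lt_or_eq.1 hj with hj | rfl
    · apply (h.fact j hj).congr <;> rw [Function.update_of_ne (by omega)]
    · exact hf
  · intro j hj i
    rw [ha, Function.update_of_ne (by omega)]
    exact h.empty j (by omega) i

theorem time_le₁ {m c K : ℕ} (hm : m ≤ K) (hK : 1 ≤ K) (hc : c ≤ 180) : m * c + 6 ≤ 200 * K := by
  have := Nat.mul_le_mul hm hc
  omega

theorem time_le₂ {m l c K : ℕ} (hm : m ≤ K) (hK : 1 ≤ K) (hml : m * l ≤ K) (hc : c ≤ 180) :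
    m * (l * c + 14) + 6 ≤ 200 * K := by
  have := Nat.mul_le_mul hml hc
  have e : m * (l * c + 14) = m * l * c + 14 * m := by ring
  omega

variable {B W K : ℕ} {s : Store}

theorem runs_adjTable (hW : WordBound B W) (hs : s.Bounded B) (hK : Sizes n L M K)
    (h : Upto G π L M 4 s) :
    Runs B W adjTable s fun t s' => t ≤ 200 * K ∧ Upto G π L M 5 s' := by
  apply Runs.flagLoop hW hs L h.reg_one (by decide) (by decide) (by decide) (by decide) (by decide)
  intro t g ht hg
  refine ⟨ht.trans (time_le₁ hK.L_le hK.one_le (by decide)),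
    h.step le_rfl (by simp) rfl fun u v => ?_⟩
  obtain ⟨hb, ha⟩ : Fact G π L M s.arr 0 := h.fact 0 (by decide)
  rw [Function.update_self, hg, ha]
  simp only [h.empty 4 le_rfl, lt_irrefl, false_or, Test.Holds, true_and, entry_val, Expr.val,
    Store.setReg_arr, Store.setReg_reg_self, ne_eq, OfNat.zero_ne_ofNat, not_false_eq_true,
    Store.setReg_reg_of_ne, h.reg_zero]
  exact exists_congr fun e => and_congr_right fun he => entry_inj (hb e he).2 v.2

theorem runs_degreeTable (hW : WordBound B W) (hs : s.Bounded B) (hK : Sizes n L M K)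
    (h : Upto G π L M 5 s) :
    Runs B W degreeTable s fun t s' => t ≤ 200 * K ∧ Upto G π L M 6 s' := by
  apply Runs.countLoop hW hs n n h.reg_zero h.reg_zero (by decide) (by decide) (by decide)
    (by decide) (by decide) (by decide) (by decide) (h.empty 5 le_rfl)
  intro t g v ht hg
  refine ⟨ht.trans (time_le₂ hK.n_le hK.one_le hK.nn_le (by decide)),
    h.step (by decide) (by simp) rfl fun u => ?_⟩
  have ha : Fact G π L M s.arr 4 := h.fact 4 (by decide)
  rw [Function.update_self, hg u u.2]
  refine card_range_filter fun l => ?_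
  simpa [flag_holds, entry_val, Expr.val, h.reg_zero] using ha u l

theorem runs_rankTable (hW : WordBound B W) (hs : s.Bounded B) (hK : Sizes n L M K)
    (h : Upto G π L M 6 s) :
    Runs B W rankTable s fun t s' => t ≤ 200 * K ∧ Upto G π L M 7 s' := by
  apply Runs.countLoop hW hs n n h.reg_zero h.reg_zero (by decide) (by decide) (by decide)
    (by decide) (by decide) (by decide) (by decide) (h.empty 6 le_rfl)
  intro t g v ht hg
  refine ⟨ht.trans (time_le₂ hK.n_le hK.one_le hK.nn_le (by decide)),
    h.step (by decide) (by simp) rfl fun u => ?_⟩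
  have hd : Fact G π L M s.arr 5 := h.fact 5 (by decide)
  rw [Function.update_self, hg u u.2]
  refine card_range_filter fun l => ?_
  simp [Test.holds_or, Test.Holds, Expr.val, hd u, hd l, DegreeBefore]

theorem runs_cliqueTable (hW : WordBound B W) (hs : s.Bounded B) (hK : Sizes n L M K)
    (h : Upto G π L M 7 s) :
    Runs B W cliqueTable s fun t s' => t ≤ 200 * K ∧ Upto G π L M 8 s' := by
  apply Runs.flagLoop hW hs n h.reg_zero (by decide) (by decide) (by decide) (by decide) (by decide)
  intro t g ht hg
  refine ⟨ht.trans (time_le₁ hK.n_le hK.one_le (by decide)),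
    h.step (by decide) (by simp) rfl fun u => ?_⟩
  have hd : Fact G π L M s.arr 5 := h.fact 5 (by decide)
  have hr : Fact G π L M s.arr 6 := h.fact 6 (by decide)
  rw [Function.update_self, hg]
  simp only [h.empty 7 le_rfl, lt_irrefl, false_or, Test.Holds, Expr.val, Store.setReg_arr,
    Store.setReg_reg_self, InClique, ← hd u, ← hr u, not_lt]
  constructor
  · rintro ⟨k, hk, h, rfl⟩; exact h
  · exact fun h => ⟨u, u.2, h, rfl⟩

theorem runs_itemTable (hW : WordBound B W) (hs : s.Bounded B) (hK : Sizes n L M K)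
    (h : Upto G π L M 8 s) :
    Runs B W itemTable s fun t s' => t ≤ 200 * K ∧ Upto G π L M 9 s' := by
  apply Runs.flagLoop₂ hW hs n n h.reg_zero h.reg_zero (by decide) (by decide) (by decide)
    (by decide) (by decide) (by decide) (by decide) (by decide) (by decide)
  intro t g v ht hg
  refine ⟨ht.trans (time_le₂ hK.n_le hK.one_le hK.nn_le (by decide)),
    h.step (by decide) (by simp) rfl fun x c => ?_⟩
  have ha : Fact G π L M s.arr 4 := h.fact 4 (by decide)
  have hc : Fact G π L M s.arr 7 := h.fact 7 (by decide)
  rw [Function.update_self, hg, ← hc x, ← hc c, ← ha x c]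
  simp [h.empty 8 le_rfl, Test.holds_or, Test.Holds, flag_holds, entry_val, Expr.val, h.reg_zero,
    Fin.ext_iff]
  constructor
  · rintro ⟨k, hk, l, hl, h, e⟩
    obtain ⟨rfl, rfl⟩ := (entry_inj hl c.2).1 e
    exact h
  · exact fun h => ⟨x, x.2, c, c.2, h, rfl⟩

/-- The two difference tables differ only in the roles of the two components, so the intended
meaning enters through `hf`. Testing a common vertex for every pair takes O(n · |π|) steps, whereas
comparing all pairs of vertices would be too slow. -/
theorem runs_differenceTable (hW : WordBound B W) (hs : s.Bounded B) (hK : Sizes n L M K)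
    {a i j : ℕ} (h : Upto G π L M a s) (ha : 9 ≤ a) (hi : i < 4) (hj : j < 4)
    (hf : ∀ g : ℕ → ℕ, (∀ p < M, ∀ v w : Fin n, s.arr i p = v → s.arr j p = w →
      (0 < g p ↔ ∃ c, G.Adj v c ∧ ¬ G.Adj w c)) → Fact G π L M (Function.update s.arr a g) a) :
    Runs B W (differenceTable a i j) s fun t s' => t ≤ 200 * K ∧ Upto G π L M (a + 1) s' := by
  apply Runs.flagLoop₂ hW hs M n h.reg_two h.reg_zero (by decide) (by decide) (by decide)
    (by decide) (by decide) (by simp [Test.height, flag, entry, Expr.height])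
    (by decide) (by simp [Test.arrays, flag, entry, Expr.arrays]; omega)
    (by simp [Expr.arrays])
  intro t g v ht hg
  refine ⟨ht.trans (time_le₂ hK.M_le hK.one_le (by rw [mul_comm]; exact hK.nM_le)
    (by simp [Test.cost, Expr.cost, flag, entry])),
    h.step (by omega) (by simp) rfl (hf g fun p hp v w hv hw => ?_)⟩
  have hadj : Fact G π L M s.arr 4 := h.fact 4 (by omega)
  simp only [← hadj v, ← hadj w]
  rw [hg]
  simp only [h.empty a le_rfl, lt_irrefl, false_or, Test.Holds, flag_holds, entry_val, Expr.val,
    Store.setReg_arr, Store.setReg_reg_self, ne_eq, OfNat.zero_ne_ofNat, Nat.reduceEqDiff,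
    not_false_eq_true, Store.setReg_reg_of_ne, h.reg_zero]
  constructor
  · rintro ⟨l, hl, c, hc, h, rfl⟩
    rw [hv, hw] at h
    exact ⟨⟨c, hc⟩, h⟩
  · rintro ⟨c, hc⟩
    refine ⟨p, hp, c, c.2, ?_, rfl⟩
    rwa [hv, hw]

theorem runs_forcedTable₀ (hW : WordBound B W) (hs : s.Bounded B) (hK : Sizes n L M K)
    (h : Upto G π L M 11 s) :
    Runs B W forcedTable₀ s fun t s' => t ≤ 200 * K ∧ Upto G π L M 12 s' := by
  apply Runs.flagLoop hW hs M h.reg_two (by decide) (by decide) (by decide) (by decide) (by decide)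
  intro t g ht hg
  refine ⟨ht.trans (time_le₁ hK.M_le hK.one_le (by decide)),
    h.step (by decide) (by simp) rfl fun v => ?_⟩
  obtain ⟨hb, hp⟩ : Fact G π L M s.arr 2 := h.fact 2 (by decide)
  have hc : Fact G π L M s.arr 7 := h.fact 7 (by decide)
  have h9 : Fact G π L M s.arr 9 := h.fact 9 (by decide)
  have h10 : Fact G π L M s.arr 10 := h.fact 10 (by decide)
  rw [Function.update_self, hg]
  simp only [h.empty 11 le_rfl, lt_irrefl, false_or, Test.holds_or, Test.Holds, flag_holds, Expr.val,
    Store.setReg_arr, Store.setReg_reg_self, Forced₀]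
  constructor
  · rintro ⟨k, hk, ⟨h1, h2⟩, e⟩
    rw [e, hc] at h1
    obtain ⟨w, hw⟩ : ∃ w : Fin n, s.arr 3 k = w := ⟨⟨_, (hb k hk).2⟩, rfl⟩
    rw [hw, hc, h9 k hk v w e hw, h10 k hk v w e hw] at h2
    refine ⟨h1, w, (hp v w).2 ⟨k, hk, e, hw⟩, h2.imp_right fun h => ⟨?_, h.2⟩⟩
    intro c hvc
    by_contra hwc
    exact h.1 ⟨c, hvc, hwc⟩
  · rintro ⟨h1, w, hvw, h2⟩
    obtain ⟨k, hk, e, hw⟩ := (hp v w).1 hvw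
    refine ⟨k, hk, ⟨by rwa [e, hc], ?_⟩, e⟩
    rw [hw, hc, h9 k hk v w e hw, h10 k hk v w e hw]
    refine h2.imp_right fun h => ⟨?_, h.2⟩
    rintro ⟨c, hvc, hwc⟩
    exact hwc (h.1 c hvc)

theorem runs_forcedTable (hW : WordBound B W) (hs : s.Bounded B) (hK : Sizes n L M K)
    (h : Upto G π L M 12 s) :
    Runs B W forcedTable s fun t s' => t ≤ 200 * K ∧ Upto G π L M 13 s' := by
  apply Runs.flagLoop hW hs M h.reg_two (by decide) (by decide) (by decide) (by decide) (by decide)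
  intro t g ht hg
  refine ⟨ht.trans (time_le₁ hK.M_le hK.one_le (by decide)),
    h.step (by decide) (by simp) rfl fun v => ?_⟩
  obtain ⟨hb, hp⟩ : Fact G π L M s.arr 2 := h.fact 2 (by decide)
  have hc : Fact G π L M s.arr 7 := h.fact 7 (by decide)
  have h11 : Fact G π L M s.arr 11 := h.fact 11 (by decide)
  rw [Function.update_self, hg]
  simp only [h.empty 12 le_rfl, lt_irrefl, false_or, Test.Holds, flag_holds, Expr.val,
    Store.setReg_arr, Store.setReg_reg_self, Forced]
  constructor
  · rintro ⟨k, hk, ⟨h1, h2⟩, e⟩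
    rw [e, hc] at h1
    obtain ⟨w, hw⟩ : ∃ w : Fin n, s.arr 3 k = w := ⟨⟨_, (hb k hk).2⟩, rfl⟩
    rw [hw, h11] at h2
    exact ⟨h1, w, (hp v w).2 ⟨k, hk, e, hw⟩, h2⟩
  · rintro ⟨h1, w, hvw, h2⟩
    obtain ⟨k, hk, e, hw⟩ := (hp v w).1 hvw
    exact ⟨k, hk, ⟨by rwa [e, hc], by rwa [hw, h11]⟩, e⟩

theorem runs_satisfiedTable (hW : WordBound B W) (hs : s.Bounded B) (hK : Sizes n L M K)
    (h : Upto G π L M 13 s) :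
    Runs B W satisfiedTable s fun t s' => t ≤ 200 * K ∧ Upto G π L M 14 s' := by
  apply Runs.flagLoop hW hs M h.reg_two (by decide) (by decide) (by decide) (by decide) (by decide)
  intro t g ht hg
  refine ⟨ht.trans (time_le₁ hK.M_le hK.one_le (by decide)),
    h.step (by decide) (by simp) rfl fun p hp v w hv hw => ?_⟩
  have hc : Fact G π L M s.arr 7 := h.fact 7 (by decide)
  have h12 : Fact G π L M s.arr 12 := h.fact 12 (by decide)
  rw [Function.update_of_ne (by decide)] at hv hw
  rw [Function.update_self, hg]
  simp only [h.empty 13 le_rfl, lt_irrefl, false_or, Test.holds_or, Test.Holds, flag_holds, Expr.val,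
    Store.setReg_arr, Store.setReg_reg_self]
  rw [← h12 v, ← hc v, ← hc w, ← hv, ← hw]
  constructor
  · rintro ⟨k, hk, h, rfl⟩; tauto
  · exact fun h => ⟨p, hp, by tauto, rfl⟩

theorem runs_tables (hW : WordBound B W) (hs : s.Bounded B) (hK : Sizes n L M K)
    (h : Upto G π L M 4 s) :
    Runs B W tables s fun t s' => t ≤ 2000 * K ∧ Upto G π L M 14 s' := by
  refine Runs.seq ((runs_adjTable hW hs hK h).mono fun t₁ s hs ⟨h₁, h⟩ => ?_)
  refine Runs.seq ((runs_degreeTable hW hs hK h).mono fun t₂ s hs ⟨h₂, h⟩ => ?_)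
  refine Runs.seq ((runs_rankTable hW hs hK h).mono fun t₃ s hs ⟨h₃, h⟩ => ?_)
  refine Runs.seq ((runs_cliqueTable hW hs hK h).mono fun t₄ s hs ⟨h₄, h⟩ => ?_)
  refine Runs.seq ((runs_itemTable hW hs hK h).mono fun t₅ s hs ⟨h₅, h⟩ => ?_)
  refine Runs.seq ((runs_differenceTable hW hs hK h (by decide) (by decide) (by decide)
    fun g hg p hp v w hv hw => ?_).mono fun t₆ s hs ⟨h₆, h⟩ => ?_)
  · rw [Function.update_of_ne (by decide)] at hv hw
    rw [Function.update_self, hg p hp w v hw hv]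
  refine Runs.seq ((runs_differenceTable hW hs hK h (by decide) (by decide) (by decide)
    fun g hg p hp v w hv hw => ?_).mono fun t₇ s hs ⟨h₇, h⟩ => ?_)
  · rw [Function.update_of_ne (by decide)] at hv hw
    rw [Function.update_self, hg p hp v w hv hw]
  refine Runs.seq ((runs_forcedTable₀ hW hs hK h).mono fun t₈ s hs ⟨h₈, h⟩ => ?_)
  refine Runs.seq ((runs_forcedTable hW hs hK h).mono fun t₉ s hs ⟨h₉, h⟩ => ?_)
  exact (runs_satisfiedTable hW hs hK h).mono fun t s hs ⟨h₁₀, h⟩ => ⟨by omega, h⟩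

end Tables

/-! ### Inserting the forced vertices -/

/-- The array `17`: the pairs of vertices that violate `MayPrecede`. -/
def violationTable : Cmd :=
  flagLoop₂ 3 2 4 0 17 (Test.or (.lt (.get 5 (.get 2 (.reg 3))) (.get 5 (.reg 4)))
    (.and (flag 7 (.get 3 (.reg 3))) (.lt (.get 15 (.get 3 (.reg 3))) (.get 5 (.reg 4)))))
    (entry (.reg 4) (.get 2 (.reg 3)))

/-- Report a failure if two forced vertices cannot be compared. -/
def checkTotal : Cmd :=
  flagLoop₂ 3 0 4 0 18 (.and (flag 12 (.reg 3)) (.and (flag 12 (.reg 4))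
    (.and (.not (.eq (.reg 3) (.reg 4)))
      (.and (flag 17 (entry (.reg 3) (.reg 4))) (flag 17 (entry (.reg 4) (.reg 3))))))) (.lit 0)

/-- Report a failure if a vertex of the clique that has to precede a forced vertex is not adjacent to
it. -/
def checkClique : Cmd :=
  flagLoop 3 2 18 (.and (flag 7 (.get 2 (.reg 3))) (.and (flag 12 (.get 3 (.reg 3)))
    (.not (flag 4 (entry (.get 3 (.reg 3)) (.get 2 (.reg 3))))))) (.lit 0)

/-- Report a failure if a forced vertex cannot precede another forced vertex that it has to
precede. -/
def checkForced : Cmd :=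
  flagLoop 3 2 18 (.and (flag 12 (.get 2 (.reg 3))) (.and (flag 12 (.get 3 (.reg 3)))
    (.and (.not (.eq (.get 2 (.reg 3)) (.get 3 (.reg 3))))
      (flag 17 (entry (.get 2 (.reg 3)) (.get 3 (.reg 3))))))) (.lit 0)

/-- Report a failure if some vertex of the clique has not been placed. -/
def checkPlaced : Cmd :=
  flagLoop 3 0 18 (.and (flag 7 (.reg 3)) (.not (flag 16 (.reg 3)))) (.lit 0)

/-- All checks after the enumeration of the clique. -/
def checks : Cmd :=
  .seq violationTable (.seq checkTotal (.seq checkClique (.seq checkForced checkPlaced)))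

section Checks

variable {n : ℕ} (G : SimpleGraph (Fin n)) (π : Fin n → Fin n → Prop) (L M : ℕ)
  (τ : Fin n → ℕ) (S : Fin n → Prop)

/-- The content of the memory after the enumeration of the clique. -/
structure Enumerated (s : Store) : Prop where
  reg_zero : s.reg 0 = n
  reg_two : s.reg 2 = M
  pairs : Fact G π L M s.arr 2
  adj : Fact G π L M s.arr 4
  degree : Fact G π L M s.arr 5
  clique : Fact G π L M s.arr 7
  forced : Fact G π L M s.arr 12
  pos : ∀ d : Fin n, s.arr 15 d = τ d
  placed : ∀ d : Fin n, 0 < s.arr 16 d ↔ S d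

/-- The content of the memory after the computation of the array `17`. -/
structure Checkable (s : Store) : Prop extends Enumerated G π L M τ S s where
  violation : ∀ v x : Fin n, 0 < s.arr 17 (v * n + x) ↔ ¬ MayPrecede G π (InClique G) τ v x

variable {G π L M τ S} {B W K : ℕ} {s : Store}

theorem Enumerated.congr {s' : Store} (h : Enumerated G π L M τ S s) (h0 : s'.reg 0 = s.reg 0)
    (h2 : s'.reg 2 = s.reg 2) (ha : ∀ a < 17, s'.arr a = s.arr a) : Enumerated G π L M τ S s' := by
  have hf : ∀ j < 17, Fact G π L M s.arr j → Fact G π L M s'.arr j := fun j hj hf =>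
    hf.congr (ha 1 (by decide)) (ha 2 (by decide)) (ha 3 (by decide)) (ha j hj)
  exact ⟨h0.trans h.reg_zero, h2.trans h.reg_two, hf 2 (by decide) h.pairs, hf 4 (by decide) h.adj,
    hf 5 (by decide) h.degree, hf 7 (by decide) h.clique, hf 12 (by decide) h.forced,
    by rw [ha 15 (by decide)]; exact h.pos, by rw [ha 16 (by decide)]; exact h.placed⟩

theorem Checkable.congr {s' : Store} (h : Checkable G π L M τ S s) (h0 : s'.reg 0 = s.reg 0)
    (h2 : s'.reg 2 = s.reg 2) (ha : ∀ a < 18, s'.arr a = s.arr a) : Checkable G π L M τ S s' :=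
  ⟨h.toEnumerated.congr h0 h2 fun a h => ha a (by omega), by
    rw [ha 17 (by decide)]; exact h.violation⟩

/-- A violation for `v` and `x` is witnessed by one pair of π that starts in `x`, so scanning all
pairs against all `v` costs O(n · |π|). -/
theorem runs_violationTable (hW : WordBound B W) (hs : s.Bounded B) (hK : Sizes n L M K)
    (hπ : ∀ x, π x x) (h : Enumerated G π L M τ S s) (h17 : ∀ i, s.arr 17 i = 0) :
    Runs B W violationTable s fun t s' => t ≤ 200 * K ∧ Checkable G π L M τ S s' ∧
      s'.arr 18 = s.arr 18 := by
  apply Runs.flagLoop₂ hW hs M n h.reg_two h.reg_zero (by decide) (by decide) (by decide)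
    (by decide) (by decide) (by decide) (by decide) (by decide) (by decide)
  intro t g z ht hg
  refine ⟨ht.trans (time_le₂ hK.M_le hK.one_le (by rw [mul_comm]; exact hK.nM_le) (by decide)),
    ⟨h.congr (by simp) (by simp) fun a ha => by simp [show a ≠ 17 by omega], fun v x => ?_⟩,
    by simp⟩
  obtain ⟨hb, hp⟩ : Fact G π L M s.arr 2 := h.pairs
  have hd : Fact G π L M s.arr 5 := h.degree
  have hc : Fact G π L M s.arr 7 := h.clique
  simp only [Function.update_self]
  rw [hg]
  simp only [h17, lt_irrefl, false_or, Test.holds_or, Test.Holds, flag_holds, entry_val, Expr.val,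
    Store.setReg_arr, Store.setReg_reg_self, ne_eq, OfNat.zero_ne_ofNat, Nat.reduceEqDiff,
    not_false_eq_true, Store.setReg_reg_of_ne, h.reg_zero, MayPrecede]
  constructor
  · rintro ⟨k, hk, l, hl, h1, h2⟩
    obtain ⟨rfl, e⟩ := (entry_inj (hb k hk).1 x.2).1 h2
    obtain ⟨w, hw⟩ : ∃ w : Fin n, s.arr 3 k = w := ⟨⟨_, (hb k hk).2⟩, rfl⟩
    rw [e, hw, hd x, hd v, hc w, h.pos w] at h1
    rintro ⟨h3, h4⟩
    rcases h1 with h1 | ⟨h1, h5⟩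
    · omega
    · have := h4 w h1 ((hp x w).2 ⟨k, hk, e, hw⟩)
      omega
  · intro h1
    rw [not_and_or] at h1
    push Not at h1
    rcases h1 with h1 | ⟨w, hw, hxw, h1⟩
    -- The degree comparison involves no pair by itself; the reflexive pair of `x` makes sure that
    -- it is examined.
    · obtain ⟨k, hk, e, e'⟩ := (hp x x).1 (hπ x)
      refine ⟨k, hk, v, v.2, Or.inl ?_, by rw [e]⟩
      rwa [e, hd x, hd v]
    · obtain ⟨k, hk, e, e'⟩ := (hp x w).1 hxw
      refine ⟨k, hk, v, v.2, Or.inr ⟨by rwa [e', hc w], ?_⟩, by rw [e]⟩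
      rwa [e', hd v, h.pos w]

theorem runs_checkTotal (hW : WordBound B W) (hs : s.Bounded B) (hK : Sizes n L M K)
    (h : Checkable G π L M τ S s) :
    Runs B W checkTotal s fun t s' => t ≤ 200 * K ∧ Checkable G π L M τ S s' ∧
      (0 < s'.arr 18 0 ↔ 0 < s.arr 18 0 ∨ ∃ v v', Forced G π (InClique G) v ∧
        Forced G π (InClique G) v' ∧ v ≠ v' ∧ ¬ MayPrecede G π (InClique G) τ v v' ∧
        ¬ MayPrecede G π (InClique G) τ v' v) := by
  apply Runs.flagLoop₂ hW hs n n h.reg_zero h.reg_zero (by decide) (by decide) (by decide)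
    (by decide) (by decide) (by decide) (by decide) (by decide) (by decide)
  intro t g z ht hg
  refine ⟨ht.trans (time_le₂ hK.n_le hK.one_le hK.nn_le (by decide)),
    h.congr (by simp) (by simp) fun a ha => by simp [show a ≠ 18 by omega], ?_⟩
  have hf : Fact G π L M s.arr 12 := h.forced
  simp only [Function.update_self]
  rw [hg]
  refine or_congr Iff.rfl ?_
  simp only [Test.Holds, flag_holds, entry_val, Expr.val,
    Store.setReg_arr, Store.setReg_reg_self, ne_eq, OfNat.zero_ne_ofNat, Nat.reduceEqDiff,
    not_false_eq_true, Store.setReg_reg_of_ne, h.reg_zero, and_true, ← h.violation, ← hf _]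
  constructor
  · rintro ⟨k, hk, l, hl, h1, h2, h3, h4⟩
    exact ⟨⟨k, hk⟩, ⟨l, hl⟩, h1, h2, fun h => h3 (congrArg Fin.val h), h4⟩
  · rintro ⟨v, v', h1, h2, h3, h4⟩
    exact ⟨v, v.2, v', v'.2, h1, h2, fun h => h3 (Fin.ext h), h4⟩

theorem runs_checkClique (hW : WordBound B W) (hs : s.Bounded B) (hK : Sizes n L M K)
    (h : Checkable G π L M τ S s) :
    Runs B W checkClique s fun t s' => t ≤ 200 * K ∧ Checkable G π L M τ S s' ∧
      (0 < s'.arr 18 0 ↔ 0 < s.arr 18 0 ∨ ∃ c v, π c v ∧ InClique G c ∧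
        Forced G π (InClique G) v ∧ ¬ G.Adj v c) := by
  apply Runs.flagLoop hW hs M h.reg_two (by decide) (by decide) (by decide) (by decide) (by decide)
  intro t g ht hg
  refine ⟨ht.trans (time_le₁ hK.M_le hK.one_le (by decide)),
    h.congr (by simp) (by simp) fun a ha => by simp [show a ≠ 18 by omega], ?_⟩
  obtain ⟨hb, hp⟩ : Fact G π L M s.arr 2 := h.pairs
  have ha : Fact G π L M s.arr 4 := h.adj
  have hc : Fact G π L M s.arr 7 := h.clique
  have hf : Fact G π L M s.arr 12 := h.forced
  simp only [Function.update_self]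
  rw [hg]
  refine or_congr Iff.rfl ?_
  simp only [Test.Holds, flag_holds, entry_val, Expr.val,
    Store.setReg_arr, Store.setReg_reg_self, ne_eq, OfNat.zero_ne_ofNat,
    not_false_eq_true, Store.setReg_reg_of_ne, h.reg_zero, and_true, ← ha _, ← hc _, ← hf _, hp]
  constructor
  · rintro ⟨k, hk, h1⟩
    exact ⟨⟨_, (hb k hk).1⟩, ⟨_, (hb k hk).2⟩, ⟨k, hk, rfl, rfl⟩, h1⟩
  · rintro ⟨c, v, ⟨k, hk, e, e'⟩, h1⟩
    exact ⟨k, hk, by rwa [e, e']⟩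

theorem runs_checkForced (hW : WordBound B W) (hs : s.Bounded B) (hK : Sizes n L M K)
    (h : Checkable G π L M τ S s) :
    Runs B W checkForced s fun t s' => t ≤ 200 * K ∧ Checkable G π L M τ S s' ∧
      (0 < s'.arr 18 0 ↔ 0 < s.arr 18 0 ∨ ∃ v v', π v v' ∧ Forced G π (InClique G) v ∧
        Forced G π (InClique G) v' ∧ v ≠ v' ∧ ¬ MayPrecede G π (InClique G) τ v v') := by
  apply Runs.flagLoop hW hs M h.reg_two (by decide) (by decide) (by decide) (by decide) (by decide)
  intro t g ht hg
  refine ⟨ht.trans (time_le₁ hK.M_le hK.one_le (by decide)),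
    h.congr (by simp) (by simp) fun a ha => by simp [show a ≠ 18 by omega], ?_⟩
  obtain ⟨hb, hp⟩ : Fact G π L M s.arr 2 := h.pairs
  have hf : Fact G π L M s.arr 12 := h.forced
  simp only [Function.update_self]
  rw [hg]
  refine or_congr Iff.rfl ?_
  simp only [Test.Holds, flag_holds, entry_val, Expr.val,
    Store.setReg_arr, Store.setReg_reg_self, ne_eq, OfNat.zero_ne_ofNat,
    not_false_eq_true, Store.setReg_reg_of_ne, h.reg_zero, and_true, ← h.violation, ← hf _, hp]
  constructor
  · rintro ⟨k, hk, h1, h2, h3, h4⟩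
    exact ⟨⟨_, (hb k hk).1⟩, ⟨_, (hb k hk).2⟩, ⟨k, hk, rfl, rfl⟩, h1, h2,
      fun h => h3 (congrArg Fin.val h), h4⟩
  · rintro ⟨v, v', ⟨k, hk, e, e'⟩, h1, h2, h3, h4⟩
    exact ⟨k, hk, by rwa [e], by rwa [e'], fun h => h3 (Fin.ext (by omega)), by rwa [e, e']⟩

theorem runs_checkPlaced (hW : WordBound B W) (hs : s.Bounded B) (hK : Sizes n L M K)
    (h : Checkable G π L M τ S s) :
    Runs B W checkPlaced s fun t s' => t ≤ 200 * K ∧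
      (0 < s'.arr 18 0 ↔ 0 < s.arr 18 0 ∨ ∃ d, InClique G d ∧ ¬ S d) := by
  apply Runs.flagLoop hW hs n h.reg_zero (by decide) (by decide) (by decide) (by decide) (by decide)
  intro t g ht hg
  refine ⟨ht.trans (time_le₁ hK.n_le hK.one_le (by decide)), ?_⟩
  have hc : Fact G π L M s.arr 7 := h.clique
  simp only [Function.update_self]
  rw [hg]
  refine or_congr Iff.rfl ?_
  simp only [Test.Holds, flag_holds, Expr.val, Store.setReg_arr, Store.setReg_reg_self, and_true,
    ← h.placed, ← hc _]
  exact ⟨fun ⟨k, hk, h1⟩ => ⟨⟨k, hk⟩, h1⟩, fun ⟨d, h1⟩ => ⟨d, d.2, h1⟩⟩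

theorem runs_checks (hW : WordBound B W) (hs : s.Bounded B) (hK : Sizes n L M K)
    (hπ : ∀ x, π x x) (h : Enumerated G π L M τ S s) (h17 : ∀ i, s.arr 17 i = 0)
    (h18 : ∀ i, s.arr 18 i = 0) :
    Runs B W checks s fun t s' => t ≤ 1000 * K ∧
      (s'.arr 18 0 = 0 ↔ Insertable G π (InClique G) τ ∧ ∀ d, InClique G d → S d) := by
  refine Runs.seq ((runs_violationTable hW hs hK hπ h h17).mono fun t₁ s hs ⟨h₁, h, e₁⟩ => ?_)
  refine Runs.seq ((runs_checkTotal hW hs hK h).mono fun t₂ s hs ⟨h₂, h, e₂⟩ => ?_)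
  refine Runs.seq ((runs_checkClique hW hs hK h).mono fun t₃ s hs ⟨h₃, h, e₃⟩ => ?_)
  refine Runs.seq ((runs_checkForced hW hs hK h).mono fun t₄ s hs ⟨h₄, h, e₄⟩ => ?_)
  refine (runs_checkPlaced hW hs hK h).mono fun t₅ s hs ⟨h₅, e₅⟩ => ⟨by omega, ?_⟩
  rw [e₄, e₃, e₂, e₁, h18] at e₅
  rw [← not_iff_not, show (¬ s.arr 18 0 = 0) = (0 < s.arr 18 0) from
    propext Nat.pos_iff_ne_zero.symm, e₅]
  simp only [lt_irrefl, false_or]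
  constructor
  · rintro ((((⟨v, v', h1, h2, h3, h4, h5⟩) | ⟨c, v, h1, h2, h3, h4⟩) |
      ⟨v, v', h1, h2, h3, h4, h5⟩) | ⟨d, h1, h2⟩) ⟨hins, hall⟩
    · exact (hins.total v v' h1 h2 h3).elim h4 h5
    · exact h4 (hins.clique c v h2 h3 h1)
    · exact h5 (hins.forced v v' h2 h3 h4 h1)
    · exact h2 (hall d h1)
  · intro hnot
    by_contra! hcon
    obtain ⟨⟨⟨h1, h2⟩, h3⟩, h4⟩ := hcon
    refine hnot ⟨⟨fun v v' hv hv' hne => ?_, fun c v hc hv h => h2 c v h hc hv,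
      fun v v' hv hv' hne h => h3 v v' h hv hv' hne⟩, h4⟩
    by_contra! hcon
    exact hcon.2 (h1 v v' hv hv' hne hcon.1)

end Checks

/-! ### The decision procedure -/

/-- The program which decides whether some LBFS ordering extends the partial order. -/
def decideExtendable : Cmd :=
  .seq tables (.seq greedy (.seq checks (.assign 0 (.sub (.lit 1) (.get 18 (.lit 0))))))

section Correctness

variable {n : ℕ} {G : SimpleGraph (Fin n)} {π : Fin n → Fin n → Prop} {L M : ℕ} {s₀ s : Store}

/-- Letting a clique vertex have itself as its only item gives precedence inside the clique the same
shape as the lexicographic condition: the second vertex may not show its item before the first one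
has shown one that the second lacks. -/
theorem itemTable_clique {arr : ℕ → ℕ → ℕ} (h8 : Fact G π L M arr 8) {x c : Fin n}
    (hx : InClique G x) (hc : InClique G c) : 0 < arr 8 (x * n + c) ↔ x = c := by
  rw [h8 x c]; simp [hx, hc]

theorem itemTable_indep {arr : ℕ → ℕ → ℕ} (h8 : Fact G π L M arr 8) {x c : Fin n}
    (hx : ¬ InClique G x) (hc : InClique G c) : 0 < arr 8 (x * n + c) ↔ G.Adj x c := by
  rw [h8 x c]; simp [hx, hc]

theorem GreedyInv.inClique (h : GreedyInv s₀ s) (hU : Upto G π L M 14 s₀) {d : Fin n}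
    (hd : 0 < s.arr 16 d) : InClique G d := by
  have h7 : Fact G π L M s₀.arr 7 := hU.fact 7 (by decide)
  exact (h7 d).1 (h.placed d hd).2.1

theorem GreedyInv.cliqueOrder (h : GreedyInv s₀ s) (hU : Upto G π L M 14 s₀)
    (hI : ∀ u v, ¬ InClique G u → ¬ InClique G v → ¬ G.Adj u v) (hπ : ∀ x, π x x)
    (hall : ∀ d : Fin n, InClique G d → 0 < s.arr 16 d) :
    CliqueOrder G π (InClique G) fun d : Fin n => s.arr 15 d := by
  classical
  obtain ⟨hb, hp⟩ : Fact G π L M s₀.arr 2 := hU.fact 2 (by decide)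
  have h5 : Fact G π L M s₀.arr 5 := hU.fact 5 (by decide)
  have h8 : Fact G π L M s₀.arr 8 := hU.fact 8 (by decide)
  have h12 : Fact G π L M s₀.arr 12 := hU.fact 12 (by decide)
  have h13 : Fact G π L M s₀.arr 13 := hU.fact 13 (by decide)
  have hr0 := hU.reg_zero
  have hr2 := hU.reg_two
  constructor
  · intro c d hc hd hcd
    exact Fin.ext (h.inj c d (hall c hc) (hall d hd) hcd)
  · intro c hc
    have : s.reg 6 = cliqueCount (InClique G) := by
      rw [h.card, hr0]
      exact card_range_filter (P := fun d => 0 < s.arr 16 d) (R := InClique G)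
        fun l => ⟨h.inClique hU, hall l⟩
    rw [← this]
    exact (h.placed c (hall c hc)).2.2
  · intro c d hc hd hcd hne
    obtain ⟨p, hpM, e1, e2⟩ := (hp c d).1 hcd
    have hit := h.item d p (hall d hd) (hr2 ▸ hpM)
    rw [e1, e2, hr0, h13 p hpM c d e1 e2, itemTable_clique h8 hd hd, itemTable_clique h8 hc hd] at hit
    rcases hit with (hit | hit) | hit | hit | ⟨x, hx, hxd, hit, _⟩
    · exact absurd hc hit.1
    · exact absurd (iff_of_true hc hd) hit
    · exact absurd rfl hit
    · exact absurd hit hne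
    · obtain ⟨x, rfl⟩ : ∃ y : Fin n, x = y := ⟨⟨x, hr0 ▸ (h.placed x hx).1⟩, rfl⟩
      rw [itemTable_clique h8 hc (h.inClique hU hx)] at hit
      rwa [hit]
  · intro v d hv hd hvd
    -- The initial-segment test is attached to first components of pairs, and reflexivity makes
    -- every forced vertex one.
    obtain ⟨p, hpM, e1, e2⟩ := (hp v v).1 (hπ v)
    have hin := h.initial d p (hall d hd) (hr2 ▸ hpM)
    rw [e1, hr0, h12, itemTable_indep h8 hv.1 hd, h5] at hin
    exact hin hv hvd
  · intro v w b hvw hv hw hvF hwb hvb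
    obtain ⟨p, hpM, e1, e2⟩ := (hp v w).1 hvw
    have hbC : InClique G b := by by_contra hb; exact hI w b hw hb hwb
    have hit := h.item b p (hall b hbC) (hr2 ▸ hpM)
    rw [e1, e2, hr0, h13 p hpM v w e1 e2, itemTable_indep h8 hw hbC, itemTable_indep h8 hv hbC] at hit
    rcases hit with (hit | hit) | hit | hit | ⟨x, hx, hxd, hit, hit'⟩
    · exact absurd hit hvF
    · exact absurd (iff_of_false hv hw) hit
    · exact absurd hwb hit
    · exact absurd hit hvb
    · obtain ⟨x, rfl⟩ : ∃ y : Fin n, x = y := ⟨⟨x, hr0 ▸ (h.placed x hx).1⟩, rfl⟩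
      rw [itemTable_indep h8 hv (h.inClique hU hx)] at hit
      rw [itemTable_indep h8 hw (h.inClique hU hx)] at hit'
      exact ⟨x, hit, hit', hxd⟩

theorem GreedyInv.exists_not_blocks (h : GreedyInv s₀ s) (hU : Upto G π L M 14 s₀)
    (hI : ∀ u v, ¬ InClique G u → ¬ InClique G v → ¬ G.Adj u v)
    (hav : ∀ S : Fin n → Prop, (∃ d, InClique G d ∧ ¬ S d) →
      ∃ d, InClique G d ∧ ¬ S d ∧ (∀ c, InClique G c → π c d → c ≠ d → S c) ∧
      (∀ v, Forced G π (InClique G) v → ¬ G.Adj v d → ∀ c, G.Adj v c → S c) ∧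
      (∀ v w, π v w → ¬ InClique G v → ¬ InClique G w → ¬ Forced G π (InClique G) v → G.Adj w d →
        ¬ G.Adj v d → ∃ a, G.Adj v a ∧ ¬ G.Adj w a ∧ S a))
    (hex : ∃ d < s₀.reg 0, 0 < s₀.arr 7 d ∧ ¬ 0 < s.arr 16 d) :
    ∃ d < s₀.reg 0, 0 < s₀.arr 7 d ∧ ¬ 0 < s.arr 16 d ∧ ∀ p < s₀.reg 2, ¬ Blocks s d p := by
  classical
  obtain ⟨hb, hp⟩ : Fact G π L M s₀.arr 2 := hU.fact 2 (by decide)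
  have h5 : Fact G π L M s₀.arr 5 := hU.fact 5 (by decide)
  have h7 : Fact G π L M s₀.arr 7 := hU.fact 7 (by decide)
  have h8 : Fact G π L M s₀.arr 8 := hU.fact 8 (by decide)
  have h12 : Fact G π L M s₀.arr 12 := hU.fact 12 (by decide)
  have h13 : Fact G π L M s₀.arr 13 := hU.fact 13 (by decide)
  have hr0 := hU.reg_zero
  have hr2 := hU.reg_two
  obtain ⟨d₀, hd₀, hdC₀, hdS₀⟩ := hex
  obtain ⟨d, hdC, hdS, ho, hi, hl⟩ := hav (fun d => 0 < s.arr 16 d)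
    ⟨⟨d₀, hr0 ▸ hd₀⟩, (h7 ⟨d₀, hr0 ▸ hd₀⟩).1 hdC₀, hdS₀⟩
  refine ⟨d, hr0 ▸ d.2, (h7 d).2 hdC, hdS, fun p hpM hblk => ?_⟩
  have hpM' : p < M := hr2 ▸ hpM
  obtain ⟨v, hv⟩ : ∃ v : Fin n, s₀.arr 2 p = v := ⟨⟨_, (hb p hpM').1⟩, rfl⟩
  obtain ⟨w, hw⟩ : ∃ w : Fin n, s₀.arr 3 p = w := ⟨⟨_, (hb p hpM').2⟩, rfl⟩
  have hvw : π v w := (hp v w).2 ⟨p, hpM', hv, hw⟩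
  unfold Blocks at hblk
  rw [h.arr 8 (by decide), h.arr 3 (by decide), h.arr 2 (by decide), h.arr 12 (by decide),
    h.arr 5 (by decide), h.reg_zero, h.satisfied p hpM, hv, hw, hr0, h13 p hpM' v w hv hw, h12,
    h5] at hblk
  rcases hblk with ⟨hsat, hwd, hvd⟩ | ⟨hvF, hvd, hlt⟩
  · push Not at hsat
    obtain ⟨⟨hvF, hiff⟩, hno⟩ := hsat
    by_cases hvC : InClique G v
    · have hwC := hiff.1 hvC
      rw [itemTable_clique h8 hwC hdC] at hwd
      rw [itemTable_clique h8 hvC hdC] at hvd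
      subst hwd
      have := hno v (ho v hvC hvw hvd) ((itemTable_clique h8 hvC hvC).2 rfl)
      exact hvd ((itemTable_clique h8 hwC hvC).1 this).symm
    · have hwC : ¬ InClique G w := fun h => hvC (hiff.2 h)
      rw [itemTable_indep h8 hwC hdC] at hwd
      rw [itemTable_indep h8 hvC hdC] at hvd
      obtain ⟨a, hva, hwa, haS⟩ := hl v w hvw hvC hwC hvF hwd hvd
      have haC : InClique G a := by by_contra haC; exact hI v a hvC haC hva
      have := hno a haS ((itemTable_indep h8 hvC haC).2 hva)
      exact hwa ((itemTable_indep h8 hwC haC).1 this)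
  · rw [itemTable_indep h8 hvF.1 hdC] at hvd
    -- The program compares only numbers. All neighbors of `v` have been placed, so the number of
    -- placed vertices is large enough.
    have : nbrCount G v ≤ s.reg 6 := by
      have hcard : s.reg 6 = (Finset.univ.filter fun c : Fin n => 0 < s.arr 16 c).card := by
        rw [h.card, hr0]
        exact card_range_filter (P := fun d => 0 < s.arr 16 d) fun _ => Iff.rfl
      rw [hcard]
      refine Finset.card_le_card fun c hc => ?_
      simp only [Finset.mem_filter, Finset.mem_univ, true_and] at hc ⊢
      exact hi v hvF hvd c hc
    omega

theorem runs_decideExtendable {B W : ℕ} (hW : WordBound B W) (hs : s.Bounded B)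
    (hK : Sizes n L M (n * M)) (hU : Upto G π L M 4 s) (hG : IsSplitGraph G)
    (hπ : IsPartialOrder (Fin n) π) :
    Runs B W decideExtendable s fun t s' => t ≤ 4000 * (n * M) ∧
      (LBFSExtendable G π → s'.reg 0 = 1) ∧ (¬ LBFSExtendable G π → s'.reg 0 = 0) := by
  obtain ⟨hC, hI⟩ := inClique_partition hG
  refine Runs.seq ((runs_tables hW hs hK hU).mono fun t₁ s₁ hs₁ ⟨ht₁, hU₁⟩ => ?_)
  refine Runs.seq ((runs_greedy hW hs₁ hU₁.reg_six (hU₁.empty 14 (by decide))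
    (hU₁.empty 16 (by decide))).mono fun t₂ s₂ hs₂ ⟨hinv, ht₂, hcomplete⟩ => ?_)
  have hE : Enumerated G π L M (fun d => s₂.arr 15 d) (fun d => 0 < s₂.arr 16 d) s₂ := by
    have hf : ∀ j < 13, Fact G π L M s₂.arr j := fun j hj =>
      (hU₁.fact j (by omega)).congr (hinv.arr 1 (by decide)) (hinv.arr 2 (by decide))
        (hinv.arr 3 (by decide)) (hinv.arr j (by
          simp only [List.mem_cons, List.not_mem_nil, or_false]; omega))
    exact ⟨hinv.reg_zero.trans hU₁.reg_zero, hinv.reg_two.trans hU₁.reg_two, hf 2 (by decide),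
      hf 4 (by decide), hf 5 (by decide), hf 7 (by decide), hf 12 (by decide), fun _ => rfl,
      fun _ => Iff.rfl⟩
  apply Runs.seq
  refine (runs_checks hW hs₂ hK hπ.refl hE
    (by rw [hinv.arr 17 (by decide)]; exact hU₁.empty 17 (by decide))
    (by rw [hinv.arr 18 (by decide)]; exact hU₁.empty 18 (by decide))).mono
    fun t₃ s₃ hs₃ ⟨ht₃, hres⟩ => ?_
  apply Runs.assign hW hs₃ (by decide)
  · have := hW.two_le
    simp only [Expr.val]; omega
  have hdec : s₃.arr 18 0 = 0 ↔ LBFSExtendable G π := by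
    rw [hres]
    constructor
    · rintro ⟨hins, hall⟩
      exact exists_ordering_of_cliqueOrder (by simp) hπ hC hI
        (hinv.cliqueOrder hU₁ hI hπ.refl hall) hins
    · rintro ⟨σ, hσ, hext⟩
      have h4 := isLBFSOrdering_iff_fourPoint.1 hσ
      have hinj := σ.symm.injective
      have hall : ∀ d : Fin n, InClique G d → 0 < s₂.arr 16 d := by
        have h7 : Fact G π L M s₁.arr 7 := hU₁.fact 7 (by decide)
        have := hcomplete fun s' hinv' => hinv'.exists_not_blocks hU₁ hI fun S hS =>
          exists_available hinj hC hI h4 hext hπ.refl S hS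
        exact fun d hd => this d (hU₁.reg_zero ▸ d.2) ((h7 d).2 hd)
      -- The initial-segment property used here is that of the computed enumeration, which may
      -- differ from the clique order of `σ`.
      refine ⟨insertable_of_fourPoint hinj hC hI h4 hext ?_, hall⟩
      exact (hinv.cliqueOrder hU₁ hI hπ.refl hall).initial
  refine ⟨?_, fun h => ?_, fun h => ?_⟩
  · rw [hU₁.reg_zero, hU₁.reg_two] at ht₂
    have e : n * (148 * n + 136 * M + 68) = 148 * (n * n) + 136 * (n * M) + 68 * n := by ring
    have := hK.nn_le
    have := hK.n_le
    have := hK.one_le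
    simp only [Expr.cost]
    omega
  · simp [Expr.val, hdec.2 h]
  · have : s₃.arr 18 0 ≠ 0 := fun h' => h (hdec.1 h')
    simp [Expr.val]; omega

theorem inputStore_upto {arcs pairs : List (Fin n × Fin n)} (ha : Lists arcs G.Adj)
    (hp : Lists pairs π) : Upto G π arcs.length pairs.length 4 (inputStore arcs pairs) := by
  have key : ∀ (l : List (Fin n × Fin n)) (r : Fin n → Fin n → Prop), Lists l r →
      (∀ e < l.length, (l.map fun e => (e.1 : ℕ)).getD e 0 < n ∧
        (l.map fun e => (e.2 : ℕ)).getD e 0 < n) ∧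
      ∀ u v : Fin n, r u v ↔ ∃ e < l.length, (l.map fun e => (e.1 : ℕ)).getD e 0 = u ∧
        (l.map fun e => (e.2 : ℕ)).getD e 0 = v := by
    intro l r hl
    have h1 : ∀ e (he : e < l.length), (l.map fun e => (e.1 : ℕ)).getD e 0 = (l[e].1 : ℕ) :=
      fun e he => by simp [List.getD_eq_getElem?_getD, he]
    have h2 : ∀ e (he : e < l.length), (l.map fun e => (e.2 : ℕ)).getD e 0 = (l[e].2 : ℕ) :=
      fun e he => by simp [List.getD_eq_getElem?_getD, he]
    constructor
    · intro e he
      rw [h1 e he, h2 e he]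
      exact ⟨l[e].1.2, l[e].2.2⟩
    · intro u v
      rw [← hl.2, List.mem_iff_getElem]
      constructor
      · rintro ⟨e, he, h⟩
        exact ⟨e, he, by rw [h1 e he, h], by rw [h2 e he, h]⟩
      · rintro ⟨e, he, hu, hv⟩
        rw [h1 e he] at hu
        rw [h2 e he] at hv
        exact ⟨e, he, Prod.ext (Fin.ext hu) (Fin.ext hv)⟩
  refine ⟨rfl, rfl, rfl, rfl, fun j hj => ?_, fun j hj i => ?_⟩
  · interval_cases j
    · exact key arcs G.Adj ha
    · trivial
    · exact key pairs π hp
    · trivial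
  · match j, hj with
    | j + 4, _ => rfl

theorem Lists.length_le {l : List (Fin n × Fin n)} {r : Fin n → Fin n → Prop} (h : Lists l r) :
    l.length ≤ n * n := by
  simpa using h.1.length_le_card

theorem Lists.length_eq {l : List (Fin n × Fin n)} {r : Fin n → Fin n → Prop} (h : Lists l r) :
    l.length = relSize r := by
  classical
  rw [← List.toFinset_card_of_nodup h.1, relSize, ← Set.ncard_coe_finset]
  congr 1
  ext ⟨u, v⟩
  simp [h.2]

theorem le_relSize {r : Fin n → Fin n → Prop} (h : ∀ x, r x x) : n ≤ relSize r := by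
  have h1 : ((fun x : Fin n => (x, x)) '' Set.univ).ncard = n := by
    rw [Set.ncard_image_of_injective _ fun x y h => (Prod.ext_iff.1 h).1]
    simp [Set.ncard_univ]
  calc n = _ := h1.symm
    _ ≤ _ := Set.ncard_le_ncard (by rintro _ ⟨x, _, rfl⟩; exact h x) (Set.toFinite _)

theorem inputStore_bounded {arcs pairs : List (Fin n × Fin n)} (ha : Lists arcs G.Adj)
    (hp : Lists pairs π) {B : ℕ} (hB : n * n < B) (hn : n < B) :
    (inputStore arcs pairs).Bounded B := by
  have key : ∀ (l : List (Fin n × Fin n)) (f : Fin n × Fin n → Fin n) i,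
      (l.map fun e => (f e : ℕ)).getD i 0 < B := by
    intro l f i
    by_cases hi : i < l.length
    · have : (l.map fun e => (f e : ℕ)).getD i 0 = (f l[i] : ℕ) := by
        simp [List.getD_eq_getElem?_getD, hi]
      have := (f l[i]).2
      omega
    · have : (l.map fun e => (f e : ℕ)).getD i 0 = 0 := by
        simp [List.getD_eq_getElem?_getD, hi]
      omega
  constructor
  · intro x
    match x with
    | 0 => exact hn
    | 1 => exact lt_of_le_of_lt ha.length_le hB
    | 2 => exact lt_of_le_of_lt hp.length_le hB
    | x + 3 => exact Nat.zero_lt_of_lt hn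
  · intro a i
    match a with
    | 0 => exact key arcs Prod.fst i
    | 1 => exact key arcs Prod.snd i
    | 2 => exact key pairs Prod.fst i
    | 3 => exact key pairs Prod.snd i
    | a + 4 => exact Nat.zero_lt_of_lt hn

end Correctness

end PSOP

/-- There is one program `P` (and constants `k`, `c`) that decides, for every connected split graph
`G` on `n` vertices and every partial order `π` on its vertex set, whether some LBFS ordering of `G`
extends `π`, in at most `c * (n * |π|)` steps of a word RAM with words of `k * ⌈log₂ (n + 1)⌉` bits;
the answer (`1` for yes, `0` for no) is left in register `0`. -/
theorem mainTheorem5 :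
    ∃ (P : PSOP.Cmd) (k c : ℕ),
      ∀ (n : ℕ) (G : SimpleGraph (Fin n)) (π : Fin n → Fin n → Prop),
        G.Connected → PSOP.IsSplitGraph G → IsPartialOrder (Fin n) π →
        ∀ arcs pairs : List (Fin n × Fin n),
          PSOP.Lists arcs G.Adj → PSOP.Lists pairs π →
          ∃ (t : ℕ) (s : PSOP.Store),
            PSOP.Exec (2 ^ (k * Nat.size n)) P (PSOP.inputStore arcs pairs) t s ∧
            t ≤ c * (n * PSOP.relSize π) ∧
            (PSOP.LBFSExtendable G π → s.reg 0 = 1) ∧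
            (¬ PSOP.LBFSExtendable G π → s.reg 0 = 0) := by
  -- Memory contents stay below `B = 2 ^ (4 * n.size)`, which exceeds n² and hence both list
  -- lengths. The factor 24 makes the number of words equal to `B ^ 6`, and 6 bounds the heights of
  -- the expressions in the program.
  refine ⟨PSOP.decideExtendable, 24, 4000, fun n G π hconn hsplit hπ arcs pairs ha hp => ?_⟩
  have hn : 1 ≤ n := by
    obtain ⟨x⟩ := hconn.nonempty
    exact Nat.one_le_of_lt x.2
  have hsize : n < 2 ^ n.size := Nat.lt_size_self n
  have hsq : n * n < 2 ^ (4 * n.size) := by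
    calc n * n < 2 ^ n.size * 2 ^ n.size := Nat.mul_lt_mul'' hsize hsize
      _ = 2 ^ (2 * n.size) := by rw [← pow_add]; congr 1; ring
      _ ≤ _ := Nat.pow_le_pow_right (by decide) (by omega)
  have hn' : n < 2 ^ (4 * n.size) := lt_of_le_of_lt (Nat.le_mul_self n) hsq
  have hW : PSOP.WordBound (2 ^ (4 * n.size)) (2 ^ (24 * n.size)) :=
    ⟨by omega, by rw [← pow_mul]; exact (congrArg _ (by ring)).le⟩
  -- Counting reflexive pairs in |π| is essential here: it lets n · |π| absorb the quadratic costs.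
  have hM : n ≤ pairs.length := by
    rw [hp.length_eq]
    exact PSOP.le_relSize hπ.refl
  have hnM : n * n ≤ n * pairs.length := Nat.mul_le_mul_left n hM
  have hK : PSOP.Sizes n arcs.length pairs.length (n * pairs.length) :=
    ⟨Nat.mul_pos hn (by omega), (Nat.le_mul_self n).trans hnM, hnM, ha.length_le.trans hnM,
      Nat.le_mul_of_pos_left _ hn, le_rfl⟩
  obtain ⟨t, s, he, _, ht, hs⟩ := PSOP.runs_decideExtendable hW
    (PSOP.inputStore_bounded ha hp hsq hn') hK (PSOP.inputStore_upto ha hp) hsplit hπ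
  exact ⟨t, s, he, by rwa [← hp.length_eq], hs⟩
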